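/- **Setting.** Let $H$ be a separable infinite-dimensional complex Hilbert space and let $\Phi:B(H)\to B(H)$ be a completely positive linear map that is normal ($\Phi(\sup_\lambda A_\lambda)=\sup_\lambda\Phi(A_\lambda)$ for increasing nets with a supremum) and subunital ($\Phi(I)\le I$). Let $\Phi_*$ be its predual map on trace class operators, $\operatorname{Tr}\Phi_*(\rho)A=\operatorname{Tr}\Phi(A)\rho$. Let $G$ be a positive (semidefinite) self-adjoint operator on $H$ with dense domain $D(G)$ such that $$\inf\{\|G\varphi\| : \varphi\in D(G),\ \|\varphi\|=1\}=0.$$ A state is a positive trace class operator $\rho$ with $\operatorname{Tr}\rho=1$. For a positive trace class operator $\rho=\sum_i|\varphi_i\rangle\langle\varphi_i|$ put $\operatorname{Tr}G\rho=\sum_i\|\sqrt G\varphi_i\|^2\in[0,\infty]$ (with $\|\sqrt G\varphi\|=\infty$ if $\varphi\notin D(\sqrt G)$). The map $\Phi$ is called $G$-limited if $\operatorname{Tr}G\Phi_*(\rho)<\infty$ for every state $\rho$ with $\operatorname{Tr}G\rho<\infty$. For $E>0$ put $$Y_\Phi(E)=\sup\{\operatorname{Tr}G\Phi_*(\rho):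 \rho \text{ a state},\ \operatorname{Tr}G\rho\le E\}.$$ A linear operator $A:D(\sqrt G)\to H$ is $\sqrt G$-bounded if, for some $a,b\ge 0$, $$\|A\varphi\|^2\le a^2\|\varphi\|^2+b^2\|\sqrt G\varphi\|^2\quad\text{for all }\varphi\in D(\sqrt G);$$ its $\sqrt G$-bound $b_{\sqrt G}(A)$ is the infimum of the $b\ge0$ that occur here, and $A$ is $\sqrt G$-infinitesimal if $b_{\sqrt G}(A)=0$. Let $B_G(H)$ be the space of $\sqrt G$-bounded operators (operators that coincide on $D(\sqrt G)$ are identified, and $B(H)$ is mapped into $B_G(H)$ by restriction), with the operator $E$-norms $$\|A\|_E^G=\sup\Big\{\sqrt{\operatorname{Tr}A\rho A^*}: \rho \text{ a state},\ \operatorname{Tr}G\rho\le E\Big\},\qquad \operatorname{Tr}A\rho A^*=\sum_i\|A\varphi_i\|^2\ \text{ for }\ \rho=\sum_i|\varphi_i\rangle\langle\varphi_i|$$ (the supremum of the empty set being $0$). A Stinespring representation of $\Phi$ is $\Phi(A)=V^*(A\otimes I_K)V$, $A\in B(H)$, with a separable Hilbert space $K$ and a bounded operator $V:H\to H\otimes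 K$; it is minimal if the linear span of the vectors $(A\otimes I_K)V\varphi$ is dense in $H\otimes K$, and the Choi rank of $\Phi$ is $\dim K$ for a minimal representation. **(A)** Suppose that $\Phi$ is $G$-limited. Then $\Phi$ is continuous on $B(H)$ with respect to the norm $\|\cdot\|_E^G$ for every $E>0$, and $Y_\Phi(E)<\infty$ for every $E>0$. Moreover, there is a linear map $\widehat\Phi:B_G(H)\to B_G(H)$ that extends $\Phi$ and has the following properties. 1. For every Stinespring representation $(K,V)$ of $\Phi$, $\widehat\Phi$ is the unique linear map on $B_G(H)$ given by $\widehat\Phi(A)\varphi=V^*(A\otimes I_K)V\varphi$ for $\varphi\in D(\sqrt G)$. Here $V$ maps $D(\sqrt G)$ into $D(\sqrt G\otimes I_K)$, and $A\otimes I_K$ denotes the unique $\sqrt G\otimes I_K$-bounded linear extension of $A\otimes I_K$ from $D(\sqrt G)\otimes K$ to $D(\sqrt G\otimes I_K)$. In particular $\widehat\Phi$ does not depend on the representation. 2. For all $E>0$ and $A\in B_G(H)$, $$\|\widehat\Phi(A)\|_E^G\le\sqrt{\|\Phi(I)\|}\,\|A\|^G_{Y_\Phi(E)}\le\sqrt{\max\{1,Y_\Phi(E)/E\}\,\|\Phi(I)\|}\;\|A\|_E^G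 .$$ 3. The limit $k_\Phi=\lim_{E\to+\infty}Y_\Phi(E)/E$ exists and is finite, and $b_{\sqrt G}(\widehat\Phi(A))\le\sqrt{k_\Phi\|\Phi(I)\|}\;b_{\sqrt G}(A)$ for all $A\in B_G(H)$. In particular, $\widehat\Phi$ maps $\sqrt G$-infinitesimal operators to $\sqrt G$-infinitesimal operators. **(B)** Suppose that $G$ is discrete, i.e. $G=\sum_{k\ge0}E_k|\tau_k\rangle\langle\tau_k|$ with an orthonormal basis $(\tau_k)$ of $H$, a nondecreasing sequence $E_k\to+\infty$, and $D(G)=\{\varphi:\sum_kE_k^2|\langle\tau_k|\varphi\rangle|^2<\infty\}$. Suppose also that $\Phi$ has finite Choi rank or that $\Phi(I)=\Phi(P)$ for some finite-rank orthogonal projector $P$. If $\Phi$ is continuous on $B(H)$ with respect to $\|\cdot\|_E^G$ for some $E>0$, then $\Phi$ is $G$-limited. -/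

import Mathlib

open scoped InnerProductSpace TensorProduct CStarAlgebra ENNReal Topology

namespace EnergyOp

/-- `G` is a positive (semidefinite) self-adjoint, in general unbounded, operator on `H`. Its domain
is automatically dense. -/
structure IsPosSelfAdjoint {H : Type*} [NormedAddCommGroup H] [InnerProductSpace ℂ H]
    [CompleteSpace H] (G : H →ₗ.[ℂ] H) : Prop where
  isSelfAdjoint : IsSelfAdjoint G
  nonneg : ∀ x : G.domain, 0 ≤ (⟪(x : H), G x⟫_ℂ).re

/-- `S = √G`: the operator `S` is positive, self-adjoint and `S² = G`, including domains. -/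
structure IsPosSqrt {H : Type*} [NormedAddCommGroup H] [InnerProductSpace ℂ H]
    [CompleteSpace H] (S G : H →ₗ.[ℂ] H) : Prop where
  posSelfAdjoint : IsPosSelfAdjoint S
  mem_domain : ∀ x : H, x ∈ G.domain ↔ ∃ hx : x ∈ S.domain, S ⟨x, hx⟩ ∈ S.domain
  apply_eq : ∀ (x : G.domain) (hx : (x : H) ∈ S.domain) (hSx : S ⟨x, hx⟩ ∈ S.domain),
    G x = S ⟨S ⟨x, hx⟩, hSx⟩

section Sqrt

variable {H : Type*} [NormedAddCommGroup H] [InnerProductSpace ℂ H] [CompleteSpace H]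

theorem IsPosSelfAdjoint.inner_symm {G : H →ₗ.[ℂ] H} (hG : IsPosSelfAdjoint G)
    (x y : G.domain) : ⟪G x, (y : H)⟫_ℂ = ⟪(x : H), G y⟫_ℂ := by
  have h := LinearPMap.adjoint_isFormalAdjoint hG.isSelfAdjoint.dense_domain
  rw [LinearPMap.isSelfAdjoint_def.1 hG.isSelfAdjoint] at h
  exact h x y

/-- The bounded inverse of `1 + G`. -/
theorem IsPosSelfAdjoint.exists_resolvent {G : H →ₗ.[ℂ] H} (hG : IsPosSelfAdjoint G) :
    ∃ R : H →L[ℂ] H, 0 ≤ R ∧ R ≤ 1 ∧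
      (∀ y : H, ∃ h : R y ∈ G.domain, G ⟨R y, h⟩ = y - R y) ∧
      ∀ x : G.domain, R (x + G x) = x := by
  have hadj := LinearPMap.isSelfAdjoint_def.1 hG.isSelfAdjoint
  have hd := hG.isSelfAdjoint.dense_domain
  let T : G.domain →ₗ[ℂ] H := G.domain.subtype + G.toFun
  have hT : ∀ x : G.domain, T x = x + G x := fun x => rfl
  have hlow : ∀ x : G.domain, ‖(x : H)‖ ≤ ‖T x‖ := by
    intro x
    by_cases hx : ‖(x : H)‖ = 0
    · rw [hx]; exact norm_nonneg _
    have h1 : ‖(x : H)‖ ^ 2 ≤ (⟪(x : H), T x⟫_ℂ).re := by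
      rw [hT, inner_add_right, Complex.add_re]
      have := inner_self_eq_norm_sq (𝕜 := ℂ) (x : H)
      have h2 := hG.nonneg x
      simp only [RCLike.re_to_complex] at this
      linarith
    have h2 : (⟪(x : H), T x⟫_ℂ).re ≤ ‖(x : H)‖ * ‖T x‖ :=
      (Complex.re_le_norm _).trans (norm_inner_le_norm _ _)
    have h3 : 0 < ‖(x : H)‖ := lt_of_le_of_ne (norm_nonneg _) (Ne.symm hx)
    nlinarith
  have hinj : Function.Injective T := by
    rw [← LinearMap.ker_eq_bot, LinearMap.ker_eq_bot']
    intro x hx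
    have := hlow x
    rw [hx, norm_zero] at this
    exact Subtype.ext (norm_le_zero_iff.1 this)
  have hclosed : IsClosed (LinearMap.range T : Set H) := by
    rw [← isSeqClosed_iff_isClosed]
    intro y y0 hy hlim
    choose x hx using hy
    have hc : CauchySeq fun n => (x n : H) := by
      have hc := hlim.cauchySeq
      rw [Metric.cauchySeq_iff'] at hc ⊢
      intro ε hε
      obtain ⟨N, hN⟩ := hc ε hε
      refine ⟨N, fun n hn => lt_of_le_of_lt ?_ (hN n hn)⟩
      rw [dist_eq_norm, dist_eq_norm, ← hx, ← hx, ← map_sub]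
      exact hlow (x n - x N)
    obtain ⟨x0, hx0⟩ := cauchySeq_tendsto_of_complete hc
    have hg : Filter.Tendsto (fun n => G (x n)) Filter.atTop (𝓝 (y0 - x0)) := by
      have := hlim.sub hx0
      refine this.congr fun n => ?_
      rw [← hx, hT]; abel
    have hmem : (x0, y0 - x0) ∈ G.graph :=
      hG.isSelfAdjoint.isClosed.isSeqClosed (x := fun n => ((x n : H), G (x n)))
        (fun n => G.mem_graph (x n)) (hx0.prodMk_nhds hg)
    obtain ⟨z, hz1, hz2⟩ := (LinearPMap.mem_graph_iff _).1 hmem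
    refine ⟨z, ?_⟩
    rw [hT, hz1, hz2]; exact add_sub_cancel x0 y0
  have hsurj : LinearMap.range T = ⊤ := by
    have : CompleteSpace (LinearMap.range T) := hclosed.completeSpace_coe
    rw [← Submodule.orthogonal_eq_bot_iff, Submodule.eq_bot_iff]
    intro y hy
    rw [Submodule.mem_orthogonal'] at hy
    have hy' : ∀ x : G.domain, ⟪-y, (x : H)⟫_ℂ = ⟪y, G x⟫_ℂ := by
      intro x
      have := hy (T x) ⟨x, rfl⟩
      rw [hT, inner_add_right] at this
      rw [inner_neg_left]
      linear_combination -this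
    have hyd : y ∈ G.adjoint.domain := LinearPMap.mem_adjoint_domain_of_exists y ⟨-y, hy'⟩
    have hGy := LinearPMap.adjoint_apply_eq hd ⟨y, hyd⟩ hy'
    have hyg : ∃ h : y ∈ G.domain, G ⟨y, h⟩ = -y := by
      rw [hadj] at hyd
      refine ⟨hyd, ?_⟩
      have h2 := @(LinearPMap.ext_iff.1 hadj.symm).2 y
      exact h2.trans hGy
    obtain ⟨h, hyy⟩ := hyg
    have := hlow ⟨y, h⟩
    rw [hT, hyy] at this
    simpa using this
  let e := LinearEquiv.ofBijective T ⟨hinj, LinearMap.range_eq_top.1 hsurj⟩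
  have he : ∀ y, ((e.symm y : G.domain) : H) + G (e.symm y) = y := fun y =>
    e.apply_symm_apply y
  let R : H →L[ℂ] H := LinearMap.mkContinuous (G.domain.subtype ∘ₗ e.symm.toLinearMap) 1 (by
    intro y
    have h := hlow (e.symm y)
    rw [hT, he] at h
    simpa using h)
  have hR : ∀ y, R y = (e.symm y : G.domain) := fun y => rfl
  have hre : ∀ y, ⟪R y, y⟫_ℂ = ⟪R y, R y⟫_ℂ + ⟪R y, G (e.symm y)⟫_ℂ := by
    intro y
    rw [← inner_add_right, hR, he]
  have hRpos : R.IsPositive := by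
    rw [ContinuousLinearMap.isPositive_def]
    refine ⟨?_, fun y => ?_⟩
    · intro y z
      change ⟪R y, z⟫_ℂ = ⟪y, R z⟫_ℂ
      conv_lhs => rw [← he z]
      conv_rhs => rw [← he y]
      rw [inner_add_left, inner_add_right, hR, hR, hG.inner_symm]
    · rw [ContinuousLinearMap.reApplyInnerSelf_apply, hre]
      have h1 := hG.nonneg (e.symm y)
      have h2 := inner_self_nonneg (𝕜 := ℂ) (x := R y)
      rw [map_add]
      exact add_nonneg h2 h1
  have hR1 : (1 - R).IsPositive := by
    rw [ContinuousLinearMap.isPositive_def]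
    refine ⟨?_, fun y => ?_⟩
    · intro y z
      have := hRpos.isSymmetric y z
      simp only [ContinuousLinearMap.coe_coe] at this
      simp [inner_sub_left, inner_sub_right, this]
    · rw [ContinuousLinearMap.reApplyInnerSelf_apply]
      have h0 : (1 - R) y = G (e.symm y) := by
        change y - R y = _
        rw [hR, sub_eq_iff_eq_add', he]
      have h1 := hG.nonneg (e.symm y)
      have h2 := inner_self_nonneg (𝕜 := ℂ) (x := G (e.symm y))
      have h3 : ⟪(1 - R) y, y⟫_ℂ = ⟪G (e.symm y), G (e.symm y)⟫_ℂ +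
          ⟪((e.symm y : G.domain) : H), G (e.symm y)⟫_ℂ := by
        rw [h0, ← hG.inner_symm, ← inner_add_right, add_comm, he]
      rw [h3, map_add]
      exact add_nonneg h2 h1
  refine ⟨R, (ContinuousLinearMap.nonneg_iff_isPositive R).2 hRpos,
    (ContinuousLinearMap.le_def R 1).2 hR1, fun y => ⟨(e.symm y).2, ?_⟩, fun x => ?_⟩
  · have := he y
    change G (e.symm y) = y - _
    rw [hR, eq_sub_iff_add_eq', this]
  · rw [hR]
    have : e.symm (x + G x) = x := e.symm_apply_apply x
    rw [this]

/-- Every positive self-adjoint operator has a positive square root. -/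
theorem IsPosSelfAdjoint.exists_posSqrt {G : H →ₗ.[ℂ] H} (hG : IsPosSelfAdjoint G) :
    ∃ S : H →ₗ.[ℂ] H, IsPosSqrt S G := by
  obtain ⟨R, hR0, hR1, hRG, hRx⟩ := hG.exists_resolvent
  have hR1' : 0 ≤ 1 - R := sub_nonneg.2 hR1
  let P := CFC.sqrt R
  let Q := CFC.sqrt (1 - R)
  have hPP : ∀ x, P (P x) = R x := fun x => by
    have := CFC.sqrt_mul_sqrt_self R hR0
    exact congrArg (fun T : H →L[ℂ] H => T x) this
  have hQQ : ∀ x, Q (Q x) = x - R x := fun x => by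
    have := CFC.sqrt_mul_sqrt_self (1 - R) hR1'
    exact congrArg (fun T : H →L[ℂ] H => T x) this
  have hcomm : Commute P Q := by
    have h1 : Commute R (1 - R) := (Commute.one_right R).sub_right (Commute.refl R)
    exact ((h1.cfcₙ_nnreal NNReal.sqrt).symm.cfcₙ_nnreal NNReal.sqrt).symm
  have hPQ : ∀ x, P (Q x) = Q (P x) := fun x =>
    congrArg (fun T : H →L[ℂ] H => T x) hcomm.eq
  have hPs : ∀ x y, ⟪P x, y⟫_ℂ = ⟪x, P y⟫_ℂ :=
    ((ContinuousLinearMap.nonneg_iff_isPositive P).1 (CFC.sqrt_nonneg R)).isSymmetric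
  have hQs : ∀ x y, ⟪Q x, y⟫_ℂ = ⟪x, Q y⟫_ℂ :=
    ((ContinuousLinearMap.nonneg_iff_isPositive Q).1 (CFC.sqrt_nonneg (1 - R))).isSymmetric
  have hsum : ∀ x, P (P x) + Q (Q x) = x := fun x => by rw [hPP, hQQ]; abel
  have hRinj : ∀ x, R x = 0 → x = 0 := by
    intro x hx
    obtain ⟨h, h'⟩ := hRG x
    have h0 : (⟨R x, h⟩ : G.domain) = 0 := Subtype.ext hx
    rw [h0, LinearPMap.map_zero, hx, sub_zero] at h'
    exact h'.symm
  have hPinj : Function.Injective P := by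
    rw [injective_iff_map_eq_zero]
    intro x hx
    exact hRinj x (by rw [← hPP, hx, map_zero])
  let e := LinearEquiv.ofInjective P.toLinearMap hPinj
  let S : H →ₗ.[ℂ] H := ⟨LinearMap.range P.toLinearMap, Q.toLinearMap ∘ₗ e.symm.toLinearMap⟩
  have hmem : ∀ x, P x ∈ S.domain := fun x => ⟨x, rfl⟩
  have hS : ∀ (x : H) (h : P x ∈ S.domain), S ⟨P x, h⟩ = Q x := by
    intro x h
    change Q (e.symm ⟨P x, h⟩) = Q x
    have : e.symm ⟨P x, h⟩ = x := by
      rw [LinearEquiv.symm_apply_eq]; rfl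
    rw [this]
  have hS' : ∀ y : S.domain, ∃ x, (y : H) = P x ∧ S y = Q x := by
    rintro ⟨y, hy⟩
    obtain ⟨x, hx⟩ := id hy
    change P x = y at hx
    subst hx
    exact ⟨x, rfl, hS x hy⟩
  have hdense : Dense (S.domain : Set H) := by
    rw [Submodule.dense_iff_topologicalClosure_eq_top,
      Submodule.topologicalClosure_eq_top_iff, Submodule.eq_bot_iff]
    intro y hy
    rw [Submodule.mem_orthogonal'] at hy
    apply hPinj
    rw [map_zero]
    have := hy _ (hmem (P y))
    rw [← hPs, inner_self_eq_zero] at this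
    exact this
  have hsym : S.IsFormalAdjoint S := by
    intro x' y'
    obtain ⟨x, hx, hSx⟩ := hS' x'
    obtain ⟨y, hy, hSy⟩ := hS' y'
    rw [hSx, hSy, hx, hy, hQs, hPs, hPQ]
  have hsa : IsSelfAdjoint S := by
    rw [LinearPMap.isSelfAdjoint_def]
    refine le_antisymm ?_ (hsym.le_adjoint hdense)
    have key : ∀ y : S.adjoint.domain,
        (y : H) = P (P y + Q (S.adjoint y)) ∧ S.adjoint y = Q (P y + Q (S.adjoint y)) := by
      intro y
      have h1 : P (S.adjoint y) = Q y := by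
        apply ext_inner_right ℂ
        intro z
        have := LinearPMap.adjoint_isFormalAdjoint hdense y ⟨P z, hmem z⟩
        rw [hS] at this
        rw [hPs, hQs]
        exact this
      constructor
      · rw [map_add, hPQ, h1, hsum]
      · rw [map_add, ← hPQ, ← h1, hsum]
    refine ⟨fun y hy => ?_, ?_⟩
    · have h := (key ⟨y, hy⟩).1
      change y = _ at h
      rw [h]; exact hmem _
    · rintro y ⟨z, hz⟩ hyz
      have h1 : (⟨z, hz⟩ : S.domain) = ⟨P (P y + Q (S.adjoint y)), hmem _⟩ :=
        Subtype.ext (hyz.symm.trans (key y).1)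
      rw [h1, hS]
      exact (key y).2
  have hpos : IsPosSelfAdjoint S := by
    refine ⟨hsa, ?_⟩
    intro x'
    obtain ⟨x, hx, hSx⟩ := hS' x'
    rw [hSx, hx]
    have hPQ0 : 0 ≤ P * Q := hcomm.mul_nonneg (CFC.sqrt_nonneg R) (CFC.sqrt_nonneg (1 - R))
    have := ((ContinuousLinearMap.nonneg_iff_isPositive _).1 hPQ0).re_inner_nonneg_right x
    rw [hPs]
    exact this
  have hdom : ∀ (x : H) (hx : x ∈ S.domain), S ⟨x, hx⟩ ∈ S.domain → ∃ z, x = R z := by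
    intro y hy hSy
    obtain ⟨x, hx, hSx⟩ := hS' ⟨y, hy⟩
    obtain ⟨z, hz, -⟩ := hS' ⟨_, hSy⟩
    change S ⟨y, hy⟩ = P z at hz
    change y = P x at hx
    rw [hSx] at hz
    refine ⟨P x + Q z, ?_⟩
    rw [hx, ← hPP]
    congr 1
    rw [map_add, hPQ, ← hz, hsum]
  refine ⟨S, hpos, fun x => ⟨fun hx => ?_, ?_⟩, ?_⟩
  · have hx' := hRx ⟨x, hx⟩
    rw [← hPP] at hx'
    change P (P _) = x at hx'
    rw [← hx']
    refine ⟨hmem _, ?_⟩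
    rw [hS, ← hPQ]
    exact hmem _
  · rintro ⟨hx, hSx⟩
    obtain ⟨z, rfl⟩ := hdom x hx hSx
    exact (hRG z).1
  · rintro ⟨x, hxG⟩ hx hSx
    obtain ⟨z, rfl⟩ := hdom x hx hSx
    have h1 : (⟨R z, hx⟩ : S.domain) = ⟨P (P z), hmem _⟩ := Subtype.ext (hPP z).symm
    have h2 : S ⟨R z, hx⟩ = P (Q z) := by rw [h1, hS, hPQ]
    have h3 : (⟨S ⟨R z, hx⟩, hSx⟩ : S.domain) = ⟨P (Q z), hmem _⟩ := Subtype.ext h2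
    rw [h3, hS, hQQ]
    exact (hRG z).2

/-- The positive square root `√G` of a positive self-adjoint operator `G`. -/
noncomputable def sqrtOp (G : H →ₗ.[ℂ] H) (hG : IsPosSelfAdjoint G) : H →ₗ.[ℂ] H :=
  hG.exists_posSqrt.choose

theorem sqrtOp_spec (G : H →ₗ.[ℂ] H) (hG : IsPosSelfAdjoint G) : IsPosSqrt (sqrtOp G hG) G :=
  hG.exists_posSqrt.choose_spec

end Sqrt

section Trace

variable {H : Type*} [NormedAddCommGroup H] [InnerProductSpace ℂ H] [CompleteSpace H]

/-- A fixed orthonormal basis of `H`; the traces below do not depend on it. -/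
noncomputable def stdBasis (H : Type*) [NormedAddCommGroup H] [InnerProductSpace ℂ H]
    [CompleteSpace H] : HilbertBasis (exists_hilbertBasis ℂ H).choose ℂ H :=
  (exists_hilbertBasis ℂ H).choose_spec.choose

/-- The trace `Tr X = ∑ᵢ ⟨eᵢ, X eᵢ⟩` (of a trace class operator `X`). -/
noncomputable def opTrace (X : H →L[ℂ] H) : ℂ :=
  ∑' i, ⟪stdBasis H i, X (stdBasis H i)⟫_ℂ

/-- `ρ` is a positive trace class operator. -/
def IsPosTraceClass (ρ : H →L[ℂ] H) : Prop :=
  0 ≤ ρ ∧ Summable fun i => ⟪stdBasis H i, ρ (stdBasis H i)⟫_ℂ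

/-- `ρ` is a state: a positive trace class operator of unit trace. -/
def IsState (ρ : H →L[ℂ] H) : Prop :=
  IsPosTraceClass ρ ∧ opTrace ρ = 1

open scoped Classical in
/-- `‖T φ‖² ∈ [0, ∞]`, which is `∞` for `φ` outside the domain of `T`. -/
noncomputable def sqNorm (T : H →ₗ.[ℂ] H) (φ : H) : ℝ≥0∞ :=
  if h : φ ∈ T.domain then ‖T ⟨φ, h⟩‖ₑ ^ 2 else ⊤

/-- `Tr T ρ T* ∈ [0, ∞]` for a positive operator `ρ`, computed as `∑ᵢ ‖T φᵢ‖²` from the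
decomposition `ρ = ∑ᵢ |φᵢ⟩⟨φᵢ|` with `φᵢ = √ρ eᵢ`. -/
noncomputable def trConj (T : H →ₗ.[ℂ] H) (ρ : H →L[ℂ] H) : ℝ≥0∞ :=
  ∑' i, sqNorm T (CFC.sqrt ρ (stdBasis H i))

/-- The energy `Tr G ρ ∈ [0, ∞]` of a positive operator `ρ`, i.e. `Tr √G ρ √G`. -/
noncomputable def energy (G : H →ₗ.[ℂ] H) (hG : IsPosSelfAdjoint G) (ρ : H →L[ℂ] H) : ℝ≥0∞ :=
  trConj (sqrtOp G hG) ρ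

end Trace

section RelBounded

variable {H : Type*} [NormedAddCommGroup H] [InnerProductSpace ℂ H]

/-- `‖A φ‖² ≤ a² ‖φ‖² + b² ‖S φ‖²` for all `φ` in the domain of `S`. -/
def RelBoundedWith (S : H →ₗ.[ℂ] H) (A : S.domain →ₗ[ℂ] H) (a b : ℝ) : Prop :=
  ∀ φ : S.domain, ‖A φ‖ ^ 2 ≤ a ^ 2 * ‖(φ : H)‖ ^ 2 + b ^ 2 * ‖S φ‖ ^ 2

/-- The linear space of `S`-bounded operators, where operators that coincide on the domain of `S`
are identified. -/
def relBounded (S : H →ₗ.[ℂ] H) : Submodule ℂ (S.domain →ₗ[ℂ] H) where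
  carrier := {A | ∃ a b : ℝ, 0 ≤ a ∧ 0 ≤ b ∧ RelBoundedWith S A a b}
  zero_mem' := ⟨0, 0, le_rfl, le_rfl, fun φ => by simp⟩
  add_mem' := by
    rintro A B ⟨a, b, ha, hb, hA⟩ ⟨c, d, hc, hd, hB⟩
    refine ⟨2 * (a + c), 2 * (b + d), by positivity, by positivity, fun φ => ?_⟩
    have h1 : ‖(A + B) φ‖ ≤ ‖A φ‖ + ‖B φ‖ := norm_add_le _ _
    have h2 : ‖(A + B) φ‖ ^ 2 ≤ (‖A φ‖ + ‖B φ‖) ^ 2 := pow_le_pow_left₀ (norm_nonneg _) h1 2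
    have h3 : (0 : ℝ) ≤ (4 * (a + c) ^ 2 - 2 * a ^ 2 - 2 * c ^ 2) * ‖(φ : H)‖ ^ 2 :=
      mul_nonneg (by nlinarith [mul_nonneg ha hc]) (sq_nonneg _)
    have h4 : (0 : ℝ) ≤ (4 * (b + d) ^ 2 - 2 * b ^ 2 - 2 * d ^ 2) * ‖S φ‖ ^ 2 :=
      mul_nonneg (by nlinarith [mul_nonneg hb hd]) (sq_nonneg _)
    nlinarith [hA φ, hB φ, sq_nonneg (‖A φ‖ - ‖B φ‖)]
  smul_mem' := by
    rintro c A ⟨a, b, ha, hb, hA⟩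
    refine ⟨‖c‖ * a, ‖c‖ * b, by positivity, by positivity, fun φ => ?_⟩
    have h := mul_le_mul_of_nonneg_left (hA φ) (sq_nonneg ‖c‖)
    rw [LinearMap.smul_apply, norm_smul]
    nlinarith

/-- The restriction of a bounded operator to the domain of `S`, as an `S`-bounded operator. -/
def ofBounded (S : H →ₗ.[ℂ] H) (A : H →L[ℂ] H) : relBounded S :=
  ⟨A.toLinearMap.domRestrict S.domain, ‖A‖, 0, norm_nonneg _, le_rfl, fun φ => by
    have h := pow_le_pow_left₀ (norm_nonneg _) (A.le_opNorm (φ : H)) 2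
    simpa [mul_pow] using h⟩

/-- The `S`-bound of an `S`-bounded operator. -/
noncomputable def relBound (S : H →ₗ.[ℂ] H) (A : relBounded S) : ℝ :=
  sInf {b | 0 ≤ b ∧ ∃ a, 0 ≤ a ∧ RelBoundedWith S A.1 a b}

variable [CompleteSpace H]

/-- The space of `√G`-bounded operators. -/
noncomputable abbrev BG (G : H →ₗ.[ℂ] H) (hG : IsPosSelfAdjoint G) : Submodule ℂ ((sqrtOp G hG).domain →ₗ[ℂ] H) :=
  relBounded (sqrtOp G hG)

/-- The operator `E`-norm `‖A‖_E^G`, the supremum of `√(Tr A ρ A*)` over all states `ρ` with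
`Tr G ρ ≤ E`. For a `√G`-bounded operator `A` these numbers are finite and bounded above. -/
noncomputable def eNorm (G : H →ₗ.[ℂ] H) (hG : IsPosSelfAdjoint G) (E : ℝ) (A : BG G hG) : ℝ :=
  sSup {r | ∃ ρ : H →L[ℂ] H, IsState ρ ∧ energy G hG ρ ≤ ENNReal.ofReal E ∧
    r = √(trConj ⟨(sqrtOp G hG).domain, A.1⟩ ρ).toReal}

end RelBounded

section Maps

variable {H : Type*} [NormedAddCommGroup H] [InnerProductSpace ℂ H] [CompleteSpace H]

/-- Normality: `Φ (sup A_λ) = sup Φ (A_λ)` for increasing nets of operators. -/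
def IsNormalMap (Φ : (H →L[ℂ] H) →CP (H →L[ℂ] H)) : Prop :=
  ∀ s : Set (H →L[ℂ] H), s.Nonempty → DirectedOn (· ≤ ·) s →
    ∀ A, IsLUB s A → IsLUB (Φ '' s) (Φ A)

/-- `σ = Φ_*(ρ)` for a positive trace class operator `ρ`: the operator `σ` is positive and trace
class and `Tr σ A = Tr Φ(A) ρ` for all bounded `A`. -/
def IsPredualAt (Φ : (H →L[ℂ] H) →CP (H →L[ℂ] H)) (ρ σ : H →L[ℂ] H) : Prop :=
  IsPosTraceClass σ ∧ ∀ A : H →L[ℂ] H, opTrace (σ * A) = opTrace (Φ A * ρ)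

/-- The predual map `Φ_*` on positive trace class operators (`σ` as above exists, since `Φ` is
normal, and is unique). -/
noncomputable def predual (Φ : (H →L[ℂ] H) →CP (H →L[ℂ] H)) (ρ : H →L[ℂ] H) : H →L[ℂ] H :=
  Classical.epsilon (IsPredualAt Φ ρ)

/-- `Φ` is `G`-limited: `Φ_*` maps states of finite energy to operators of finite energy. -/
def IsLimited (Φ : (H →L[ℂ] H) →CP (H →L[ℂ] H)) (G : H →ₗ.[ℂ] H) (hG : IsPosSelfAdjoint G) :
    Prop :=
  ∀ ρ, IsState ρ → energy G hG ρ < ⊤ → energy G hG (predual Φ ρ) < ⊤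

/-- `Y_Φ(E) = sup {Tr G Φ_*(ρ) | ρ a state, Tr G ρ ≤ E}`. -/
noncomputable def maxEnergy (Φ : (H →L[ℂ] H) →CP (H →L[ℂ] H)) (G : H →ₗ.[ℂ] H)
    (hG : IsPosSelfAdjoint G) (E : ℝ) : ℝ≥0∞ :=
  ⨆ (ρ : H →L[ℂ] H) (_ : IsState ρ) (_ : energy G hG ρ ≤ ENNReal.ofReal E),
    energy G hG (predual Φ ρ)

/-- Continuity of `Φ` on the bounded operators with respect to the norm `‖·‖_E^G`. -/
def IsENormContinuous (Φ : (H →L[ℂ] H) →CP (H →L[ℂ] H)) (G : H →ₗ.[ℂ] H)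
    (hG : IsPosSelfAdjoint G) (E : ℝ) : Prop :=
  ∀ A₀ : H →L[ℂ] H, ∀ ε > 0, ∃ δ > 0, ∀ A : H →L[ℂ] H,
    eNorm G hG E (ofBounded _ (A - A₀)) < δ → eNorm G hG E (ofBounded _ (Φ A - Φ A₀)) < ε

/-- `G = ∑ₖ Eₖ |τₖ⟩⟨τₖ|` with an orthonormal basis `τₖ` and a nondecreasing sequence of eigenvalues
`Eₖ` tending to infinity. -/
def IsDiscreteOp (G : H →ₗ.[ℂ] H) : Prop :=
  ∃ (τ : HilbertBasis ℕ ℂ H) (ev : ℕ → ℝ), Monotone ev ∧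
    Filter.Tendsto ev Filter.atTop Filter.atTop ∧
    (∀ φ : H, φ ∈ G.domain ↔ Summable fun k => ev k ^ 2 * ‖⟪τ k, φ⟫_ℂ‖ ^ 2) ∧
    ∀ φ : G.domain, HasSum (fun k => ((ev k : ℂ) * ⟪τ k, (φ : H)⟫_ℂ) • τ k) (G φ)

end Maps

section Stinespring

variable {H : Type*} [NormedAddCommGroup H] [InnerProductSpace ℂ H]

/-- The Hilbert space tensor product `H ⊗ K`: the completion of the algebraic one. -/
abbrev HTensor (H K : Type*) [NormedAddCommGroup H] [InnerProductSpace ℂ H]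
    [NormedAddCommGroup K] [InnerProductSpace ℂ K] : Type _ :=
  UniformSpace.Completion (H ⊗[ℂ] K)

/-- The vector `φ ⊗ ψ` in the Hilbert space tensor product. -/
noncomputable def pureTensor {K : Type*} [NormedAddCommGroup K] [InnerProductSpace ℂ K] (φ : H) (ψ : K) :
    HTensor H K :=
  ((φ ⊗ₜ[ℂ] ψ : H ⊗[ℂ] K) : HTensor H K)

/-- The bounded operator `A ⊗ I_K` for a bounded operator `A`. -/
noncomputable def ampl (K : Type*) [NormedAddCommGroup K] [InnerProductSpace ℂ K]
    (A : H →L[ℂ] H) : HTensor H K →L[ℂ] HTensor H K :=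
  (UniformSpace.Completion.toComplL.comp (A.rTensor K)).extend
    (UniformSpace.Completion.toComplL : H ⊗[ℂ] K →L[ℂ] HTensor H K)

/-- The operator `T ⊗ I_K` on the linear span of the vectors `φ ⊗ ψ` with `φ` in the domain of an
unbounded operator `T`. -/
noncomputable def algAmpl (K : Type*) [NormedAddCommGroup K] [InnerProductSpace ℂ K]
    (T : H →ₗ.[ℂ] H) : HTensor H K →ₗ.[ℂ] HTensor H K :=
  (Submodule.span ℂ {p : HTensor H K × HTensor H K | ∃ (φ : T.domain) (ψ : K),
    p = (pureTensor (φ : H) ψ, pureTensor (T φ) ψ)}).toLinearPMap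

/-- The closed operator `S ⊗ I_K`, for a closed operator `S`. -/
noncomputable def closedAmpl (K : Type*) [NormedAddCommGroup K] [InnerProductSpace ℂ K]
    (S : H →ₗ.[ℂ] H) : HTensor H K →ₗ.[ℂ] HTensor H K :=
  (algAmpl K S).closure

/-- `B` is an `S ⊗ I_K`-bounded extension of `A ⊗ I_K` to the domain of `S ⊗ I_K`, where `A` is an
operator defined on the domain of `S`. -/
def IsRelAmpl (K : Type*) [NormedAddCommGroup K] [InnerProductSpace ℂ K] (S : H →ₗ.[ℂ] H)
    (A : S.domain →ₗ[ℂ] H) (B : (closedAmpl K S).domain →ₗ[ℂ] HTensor H K) : Prop :=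
  B ∈ relBounded (closedAmpl K S) ∧ algAmpl K ⟨S.domain, A⟩ ≤ ⟨(closedAmpl K S).domain, B⟩

variable [CompleteSpace H] {K : Type*} [NormedAddCommGroup K] [InnerProductSpace ℂ K]

/-- Stinespring representation `Φ(A) = V* (A ⊗ I_K) V`. -/
def IsStinespring (Φ : (H →L[ℂ] H) →CP (H →L[ℂ] H)) (V : H →L[ℂ] HTensor H K) : Prop :=
  ∀ A : H →L[ℂ] H, Φ A = V.adjoint ∘L ampl K A ∘L V

/-- Minimality: the linear span of the vectors `(A ⊗ I_K) V φ` is dense. -/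
def IsMinimalStinespring (Φ : (H →L[ℂ] H) →CP (H →L[ℂ] H)) (V : H →L[ℂ] HTensor H K) : Prop :=
  IsStinespring Φ V ∧ Dense (Submodule.span ℂ
    {x : HTensor H K | ∃ (A : H →L[ℂ] H) (φ : H), x = ampl K A (V φ)} : Set (HTensor H K))

/-- The space `K` of a minimal Stinespring representation has finite dimension. -/
def HasFiniteChoiRank (Φ : (H →L[ℂ] H) →CP (H →L[ℂ] H)) : Prop :=
  ∃ (K : Type) (_ : NormedAddCommGroup K) (_ : InnerProductSpace ℂ K)
    (V : H →L[ℂ] HTensor H K), FiniteDimensional ℂ K ∧ IsMinimalStinespring Φ V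

/-- The map `Ψ` on `S`-bounded operators is given by the formula `Ψ(A) = V* (A ⊗ I_K) V`: every
`A ⊗ I_K` has a unique `S ⊗ I_K`-bounded extension `B` to the domain of `S ⊗ I_K`, the operator `V`
maps the domain of `S` to that of `S ⊗ I_K`, and `Ψ(A) φ = V* B V φ` on the domain of `S`. -/
def IsGivenBy (S : H →ₗ.[ℂ] H) (V : H →L[ℂ] HTensor H K) (Ψ : relBounded S → relBounded S) :
    Prop :=
  ∀ A : relBounded S, (∃! B, IsRelAmpl K S A.1 B) ∧
    ∀ B, IsRelAmpl K S A.1 B → ∀ φ : S.domain,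
      ∃ h : V φ ∈ (closedAmpl K S).domain, (Ψ A).1 φ = V.adjoint (B ⟨V φ, h⟩)

end Stinespring

end EnergyOp

open EnergyOp

/-!
Let `S = √G` and `Q = 1 - (1 + S)⁻¹`. As `S = Q (1 - Q)⁻¹`, the square of the Neumann series writes
`‖S φ‖²` as the sum of the bounded forms `⟨φ, Q ^ (p + q + 2) φ⟩`, so a normal map can be moved
through the energy `Tr S² ρ` term by term. If `Φ` is limited, the energy of `Φ_* ρ` is at most a
multiple of `Tr ρ` plus the energy of `ρ`, by uniform boundedness.

An `S`-bounded operator `A` is the limit of the bounded operators `A (1 - Qⁿ)`. By the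
Kadison–Schwarz inequality `‖Φ(B) φ‖² ≤ ‖Φ(1)‖ Tr B Φ_*(|φ⟩⟨φ|) B*`, so for `φ` in the domain of `S`
the vectors `Φ(A (1 - Qⁿ)) φ` converge; their limit is the extension of `Φ`, and it inherits the
estimates.

For the converse, both rank conditions make the operators `Φ_*(|φ⟩⟨φ|)` finite-rank. Continuity of
`Φ` at the operators `|ψ⟩⟨S χ|`, together with the self-adjointness of `S`, puts their ranges into
the domain of `S`. They then have finite energy, and uniform boundedness applies again.
-/

namespace EnergyOp

open Filter

/-! ### Positive operators and the Neumann series of a contraction -/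

section Convergence

theorem enorm_sq_eq_ofReal {E : Type*} [SeminormedAddGroup E] (x : E) :
    ‖x‖ₑ ^ 2 = ENNReal.ofReal (‖x‖ ^ 2) := by
  rw [ENNReal.ofReal_pow (norm_nonneg x), ofReal_norm]

theorem enorm_add_sq_le {E : Type*} [SeminormedAddGroup E] (x y : E) :
    ‖x + y‖ₑ ^ 2 ≤ 2 * (‖x‖ₑ ^ 2 + ‖y‖ₑ ^ 2) := by
  simp only [enorm_sq_eq_ofReal]
  rw [← ENNReal.ofReal_add (sq_nonneg _) (sq_nonneg _), ← ENNReal.ofReal_ofNat 2,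
    ← ENNReal.ofReal_mul zero_le_two]
  refine ENNReal.ofReal_le_ofReal ?_
  nlinarith [norm_add_le x y, norm_nonneg (x + y), sq_nonneg (‖x‖ - ‖y‖)]

theorem cauchySeq_of_norm_sub_sq_le {E : Type*} [SeminormedAddCommGroup E] {y : ℕ → E} {a : ℕ → ℝ}
    (ha : CauchySeq a) (h : ∀ ⦃m n⦄, m ≤ n → ‖y n - y m‖ ^ 2 ≤ |a n - a m|) : CauchySeq y := by
  rw [Metric.cauchySeq_iff'] at ha ⊢
  intro ε hε
  obtain ⟨N, hN⟩ := ha (ε ^ 2) (by positivity)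
  refine ⟨N, fun n hn => ?_⟩
  rw [dist_eq_norm]
  exact lt_of_pow_lt_pow_left₀ 2 hε.le ((h hn).trans_lt (hN n hn))

theorem tendsto_range_product_range_atTop :
    Tendsto (fun n => Finset.range n ×ˢ Finset.range n) atTop atTop := by
  refine tendsto_atTop_finset_of_monotone
    (fun m n h => Finset.product_subset_product (Finset.range_mono h) (Finset.range_mono h)) ?_
  rintro ⟨i, j⟩
  refine ⟨i + j + 1, ?_⟩
  simp only [Finset.mem_product, Finset.mem_range]
  lia

end Convergence

section Operators

variable {X : Type*} [NormedAddCommGroup X] [InnerProductSpace ℂ X]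

theorem re_inner_self_eq (x : X) : (⟪x, x⟫_ℂ).re = ‖x‖ ^ 2 :=
  inner_self_eq_norm_sq (𝕜 := ℂ) x

theorem re_inner_apply_nonneg {B : X →L[ℂ] X} (hB : 0 ≤ B) (x : X) : 0 ≤ (⟪x, B x⟫_ℂ).re :=
  ((ContinuousLinearMap.nonneg_iff_isPositive B).1 hB).re_inner_nonneg_right x

theorem inner_apply_comm_of_nonneg {B : X →L[ℂ] X} (hB : 0 ≤ B) (x y : X) :
    ⟪B x, y⟫_ℂ = ⟪x, B y⟫_ℂ :=
  ((ContinuousLinearMap.nonneg_iff_isPositive B).1 hB).inner_left_eq_inner_right x y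

theorem re_inner_apply_mono {B C : X →L[ℂ] X} (h : B ≤ C) (x : X) :
    (⟪x, B x⟫_ℂ).re ≤ (⟪x, C x⟫_ℂ).re := by
  have := ((ContinuousLinearMap.le_def B C).1 h).re_inner_nonneg_right x
  rwa [sub_apply, inner_sub_right, RCLike.re_to_complex, Complex.sub_re, sub_nonneg] at this

/-- The quadratic form `x ↦ ⟨x, B x⟩` of an operator `B ≥ 0`, with values in `[0, ∞]` so that sums
of such forms need no convergence hypothesis. Negative values are truncated to `0`. -/
noncomputable def quad (B : X →L[ℂ] X) (x : X) : ℝ≥0∞ := ENNReal.ofReal (⟪x, B x⟫_ℂ).re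

theorem quad_ne_top (B : X →L[ℂ] X) (x : X) : quad B x ≠ ⊤ := ENNReal.ofReal_ne_top

theorem quad_sum {ι : Type*} (s : Finset ι) {B : ι → X →L[ℂ] X} (hB : ∀ i, 0 ≤ B i) (x : X) :
    quad (∑ i ∈ s, B i) x = ∑ i ∈ s, quad (B i) x := by
  simp only [quad]
  rw [← ENNReal.ofReal_sum_of_nonneg fun i _ => re_inner_apply_nonneg (hB i) x,
    sum_apply, inner_sum, Complex.re_sum]

theorem quad_add {B C : X →L[ℂ] X} (hB : 0 ≤ B) (hC : 0 ≤ C) (x : X) :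
    quad (B + C) x = quad B x + quad C x := by
  simp only [quad]
  rw [← ENNReal.ofReal_add (re_inner_apply_nonneg hB x) (re_inner_apply_nonneg hC x), add_apply,
    inner_add_right, Complex.add_re]

theorem quad_smul {c : ℝ} (hc : 0 ≤ c) (B : X →L[ℂ] X) (x : X) :
    quad ((c : ℂ) • B) x = ENNReal.ofReal c * quad B x := by
  simp only [quad]
  rw [← ENNReal.ofReal_mul hc, smul_apply, inner_smul_right, Complex.re_ofReal_mul]

theorem quad_smul_right (B : X →L[ℂ] X) (c : ℂ) (x : X) :
    quad B (c • x) = ‖c‖ₑ ^ 2 * quad B x := by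
  rw [quad, quad, enorm_sq_eq_ofReal, ← ENNReal.ofReal_mul (sq_nonneg _), map_smul,
    inner_smul_left, inner_smul_right, ← mul_assoc, Complex.conj_mul', ← Complex.ofReal_pow,
    Complex.re_ofReal_mul]

theorem quad_mono {B C : X →L[ℂ] X} (h : B ≤ C) (x : X) : quad B x ≤ quad C x :=
  ENNReal.ofReal_le_ofReal (re_inner_apply_mono h x)

theorem le_of_quad_le {B C : X →L[ℂ] X} (hB : 0 ≤ B) (hC : 0 ≤ C)
    (h : ∀ x, quad B x ≤ quad C x) : B ≤ C := by
  rw [ContinuousLinearMap.le_def, ContinuousLinearMap.isPositive_def]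
  refine ⟨fun x y => ?_, fun x => ?_⟩
  · simp [inner_sub_left, inner_sub_right, inner_apply_comm_of_nonneg hB,
      inner_apply_comm_of_nonneg hC]
  · rw [ContinuousLinearMap.reApplyInnerSelf_apply, inner_re_symm, sub_apply, inner_sub_right,
      map_sub, sub_nonneg]
    exact (ENNReal.ofReal_le_ofReal_iff (re_inner_apply_nonneg hC x)).1 (h x)

/-- The partial sums of the Neumann series of `(1 - Q)⁻¹`. -/
noncomputable def neumann (Q : X →L[ℂ] X) (n : ℕ) : X →L[ℂ] X := ∑ k ∈ Finset.range n, Q ^ k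

theorem neumann_mul_one_sub (Q : X →L[ℂ] X) (n : ℕ) : neumann Q n * (1 - Q) = 1 - Q ^ n :=
  geom_sum_mul_neg Q n

theorem one_sub_mul_neumann (Q : X →L[ℂ] X) (n : ℕ) : (1 - Q) * neumann Q n = 1 - Q ^ n :=
  mul_neg_geom_sum Q n

variable [CompleteSpace X]

theorem quad_star_mul_self (T : X →L[ℂ] X) (x : X) : quad (star T * T) x = ‖T x‖ₑ ^ 2 := by
  rw [quad, enorm_sq_eq_ofReal, ← re_inner_self_eq, ContinuousLinearMap.star_eq_adjoint,
    mul_apply_eq_comp, ContinuousLinearMap.adjoint_inner_right]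

theorem sqrt_sqrt_apply {B : X →L[ℂ] X} (hB : 0 ≤ B) (x : X) :
    CFC.sqrt B (CFC.sqrt B x) = B x :=
  DFunLike.congr_fun (CFC.sqrt_mul_sqrt_self B hB) x

theorem star_sqrt (B : X →L[ℂ] X) : star (CFC.sqrt B) = CFC.sqrt B :=
  (CFC.sqrt_nonneg B).isSelfAdjoint.star_eq

theorem star_sqrt_mul_sqrt {B : X →L[ℂ] X} (hB : 0 ≤ B) : star (CFC.sqrt B) * CFC.sqrt B = B := by
  rw [star_sqrt, CFC.sqrt_mul_sqrt_self B hB]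

theorem enorm_sqrt_apply_sq {B : X →L[ℂ] X} (hB : 0 ≤ B) (x : X) :
    ‖CFC.sqrt B x‖ₑ ^ 2 = quad B x := by
  rw [← quad_star_mul_self, star_sqrt_mul_sqrt hB]

theorem denseRange_of_nonneg_of_injective {R : X →L[ℂ] X} (h0 : 0 ≤ R)
    (hR : Function.Injective R) : DenseRange R := by
  suffices Dense (LinearMap.range R.toLinearMap : Set X) from this
  rw [Submodule.dense_iff_topologicalClosure_eq_top, Submodule.topologicalClosure_eq_top_iff,
    Submodule.eq_bot_iff]
  intro y hy
  have hRy : ⟪R y, R y⟫_ℂ = 0 := by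
    rw [inner_apply_comm_of_nonneg h0]
    exact (Submodule.mem_orthogonal' _ _).1 hy _ ⟨R y, rfl⟩
  exact hR (by rw [inner_self_eq_zero.1 hRy, map_zero])

end Operators

section Contraction

variable {X : Type*} [NormedAddCommGroup X] [InnerProductSpace ℂ X] [CompleteSpace X]
  {Q : X →L[ℂ] X}

theorem norm_pow_apply_le (h0 : 0 ≤ Q) (h1 : Q ≤ 1) (n : ℕ) (x : X) : ‖(Q ^ n) x‖ ≤ ‖x‖ := by
  have hone : Q ^ n ≤ 1 := by simpa using CStarAlgebra.pow_antitone h0 h1 n.zero_le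
  have h : ‖Q ^ n‖ ≤ 1 :=
    (CStarAlgebra.norm_le_one_iff_of_nonneg _ (CStarAlgebra.pow_nonneg h0 n)).2 hone
  simpa using (Q ^ n).le_of_opNorm_le h x

theorem inner_pow_apply_pow_apply (h0 : 0 ≤ Q) (m n : ℕ) (x y : X) :
    ⟪(Q ^ m) x, (Q ^ n) y⟫_ℂ = ⟪x, (Q ^ (m + n)) y⟫_ℂ := by
  rw [inner_apply_comm_of_nonneg (CStarAlgebra.pow_nonneg h0 m), pow_add,
    mul_apply_eq_comp]

theorem tendsto_pow_apply_zero (h0 : 0 ≤ Q) (h1 : Q ≤ 1)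
    (hinj : Function.Injective (1 - Q : X →L[ℂ] X)) (x : X) :
    Tendsto (fun n => (Q ^ n) x) atTop (𝓝 0) := by
  let a : ℕ → ℝ := fun n => (⟪x, (Q ^ n) x⟫_ℂ).re
  have hanti : Antitone a := fun m n hmn =>
    re_inner_apply_mono (CStarAlgebra.pow_antitone h0 h1 hmn) x
  have hbdd : BddBelow (Set.range a) :=
    ⟨0, Set.forall_mem_range.2 fun n => re_inner_apply_nonneg (CStarAlgebra.pow_nonneg h0 n) x⟩
  have hinner (m n : ℕ) : (⟪(Q ^ m) x, (Q ^ n) x⟫_ℂ).re = a (m + n) := by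
    rw [inner_pow_apply_pow_apply h0]
  have hcauchy : CauchySeq fun n => (Q ^ n) x := by
    refine cauchySeq_of_norm_sub_sq_le (a := fun n => a (n + n)) ?_ fun m n hmn => ?_
    · exact ((tendsto_atTop_ciInf hanti hbdd).comp
        (tendsto_atTop_mono (fun n => n.le_add_left n) tendsto_id)).cauchySeq
    · rw [@norm_sub_sq ℂ, inner_re_symm, ← re_inner_self_eq, ← re_inner_self_eq,
        RCLike.re_to_complex, hinner, hinner, hinner]
      have hmid : a (n + n) ≤ a (m + n) := hanti (by lia)
      linarith [neg_abs_le (a (n + n) - a (m + m))]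
  obtain ⟨y, hy⟩ := cauchySeq_tendsto_of_complete hcauchy
  have hfix : Q y = y := by
    refine tendsto_nhds_unique ((Q.continuous.tendsto y).comp hy) ?_
    refine (hy.comp (tendsto_add_atTop_nat 1)).congr fun n => ?_
    rw [Function.comp_apply, pow_succ', mul_apply_eq_comp]
    rfl
  have hzero : y = 0 := hinj (by simp [hfix])
  rwa [hzero] at hy

theorem re_inner_apply_neumann (h0 : 0 ≤ Q) (m n : ℕ) (x : X) :
    (⟪Q (neumann Q m x), Q (neumann Q n x)⟫_ℂ).re =
      ∑ p ∈ Finset.range m ×ˢ Finset.range n, (⟪x, (Q ^ (p.1 + p.2 + 2)) x⟫_ℂ).re := by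
  have hpow (k : ℕ) : Q ((Q ^ k) x) = (Q ^ (k + 1)) x := by
    rw [pow_succ', mul_apply_eq_comp]
  simp only [neumann, sum_apply, map_sum, sum_inner, inner_sum, Complex.re_sum,
    Finset.sum_product, hpow, inner_pow_apply_pow_apply h0]
  rw [Finset.sum_comm]
  refine Finset.sum_congr rfl fun i _ => Finset.sum_congr rfl fun j _ => ?_
  rw [add_add_add_comm]

theorem re_inner_pow_apply_nonneg (h0 : 0 ≤ Q) (n : ℕ) (x : X) :
    0 ≤ (⟪x, (Q ^ n) x⟫_ℂ).re :=
  re_inner_apply_nonneg (CStarAlgebra.pow_nonneg h0 n) x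

theorem enorm_apply_neumann_sq (h0 : 0 ≤ Q) (n : ℕ) (x : X) :
    ‖Q (neumann Q n x)‖ₑ ^ 2 =
      ∑ p ∈ Finset.range n ×ˢ Finset.range n, quad (Q ^ (p.1 + p.2 + 2)) x := by
  rw [enorm_sq_eq_ofReal, ← re_inner_self_eq, re_inner_apply_neumann h0,
    ENNReal.ofReal_sum_of_nonneg fun p _ => re_inner_pow_apply_nonneg h0 _ x]
  rfl

theorem tendsto_enorm_apply_neumann_sq (h0 : 0 ≤ Q) (x : X) :
    Tendsto (fun n => ‖Q (neumann Q n x)‖ₑ ^ 2) atTop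
      (𝓝 (∑' p : ℕ × ℕ, quad (Q ^ (p.1 + p.2 + 2)) x)) := by
  simp only [enorm_apply_neumann_sq h0]
  exact ENNReal.summable.hasSum.comp tendsto_range_product_range_atTop

-- Expand `Q² (1 - Q)⁻²` as the square of the series `∑ₙ Qⁿ⁺¹`.
theorem tsum_quad_one_sub_apply (h0 : 0 ≤ Q) (h1 : Q ≤ 1)
    (hinj : Function.Injective (1 - Q : X →L[ℂ] X)) (y : X) :
    ∑' p : ℕ × ℕ, quad (Q ^ (p.1 + p.2 + 2)) ((1 - Q : X →L[ℂ] X) y) = ‖Q y‖ₑ ^ 2 := by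
  refine tendsto_nhds_unique (tendsto_enorm_apply_neumann_sq h0 _) ?_
  have hneumann (n : ℕ) : neumann Q n ((1 - Q : X →L[ℂ] X) y) = y - (Q ^ n) y :=
    DFunLike.congr_fun (neumann_mul_one_sub Q n) y
  simp only [hneumann]
  have hlim := tendsto_const_nhds (x := y).sub (tendsto_pow_apply_zero h0 h1 hinj y)
  rw [sub_zero] at hlim
  exact ENNReal.Tendsto.pow ((Q.continuous.tendsto y).comp hlim).enorm

theorem cauchySeq_apply_neumann (h0 : 0 ≤ Q) {x : X}
    (hx : ∑' p : ℕ × ℕ, quad (Q ^ (p.1 + p.2 + 2)) x ≠ ⊤) :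
    CauchySeq fun n => Q (neumann Q n x) := by
  have hle {m n : ℕ} (hmn : m ≤ n) : ‖Q (neumann Q m x)‖ ^ 2 ≤
      (⟪Q (neumann Q m x), Q (neumann Q n x)⟫_ℂ).re := by
    rw [← re_inner_self_eq, re_inner_apply_neumann h0, re_inner_apply_neumann h0]
    exact Finset.sum_le_sum_of_subset_of_nonneg
      (Finset.product_subset_product le_rfl (Finset.range_mono hmn))
      fun p _ _ => re_inner_pow_apply_nonneg h0 _ x
  refine cauchySeq_of_norm_sub_sq_le (a := fun n => ‖Q (neumann Q n x)‖ ^ 2) ?_ fun m n hmn => ?_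
  · refine (((ENNReal.tendsto_toReal hx).comp (tendsto_enorm_apply_neumann_sq h0 x)).congr
      fun n => ?_).cauchySeq
    simp
  · rw [@norm_sub_sq ℂ, inner_re_symm, RCLike.re_to_complex]
    linarith [hle hmn, le_abs_self (‖Q (neumann Q n x)‖ ^ 2 - ‖Q (neumann Q m x)‖ ^ 2)]

theorem mem_range_one_sub_of_tsum_quad_ne_top (h0 : 0 ≤ Q) (h1 : Q ≤ 1)
    (hinj : Function.Injective (1 - Q : X →L[ℂ] X)) {x : X}
    (hx : ∑' p : ℕ × ℕ, quad (Q ^ (p.1 + p.2 + 2)) x ≠ ⊤) :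
    ∃ y, (1 - Q : X →L[ℂ] X) y = x := by
  obtain ⟨z, hz⟩ := cauchySeq_tendsto_of_complete (cauchySeq_apply_neumann h0 hx)
  have hone_sub (n : ℕ) :
      (1 - Q : X →L[ℂ] X) (Q (neumann Q n x)) = Q (x - (Q ^ n) x) := by
    have h : (1 - Q) * neumann Q n = 1 - Q ^ n := one_sub_mul_neumann Q n
    have := congrArg Q (DFunLike.congr_fun h x)
    simpa [map_sub] using this
  have hlim := tendsto_const_nhds (x := x).sub (tendsto_pow_apply_zero h0 h1 hinj x)
  rw [sub_zero] at hlim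
  have hzx : (1 - Q : X →L[ℂ] X) z = Q x :=
    tendsto_nhds_unique (((1 - Q : X →L[ℂ] X).continuous.tendsto z).comp hz)
      (((Q.continuous.tendsto x).comp hlim).congr fun n => (hone_sub n).symm)
  exact ⟨x + z, by rw [map_add, hzx, sub_apply, one_apply_eq_self, sub_add_cancel]⟩

end Contraction

/-! ### Hilbert–Schmidt norms and traces -/

section HilbertSchmidt

theorem summable_norm_mul_norm {ι E F : Type*} [SeminormedAddGroup E] [SeminormedAddGroup F]
    {f : ι → E} {g : ι → F} (hf : Summable fun i => ‖f i‖ ^ 2) (hg : Summable fun i => ‖g i‖ ^ 2) :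
    Summable fun i => ‖f i‖ * ‖g i‖ := by
  refine (hf.add hg).of_nonneg_of_le (fun i => by positivity) fun i => ?_
  nlinarith [sq_nonneg (‖f i‖ - ‖g i‖), sq_nonneg (‖f i‖ + ‖g i‖)]

theorem summable_norm_sq_of_tsum_ne_top {ι E : Type*} [SeminormedAddGroup E] {f : ι → E}
    (h : ∑' i, ‖f i‖ₑ ^ 2 ≠ ⊤) : Summable fun i => ‖f i‖ ^ 2 := by
  refine Summable.of_enorm ?_
  simpa only [enorm_pow, Real.enorm_eq_ofReal (norm_nonneg _), ofReal_norm] using h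

theorem enorm_apply_sq_le {E F : Type*} [SeminormedAddCommGroup E] [NormedSpace ℂ E]
    [SeminormedAddCommGroup F] [NormedSpace ℂ F] (A : E →L[ℂ] F) (x : E) :
    ‖A x‖ₑ ^ 2 ≤ ‖A‖ₑ ^ 2 * ‖x‖ₑ ^ 2 := by
  rw [← mul_pow]
  exact pow_le_pow_left' (A.le_opENorm x) 2

section Inner

variable {X : Type*} [NormedAddCommGroup X] [InnerProductSpace ℂ X]

theorem enorm_inner_symm (x y : X) : ‖⟪x, y⟫_ℂ‖ₑ = ‖⟪y, x⟫_ℂ‖ₑ := by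
  rw [← ofReal_norm, norm_inner_symm, ofReal_norm]

theorem re_inner_mul_inner_symm (x y : X) : (⟪x, y⟫_ℂ * ⟪y, x⟫_ℂ).re = ‖⟪x, y⟫_ℂ‖ ^ 2 := by
  refine (inner_mul_symm_re_eq_norm (𝕜 := ℂ) x y).trans ?_
  rw [norm_mul, norm_inner_symm y x, sq]

theorem tsum_enorm_inner_sq {ι : Type*} (b : HilbertBasis ι ℂ X) (x : X) :
    ∑' i, ‖⟪b i, x⟫_ℂ‖ₑ ^ 2 = ‖x‖ₑ ^ 2 := by
  have h : HasSum (fun i => ‖⟪b i, x⟫_ℂ‖ ^ 2) (‖x‖ ^ 2) := by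
    rw [← re_inner_self_eq]
    refine (Complex.hasSum_re (b.hasSum_inner_mul_inner x x)).congr_fun fun i => ?_
    rw [re_inner_mul_inner_symm, norm_inner_symm]
  simp only [enorm_sq_eq_ofReal]
  rw [← h.tsum_eq, ENNReal.ofReal_tsum_of_nonneg (fun i => sq_nonneg _) h.summable]

end Inner

variable {H : Type*} [NormedAddCommGroup H] [InnerProductSpace ℂ H] [CompleteSpace H]

/-- The square of the Hilbert–Schmidt norm, equal to `∞` off the Hilbert–Schmidt class. -/
noncomputable def hsNormSq (T : H →L[ℂ] H) : ℝ≥0∞ := ∑' i, ‖T (stdBasis H i)‖ₑ ^ 2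

theorem hsNormSq_star (T : H →L[ℂ] H) : hsNormSq (star T) = hsNormSq T := by
  simp only [hsNormSq, ← tsum_enorm_inner_sq (stdBasis H)]
  rw [ENNReal.tsum_comm]
  refine tsum_congr fun i => tsum_congr fun j => ?_
  rw [ContinuousLinearMap.star_eq_adjoint, ContinuousLinearMap.adjoint_inner_right,
    enorm_inner_symm]

theorem hsNormSq_mul_le (A T : H →L[ℂ] H) : hsNormSq (A * T) ≤ ‖A‖ₑ ^ 2 * hsNormSq T := by
  rw [hsNormSq, hsNormSq, ← ENNReal.tsum_mul_left]
  exact ENNReal.tsum_le_tsum fun i => enorm_apply_sq_le A _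

theorem hsNormSq_mul_ne_top (A : H →L[ℂ] H) {T : H →L[ℂ] H} (hT : hsNormSq T ≠ ⊤) :
    hsNormSq (A * T) ≠ ⊤ :=
  ne_top_of_le_ne_top (ENNReal.mul_ne_top (ENNReal.pow_ne_top enorm_ne_top) hT)
    (hsNormSq_mul_le A T)

theorem hsNormSq_mul_ne_top' {T : H →L[ℂ] H} (hT : hsNormSq T ≠ ⊤) (A : H →L[ℂ] H) :
    hsNormSq (T * A) ≠ ⊤ := by
  rw [← hsNormSq_star, star_mul]
  rw [← hsNormSq_star] at hT
  exact hsNormSq_mul_ne_top _ hT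

theorem summable_inner_of_hsNormSq_ne_top {X Y : H →L[ℂ] H} (hX : hsNormSq X ≠ ⊤)
    (hY : hsNormSq Y ≠ ⊤) : Summable fun i => ⟪X (stdBasis H i), Y (stdBasis H i)⟫_ℂ :=
  .of_norm_bounded (summable_norm_mul_norm (summable_norm_sq_of_tsum_ne_top hX)
    (summable_norm_sq_of_tsum_ne_top hY)) fun _ => norm_inner_le_norm _ _

theorem summable_norm_inner_stdBasis_sq {T : H →L[ℂ] H} (hT : hsNormSq T ≠ ⊤) :
    Summable fun p : (exists_hilbertBasis ℂ H).choose × (exists_hilbertBasis ℂ H).choose =>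
      ‖⟪stdBasis H p.2, T (stdBasis H p.1)⟫_ℂ‖ ^ 2 := by
  apply summable_norm_sq_of_tsum_ne_top
  rw [ENNReal.tsum_prod (f := fun i j => ‖⟪stdBasis H j, T (stdBasis H i)⟫_ℂ‖ₑ ^ 2)]
  simp only [tsum_enorm_inner_sq]
  exact hT

theorem tsum_inner_eq_tsum_inner_star {X Y : H →L[ℂ] H} (hX : hsNormSq X ≠ ⊤)
    (hY : hsNormSq Y ≠ ⊤) :
    ∑' i, ⟪X (stdBasis H i), Y (stdBasis H i)⟫_ℂ =
      ∑' i, ⟪star Y (stdBasis H i), star X (stdBasis H i)⟫_ℂ := by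
  set e := stdBasis H
  have hsum : Summable (Function.uncurry fun i j => ⟪X (e i), e j⟫_ℂ * ⟪e j, Y (e i)⟫_ℂ) := by
    refine Summable.of_norm_bounded (summable_norm_mul_norm (summable_norm_inner_stdBasis_sq hX)
      (summable_norm_inner_stdBasis_sq hY)) fun p => ?_
    rw [Function.uncurry, norm_mul, norm_inner_symm]
  have hcol (i) : ∑' j, ⟪X (e i), e j⟫_ℂ * ⟪e j, Y (e i)⟫_ℂ = ⟪X (e i), Y (e i)⟫_ℂ :=
    e.tsum_inner_mul_inner _ _
  have hrow (j) :
      ∑' i, ⟪X (e i), e j⟫_ℂ * ⟪e j, Y (e i)⟫_ℂ = ⟪star Y (e j), star X (e j)⟫_ℂ := by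
    rw [← e.tsum_inner_mul_inner]
    refine tsum_congr fun i => ?_
    rw [ContinuousLinearMap.star_eq_adjoint, ContinuousLinearMap.star_eq_adjoint,
      ContinuousLinearMap.adjoint_inner_right, ContinuousLinearMap.adjoint_inner_left, mul_comm]
  simpa only [hcol, hrow] using hsum.tsum_comm.symm

end HilbertSchmidt

section TraceForm

section Inner

variable {X : Type*} [NormedAddCommGroup X] [InnerProductSpace ℂ X]

theorem smul_nonneg_of_real {c : ℝ} (hc : 0 ≤ c) {B : X →L[ℂ] X} (hB : 0 ≤ B) :
    0 ≤ (c : ℂ) • B := by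
  rw [ContinuousLinearMap.nonneg_iff_isPositive] at hB ⊢
  exact hB.smul_of_nonneg (Complex.zero_le_real.2 hc)

/-- The operator `|φ⟩⟨φ|`. -/
noncomputable abbrev ketBra (φ : X) : X →L[ℂ] X := InnerProductSpace.rankOne ℂ φ φ

theorem ketBra_nonneg (φ : X) : 0 ≤ ketBra φ :=
  (ContinuousLinearMap.nonneg_iff_isPositive _).2 (InnerProductSpace.isPositive_rankOne_self φ)

theorem quad_ketBra (φ x : X) : quad (ketBra φ) x = ‖⟪φ, x⟫_ℂ‖ₑ ^ 2 := by
  rw [quad, enorm_sq_eq_ofReal, InnerProductSpace.rankOne_apply, inner_smul_right,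
    re_inner_mul_inner_symm]

end Inner

variable {H : Type*} [NormedAddCommGroup H] [InnerProductSpace ℂ H] [CompleteSpace H]
  {ρ σ B C : H →L[ℂ] H}

theorem sqrt_ketBra {φ : H} (hφ : ‖φ‖ = 1) : CFC.sqrt (ketBra φ) = ketBra φ :=
  CFC.sqrt_unique (InnerProductSpace.isIdempotentElem_rankOne_self hφ) (ketBra_nonneg φ)

theorem inner_apply_eq_ofReal_quad (hB : 0 ≤ B) (x : H) :
    ⟪x, B x⟫_ℂ = ((quad B x).toReal : ℂ) := by
  rw [← sqrt_sqrt_apply hB, ← inner_apply_comm_of_nonneg (CFC.sqrt_nonneg B),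
    ← enorm_sqrt_apply_sq hB, inner_self_eq_norm_sq_to_K, ENNReal.toReal_pow, toReal_enorm]
  push_cast
  rfl

/-- The trace `Tr ρ B ∈ [0, ∞]` for positive operators `ρ` and `B`, neither of them required to be
trace class. -/
noncomputable def posTrace (ρ B : H →L[ℂ] H) : ℝ≥0∞ :=
  ∑' i, quad B (CFC.sqrt ρ (stdBasis H i))

theorem posTrace_star_mul_self (ρ T : H →L[ℂ] H) :
    posTrace ρ (star T * T) = hsNormSq (T * CFC.sqrt ρ) :=
  tsum_congr fun _ => quad_star_mul_self T _

theorem posTrace_one (ρ : H →L[ℂ] H) : posTrace ρ 1 = hsNormSq (CFC.sqrt ρ) := by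
  simpa using posTrace_star_mul_self ρ 1

theorem posTrace_star_mul_self_eq_tsum (hρ : 0 ≤ ρ) (T : H →L[ℂ] H) :
    posTrace ρ (star T * T) = ∑' i, quad ρ (star T (stdBasis H i)) := by
  rw [posTrace_star_mul_self, ← hsNormSq_star, star_mul, star_sqrt]
  exact tsum_congr fun i => enorm_sqrt_apply_sq hρ _

theorem posTrace_eq_hsNormSq (ρ : H →L[ℂ] H) (hB : 0 ≤ B) :
    posTrace ρ B = hsNormSq (CFC.sqrt B * CFC.sqrt ρ) := by
  rw [← posTrace_star_mul_self, star_sqrt_mul_sqrt hB]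

theorem posTrace_eq_tsum_quad (hρ : 0 ≤ ρ) (hB : 0 ≤ B) :
    posTrace ρ B = ∑' i, quad ρ (CFC.sqrt B (stdBasis H i)) := by
  rw [← star_sqrt_mul_sqrt hB, posTrace_star_mul_self_eq_tsum hρ, star_sqrt_mul_sqrt hB, star_sqrt]

theorem posTrace_mono_right (ρ : H →L[ℂ] H) (h : B ≤ C) : posTrace ρ B ≤ posTrace ρ C :=
  ENNReal.tsum_le_tsum fun _ => quad_mono h _

theorem posTrace_mono_left (hρ : 0 ≤ ρ) (h : ρ ≤ σ) (hB : 0 ≤ B) :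
    posTrace ρ B ≤ posTrace σ B := by
  rw [posTrace_eq_tsum_quad hρ hB, posTrace_eq_tsum_quad (hρ.trans h) hB]
  exact ENNReal.tsum_le_tsum fun _ => quad_mono h _

theorem posTrace_add_left (hρ : 0 ≤ ρ) (hσ : 0 ≤ σ) (hB : 0 ≤ B) :
    posTrace (ρ + σ) B = posTrace ρ B + posTrace σ B := by
  rw [posTrace_eq_tsum_quad hρ hB, posTrace_eq_tsum_quad hσ hB,
    posTrace_eq_tsum_quad (add_nonneg hρ hσ) hB, ← ENNReal.tsum_add]
  exact tsum_congr fun _ => quad_add hρ hσ _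

theorem posTrace_smul_left {c : ℝ} (hc : 0 ≤ c) (hρ : 0 ≤ ρ) (hB : 0 ≤ B) :
    posTrace ((c : ℂ) • ρ) B = ENNReal.ofReal c * posTrace ρ B := by
  rw [posTrace_eq_tsum_quad hρ hB, posTrace_eq_tsum_quad (smul_nonneg_of_real hc hρ) hB,
    ← ENNReal.tsum_mul_left]
  exact tsum_congr fun _ => quad_smul hc _ _

theorem posTrace_ketBra (φ : H) (hB : 0 ≤ B) : posTrace (ketBra φ) B = quad B φ := by
  rw [posTrace_eq_tsum_quad (ketBra_nonneg φ) hB, ← enorm_sqrt_apply_sq hB,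
    ← tsum_enorm_inner_sq (stdBasis H)]
  refine tsum_congr fun i => ?_
  rw [quad_ketBra, ← inner_apply_comm_of_nonneg (CFC.sqrt_nonneg B), enorm_inner_symm]

theorem posTrace_ne_top (hρ : posTrace ρ 1 ≠ ⊤) (hB : 0 ≤ B) : posTrace ρ B ≠ ⊤ := by
  rw [posTrace_one] at hρ
  rw [posTrace_eq_hsNormSq ρ hB]
  exact hsNormSq_mul_ne_top _ hρ

theorem isPosTraceClass_iff : IsPosTraceClass ρ ↔ 0 ≤ ρ ∧ posTrace ρ 1 ≠ ⊤ := by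
  refine and_congr_right fun hρ => ?_
  have h (i) : ⟪stdBasis H i, ρ (stdBasis H i)⟫_ℂ =
      ⟪CFC.sqrt ρ (stdBasis H i), CFC.sqrt ρ (stdBasis H i)⟫_ℂ := by
    rw [inner_apply_comm_of_nonneg (CFC.sqrt_nonneg ρ), sqrt_sqrt_apply hρ]
  rw [posTrace_one]
  simp only [h]
  refine ⟨fun hs => ?_, fun hs => summable_inner_of_hsNormSq_ne_top hs hs⟩
  refine ne_of_eq_of_ne (tsum_congr fun i => ?_) (tsum_enorm_ne_top_iff_summable_norm.2 hs.norm)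
  rw [inner_self_eq_norm_sq_to_K, enorm_pow, ← ofReal_norm, ← ofReal_norm, RCLike.norm_ofReal,
    abs_norm]

/-- `∑ᵢ ⟨√ρ eᵢ, A √ρ eᵢ⟩`, which is `Tr ρ A` for a positive trace class operator `ρ` and a bounded
operator `A`. -/
noncomputable def expect (ρ A : H →L[ℂ] H) : ℂ :=
  ∑' i, ⟪CFC.sqrt ρ (stdBasis H i), A (CFC.sqrt ρ (stdBasis H i))⟫_ℂ

theorem summable_expect (hρ : posTrace ρ 1 ≠ ⊤) (A : H →L[ℂ] H) :
    Summable fun i => ⟪CFC.sqrt ρ (stdBasis H i), A (CFC.sqrt ρ (stdBasis H i))⟫_ℂ := by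
  rw [posTrace_one] at hρ
  exact summable_inner_of_hsNormSq_ne_top (Y := A * CFC.sqrt ρ) hρ (hsNormSq_mul_ne_top A hρ)

theorem expect_eq_posTrace (ρ : H →L[ℂ] H) (hB : 0 ≤ B) :
    expect ρ B = ((posTrace ρ B).toReal : ℂ) := by
  rw [posTrace, ENNReal.tsum_toReal_eq fun i => quad_ne_top _ _, Complex.ofReal_tsum]
  exact tsum_congr fun i => inner_apply_eq_ofReal_quad hB _

theorem opTrace_mul_eq_expect (hρ : IsPosTraceClass ρ) (A : H →L[ℂ] H) :
    opTrace (ρ * A) = expect ρ A := by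
  obtain ⟨h0, hs⟩ := isPosTraceClass_iff.1 hρ
  rw [posTrace_one] at hs
  calc opTrace (ρ * A)
      = ∑' i, ⟪CFC.sqrt ρ (stdBasis H i), (CFC.sqrt ρ * A) (stdBasis H i)⟫_ℂ :=
        tsum_congr fun i => by
          rw [inner_apply_comm_of_nonneg (CFC.sqrt_nonneg ρ), ← mul_apply_eq_comp, ← mul_assoc,
            CFC.sqrt_mul_sqrt_self ρ h0]
    _ = ∑' i, ⟪star (CFC.sqrt ρ * A) (stdBasis H i), star (CFC.sqrt ρ) (stdBasis H i)⟫_ℂ :=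
        tsum_inner_eq_tsum_inner_star hs (hsNormSq_mul_ne_top' hs A)
    _ = expect ρ A := tsum_congr fun i => by
        rw [star_mul, star_sqrt, mul_apply_eq_comp, ContinuousLinearMap.star_eq_adjoint A,
          ContinuousLinearMap.adjoint_inner_left]

theorem opTrace_mul_eq_expect' (hρ : IsPosTraceClass ρ) (A : H →L[ℂ] H) :
    opTrace (A * ρ) = expect ρ A := by
  obtain ⟨h0, hs⟩ := isPosTraceClass_iff.1 hρ
  rw [posTrace_one] at hs
  calc opTrace (A * ρ)
      = ∑' i, ⟪(CFC.sqrt ρ * star A) (stdBasis H i), CFC.sqrt ρ (stdBasis H i)⟫_ℂ :=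
        tsum_congr fun i => by
          rw [mul_apply_eq_comp, mul_apply_eq_comp, inner_apply_comm_of_nonneg (CFC.sqrt_nonneg ρ),
            sqrt_sqrt_apply h0, ContinuousLinearMap.star_eq_adjoint,
            ContinuousLinearMap.adjoint_inner_left]
    _ = ∑' i, ⟪star (CFC.sqrt ρ) (stdBasis H i), star (CFC.sqrt ρ * star A) (stdBasis H i)⟫_ℂ :=
        tsum_inner_eq_tsum_inner_star (hsNormSq_mul_ne_top' hs (star A)) hs
    _ = expect ρ A := tsum_congr fun i => by rw [star_mul, star_sqrt, star_star, mul_apply_eq_comp]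

theorem isState_iff : IsState ρ ↔ 0 ≤ ρ ∧ posTrace ρ 1 = 1 := by
  have htrace (h : IsPosTraceClass ρ) : opTrace ρ = ((posTrace ρ 1).toReal : ℂ) := by
    rw [← expect_eq_posTrace ρ zero_le_one, ← opTrace_mul_eq_expect h, mul_one]
  constructor
  · rintro ⟨h, h1⟩
    rw [htrace h, Complex.ofReal_eq_one, ENNReal.toReal_eq_one_iff] at h1
    exact ⟨h.1, h1⟩
  · rintro ⟨h, h1⟩
    have hρ : IsPosTraceClass ρ := isPosTraceClass_iff.2 ⟨h, by simp [h1]⟩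
    exact ⟨hρ, by simp [htrace hρ, h1]⟩

theorem isState_ketBra {φ : H} (hφ : ‖φ‖ = 1) : IsState (ketBra φ) := by
  refine isState_iff.2 ⟨ketBra_nonneg φ, ?_⟩
  rw [posTrace_ketBra φ zero_le_one, quad, one_apply_eq_self, re_inner_self_eq, hφ]
  simp

end TraceForm

/-! ### Normal maps and their preduals -/

section KadisonSchwarz

variable {H : Type*} [NormedAddCommGroup H] [InnerProductSpace ℂ H] [CompleteSpace H]

theorem cstarMatrix_quadratic_nonneg {M : CStarMatrix (Fin 2) (Fin 2) (H →L[ℂ] H)} (hM : 0 ≤ M)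
    (x y : H) :
    0 ≤ (⟪x, M 0 0 x⟫_ℂ).re + 2 * (⟪x, M 0 1 y⟫_ℂ).re + (⟪y, M 1 1 y⟫_ℂ).re := by
  rw [StarOrderedRing.nonneg_iff] at hM
  induction hM using AddSubmonoid.closure_induction with
  | mem M hM =>
    obtain ⟨N, rfl⟩ := hM
    have hexp (k i j : Fin 2) (z w : H) :
        ⟪z, (star (N k i) * N k j) w⟫_ℂ = ⟪N k i z, N k j w⟫_ℂ := by
      rw [mul_apply_eq_comp, ContinuousLinearMap.star_eq_adjoint,
        ContinuousLinearMap.adjoint_inner_right]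
    have hsq (k : Fin 2) : 0 ≤ (⟪N k 0 x, N k 0 x⟫_ℂ).re + 2 * (⟪N k 0 x, N k 1 y⟫_ℂ).re
        + (⟪N k 1 y, N k 1 y⟫_ℂ).re := by
      have h : 0 ≤ ‖N k 0 x + N k 1 y‖ ^ 2 := sq_nonneg _
      rwa [@norm_add_sq ℂ, ← re_inner_self_eq, ← re_inner_self_eq] at h
    simp only [CStarMatrix.mul_apply, Fin.sum_univ_two, CStarMatrix.star_apply, add_apply,
      inner_add_right, Complex.add_re, hexp]
    linarith [hsq 0, hsq 1]
  | zero => simp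
  | add M N _ _ hM hN =>
    simp only [CStarMatrix.add_apply, add_apply, inner_add_right, Complex.add_re]
    linarith

variable {𝒜 : Type*} [CStarAlgebra 𝒜] [PartialOrder 𝒜] [StarOrderedRing 𝒜]

theorem two_positive (Φ : 𝒜 →CP (H →L[ℂ] H)) (a : 𝒜) (x y : H) :
    0 ≤ (⟪x, Φ 1 x⟫_ℂ).re + 2 * (⟪x, Φ a y⟫_ℂ).re + (⟪y, Φ (star a * a) y⟫_ℂ).re := by
  let v : CStarMatrix (Fin 2) (Fin 2) 𝒜 := CStarMatrix.ofMatrix !![1, a; 0, 0]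
  have hv (i j) : (star v * v) i j = star (v 0 i) * v 0 j + star (v 1 i) * v 1 j := by
    rw [CStarMatrix.mul_apply, Fin.sum_univ_two, CStarMatrix.star_apply, CStarMatrix.star_apply]
  have h := cstarMatrix_quadratic_nonneg
    (Φ.map_cstarMatrix_nonneg _ (star_mul_self_nonneg v)) x y
  simp only [CStarMatrix.map_apply, hv] at h
  simpa [v] using h

theorem kadison_schwarz (Φ : 𝒜 →CP (H →L[ℂ] H)) (a : 𝒜) (y : H) :
    ‖Φ a y‖ ^ 2 ≤ ‖Φ 1‖ * (⟪y, Φ (star a * a) y⟫_ℂ).re := by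
  have hone : (⟪Φ a y, Φ 1 (Φ a y)⟫_ℂ).re ≤ ‖Φ 1‖ * ‖Φ a y‖ ^ 2 :=
    calc (⟪Φ a y, Φ 1 (Φ a y)⟫_ℂ).re
        ≤ ‖Φ a y‖ * ‖Φ 1 (Φ a y)‖ := (Complex.re_le_norm _).trans (norm_inner_le_norm _ _)
      _ ≤ ‖Φ a y‖ * (‖Φ 1‖ * ‖Φ a y‖) := by gcongr; exact (Φ 1).le_opNorm _
      _ = ‖Φ 1‖ * ‖Φ a y‖ ^ 2 := by ring
  have hpoly (t : ℝ) : 0 ≤ ‖Φ 1‖ * ‖Φ a y‖ ^ 2 * (t * t) + 2 * ‖Φ a y‖ ^ 2 * t +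
      (⟪y, Φ (star a * a) y⟫_ℂ).re := by
    have h := two_positive Φ a ((t : ℂ) • Φ a y) y
    simp only [map_smul, inner_smul_left, inner_smul_right, Complex.conj_ofReal,
      Complex.re_ofReal_mul, re_inner_self_eq] at h
    linarith [mul_le_mul_of_nonneg_left hone (mul_self_nonneg t)]
  have hdisc := discrim_le_zero hpoly
  have hq : 0 ≤ (⟪y, Φ (star a * a) y⟫_ℂ).re :=
    re_inner_apply_nonneg (map_nonneg Φ (star_mul_self_nonneg a)) y
  rcases (sq_nonneg ‖Φ a y‖).eq_or_lt with h0 | h0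
  · rw [← h0]
    positivity
  · refine le_of_mul_le_mul_left ?_ h0
    rw [discrim] at hdisc
    linarith

theorem enorm_map_apply_sq_le (Φ : 𝒜 →CP (H →L[ℂ] H)) (a : 𝒜) (y : H) :
    ‖Φ a y‖ₑ ^ 2 ≤ ‖Φ 1‖ₑ * quad (Φ (star a * a)) y := by
  rw [enorm_sq_eq_ofReal, quad, ← ofReal_norm, ← ENNReal.ofReal_mul (norm_nonneg _)]
  exact ENNReal.ofReal_le_ofReal (kadison_schwarz Φ a y)

end KadisonSchwarz

section Normal

variable {H : Type*} [NormedAddCommGroup H] [InnerProductSpace ℂ H]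

theorem nonneg_and_quad_eq_of_inner_apply_self_eq {B : H →L[ℂ] H} {q : H → ℝ≥0∞}
    (hq : ∀ x, q x ≠ ⊤) (hB : ∀ x, ⟪B x, x⟫_ℂ = ((q x).toReal : ℂ)) :
    0 ≤ B ∧ ∀ x, quad B x = q x := by
  refine ⟨?_, fun x => ?_⟩
  · rw [ContinuousLinearMap.nonneg_iff_isPositive, ContinuousLinearMap.isPositive_iff_complex]
    intro x
    simp [hB]
  · rw [quad, ← RCLike.re_to_complex, inner_re_symm, hB, RCLike.re_to_complex, Complex.ofReal_re,
      ENNReal.ofReal_toReal (hq x)]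

variable [CompleteSpace H]

theorem exists_operator_of_form {f : H → H → ℂ} {C : ℝ}
    (add_left : ∀ x y z, f (x + y) z = f x z + f y z)
    (smul_left : ∀ (c : ℂ) x z, f (c • x) z = starRingEnd ℂ c * f x z)
    (add_right : ∀ x y z, f x (y + z) = f x y + f x z)
    (smul_right : ∀ (c : ℂ) x y, f x (c • y) = c * f x y)
    (bound : ∀ x y, ‖f x y‖ ≤ C * ‖x‖ * ‖y‖) :
    ∃ B : H →L[ℂ] H, ∀ x y, ⟪B x, y⟫_ℂ = f x y :=
  ⟨InnerProductSpace.continuousLinearMapOfBilin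
      (LinearMap.mkContinuous₂ (LinearMap.mk₂'ₛₗ (starRingEnd ℂ) (RingHom.id ℂ) f
        add_left smul_left add_right smul_right) C bound),
    fun x y => by rw [InnerProductSpace.continuousLinearMapOfBilin_apply]; rfl⟩

theorem exists_quad_eq_tsum {ι : Type*} {Y : ι → H →L[ℂ] H} (hY : ∀ i, 0 ≤ Y i)
    {B : H →L[ℂ] H} (hB : ∀ F : Finset ι, ∑ i ∈ F, Y i ≤ B) :
    ∃ S : H →L[ℂ] H, 0 ≤ S ∧ ∀ x, quad S x = ∑' i, quad (Y i) x := by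
  have hfin (x : H) : ∑' i, quad (Y i) x ≠ ⊤ := by
    refine ne_top_of_le_ne_top (quad_ne_top B x) ?_
    rw [ENNReal.tsum_eq_iSup_sum]
    exact iSup_le fun F => (quad_sum F hY x).symm.trans_le (quad_mono (hB F) x)
  have hsqrt (x : H) : Summable fun i => ‖CFC.sqrt (Y i) x‖ ^ 2 :=
    summable_norm_sq_of_tsum_ne_top
      (ne_of_eq_of_ne (tsum_congr fun i => enorm_sqrt_apply_sq (hY i) x) (hfin x))
  have hsum (x y : H) : Summable fun i => ⟪Y i x, y⟫_ℂ := by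
    refine .of_norm_bounded (summable_norm_mul_norm (hsqrt x) (hsqrt y)) fun i => ?_
    rw [← sqrt_sqrt_apply (hY i), inner_apply_comm_of_nonneg (CFC.sqrt_nonneg (Y i))]
    exact norm_inner_le_norm _ _
  obtain ⟨S, hS⟩ := exists_operator_of_form (f := fun x y => ∑' i, ⟪Y i x, y⟫_ℂ) (C := ‖B‖)
    (fun x y z => by simp only [map_add, inner_add_left, (hsum _ z).tsum_add (hsum _ z)])
    (fun c x z => by simp only [map_smul, inner_smul_left, tsum_mul_left])
    (fun x y z => by simp only [inner_add_right, (hsum x _).tsum_add (hsum x _)])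
    (fun c x y => by simp only [inner_smul_right, tsum_mul_left])
    (fun x y => by
      refine le_of_tendsto (hsum x y).hasSum.norm (.of_forall fun F => ?_)
      rw [← sum_inner, ← sum_apply]
      refine (norm_inner_le_norm _ _).trans (mul_le_mul_of_nonneg_right ?_ (norm_nonneg _))
      exact ContinuousLinearMap.le_of_opNorm_le _ (CStarAlgebra.norm_le_norm_of_nonneg_of_le
        (Finset.sum_nonneg fun i _ => hY i) (hB F)) x)
  refine ⟨S, nonneg_and_quad_eq_of_inner_apply_self_eq hfin fun x => ?_⟩
  rw [hS, ENNReal.tsum_toReal_eq fun i => quad_ne_top _ _, Complex.ofReal_tsum]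
  refine tsum_congr fun i => ?_
  rw [inner_apply_comm_of_nonneg (hY i), inner_apply_eq_ofReal_quad (hY i)]

theorem quad_eq_tsum_of_isLUB {ι : Type*} {Y : ι → H →L[ℂ] H} (hY : ∀ i, 0 ≤ Y i)
    {B : H →L[ℂ] H} (hB : IsLUB (Set.range fun F : Finset ι => ∑ i ∈ F, Y i) B) (x : H) :
    quad B x = ∑' i, quad (Y i) x := by
  have hle (F : Finset ι) : ∑ i ∈ F, Y i ≤ B := hB.1 ⟨F, rfl⟩
  obtain ⟨S, hS0, hS⟩ := exists_quad_eq_tsum hY hle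
  have hBS : B ≤ S := by
    refine hB.2 (Set.forall_mem_range.2 fun F => ?_)
    refine le_of_quad_le (Finset.sum_nonneg fun i _ => hY i) hS0 fun x => ?_
    rw [quad_sum F hY, hS]
    exact ENNReal.sum_le_tsum F
  refine le_antisymm ((quad_mono hBS x).trans_eq (hS x)) ?_
  rw [ENNReal.tsum_eq_iSup_sum]
  exact iSup_le fun F => (quad_sum F hY x).symm.trans_le (quad_mono (hle F) x)

variable {ι : Type*} (b : HilbertBasis ι ℂ H)

theorem quad_sum_ketBra (T : H →L[ℂ] H) (F : Finset ι) (x : H) :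
    quad (∑ i ∈ F, ketBra (star T (b i))) x = ∑ i ∈ F, ‖⟪b i, T x⟫_ℂ‖ₑ ^ 2 := by
  rw [quad_sum F fun i => ketBra_nonneg _]
  refine Finset.sum_congr rfl fun i _ => ?_
  rw [quad_ketBra, ContinuousLinearMap.star_eq_adjoint, ContinuousLinearMap.adjoint_inner_left]

theorem sum_ketBra_nonneg (f : ι → H) (F : Finset ι) : 0 ≤ ∑ i ∈ F, ketBra (f i) :=
  Finset.sum_nonneg fun i _ => ketBra_nonneg (f i)

theorem isLUB_sum_ketBra (T : H →L[ℂ] H) :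
    IsLUB (Set.range fun F : Finset ι => ∑ i ∈ F, ketBra (star T (b i))) (star T * T) := by
  constructor
  · rintro _ ⟨F, rfl⟩
    refine le_of_quad_le (sum_ketBra_nonneg _ F) (star_mul_self_nonneg T) fun x => ?_
    rw [quad_sum_ketBra, quad_star_mul_self, ← tsum_enorm_inner_sq b]
    exact ENNReal.sum_le_tsum F
  · intro C hC
    have hC0 : 0 ≤ C := by simpa using hC ⟨∅, rfl⟩
    refine le_of_quad_le (star_mul_self_nonneg T) hC0 fun x => ?_
    rw [quad_star_mul_self, ← tsum_enorm_inner_sq b, ENNReal.tsum_eq_iSup_sum]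
    refine iSup_le fun F => ?_
    rw [← quad_sum_ketBra]
    exact quad_mono (hC ⟨F, rfl⟩) x

theorem IsNormalMap.quad_star_mul_self {Φ : (H →L[ℂ] H) →CP (H →L[ℂ] H)} (hΦ : IsNormalMap Φ)
    (T : H →L[ℂ] H) (x : H) :
    quad (Φ (star T * T)) x = ∑' i, quad (Φ (ketBra (star T (b i)))) x := by
  refine quad_eq_tsum_of_isLUB (fun i => map_nonneg Φ (ketBra_nonneg _)) ?_ x
  have hdir : DirectedOn (· ≤ ·)
      (Set.range fun F : Finset ι => ∑ i ∈ F, ketBra (star T (b i))) := by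
    rw [directedOn_range]
    exact Monotone.directed_le fun F G hFG =>
      Finset.sum_le_sum_of_subset_of_nonneg hFG fun i _ _ => ketBra_nonneg _
  have h := hΦ _ (Set.range_nonempty _) hdir _ (isLUB_sum_ketBra b T)
  rw [← Set.range_comp] at h
  simpa only [Function.comp_def, map_sum] using h

end Normal

section Predual

variable {H : Type*} [NormedAddCommGroup H] [InnerProductSpace ℂ H] [CompleteSpace H]
  {ρ σ : H →L[ℂ] H} {Φ : (H →L[ℂ] H) →CP (H →L[ℂ] H)}

theorem expect_add (hρ : posTrace ρ 1 ≠ ⊤) (A B : H →L[ℂ] H) :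
    expect ρ (A + B) = expect ρ A + expect ρ B := by
  simp only [expect, add_apply, inner_add_right]
  exact (summable_expect hρ A).tsum_add (summable_expect hρ B)

theorem expect_smul (ρ : H →L[ℂ] H) (c : ℂ) (A : H →L[ℂ] H) :
    expect ρ (c • A) = c * expect ρ A := by
  simp only [expect, smul_apply, inner_smul_right]
  exact tsum_mul_left

theorem norm_expect_le (hρ : posTrace ρ 1 ≠ ⊤) (A : H →L[ℂ] H) :
    ‖expect ρ A‖ ≤ ‖A‖ * (posTrace ρ 1).toReal := by
  rw [posTrace_one] at hρ ⊢
  have hnorm : (hsNormSq (CFC.sqrt ρ)).toReal = ∑' i, ‖CFC.sqrt ρ (stdBasis H i)‖ ^ 2 := by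
    rw [hsNormSq, ENNReal.tsum_toReal_eq fun i => ENNReal.pow_ne_top enorm_ne_top]
    exact tsum_congr fun i => by simp
  rw [hnorm, ← tsum_mul_left]
  refine tsum_of_norm_bounded ((summable_norm_sq_of_tsum_ne_top hρ).mul_left ‖A‖).hasSum
    fun i => (norm_inner_le_norm _ _).trans ?_
  nlinarith [A.le_opNorm (CFC.sqrt ρ (stdBasis H i)), norm_nonneg (CFC.sqrt ρ (stdBasis H i))]

theorem exists_norm_map_le (Φ : (H →L[ℂ] H) →CP (H →L[ℂ] H)) :
    ∃ C : ℝ, ∀ A, ‖Φ A‖ ≤ C * ‖A‖ := by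
  obtain ⟨C, hC⟩ := PositiveLinearMap.exists_norm_apply_le
    (⟨Φ.toLinearMap, OrderHomClass.mono Φ⟩ : (H →L[ℂ] H) →ₚ[ℂ] (H →L[ℂ] H))
  exact ⟨C, hC⟩

theorem exists_quad_eq_posTrace_map_ketBra (Φ : (H →L[ℂ] H) →CP (H →L[ℂ] H))
    (hρ : posTrace ρ 1 ≠ ⊤) :
    ∃ σ : H →L[ℂ] H, 0 ≤ σ ∧ ∀ x, quad σ x = posTrace ρ (Φ (ketBra x)) := by
  obtain ⟨C, hC⟩ := exists_norm_map_le Φ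
  obtain ⟨σ, hσ⟩ := exists_operator_of_form
    (f := fun x y => expect ρ (Φ (InnerProductSpace.rankOne ℂ y x)))
    (C := C * (posTrace ρ 1).toReal)
    (fun x y z => by rw [map_add, map_add, expect_add hρ])
    (fun c x z => by rw [map_smulₛₗ, map_smul, expect_smul])
    (fun x y z => by rw [map_add, add_apply, map_add, expect_add hρ])
    (fun c x y => by rw [map_smul, smul_apply, map_smul, expect_smul])
    (fun x y =>
      calc _ ≤ ‖Φ (InnerProductSpace.rankOne ℂ y x)‖ * (posTrace ρ 1).toReal :=
            norm_expect_le hρ _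
        _ ≤ C * (‖y‖ * ‖x‖) * (posTrace ρ 1).toReal := by
            gcongr
            exact (hC _).trans_eq (by rw [InnerProductSpace.norm_rankOne])
        _ = _ := by ring)
  have hnonneg (x : H) : 0 ≤ Φ (ketBra x) := map_nonneg Φ (ketBra_nonneg x)
  exact ⟨σ, nonneg_and_quad_eq_of_inner_apply_self_eq (fun x => posTrace_ne_top hρ (hnonneg x))
    fun x => (hσ x x).trans (expect_eq_posTrace ρ (hnonneg x))⟩

theorem IsNormalMap.posTrace_eq_of_quad_eq (hΦ : IsNormalMap Φ) (hσ : 0 ≤ σ)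
    (h : ∀ x, quad σ x = posTrace ρ (Φ (ketBra x))) {B : H →L[ℂ] H} (hB : 0 ≤ B) :
    posTrace σ B = posTrace ρ (Φ B) := by
  rw [← star_sqrt_mul_sqrt hB, posTrace_star_mul_self_eq_tsum hσ]
  simp only [h, posTrace, hΦ.quad_star_mul_self (stdBasis H)]
  rw [ENNReal.tsum_comm]

theorem isPredualAt_of_posTrace_eq (hρ : IsPosTraceClass ρ) (hσ : 0 ≤ σ)
    (h : ∀ B, 0 ≤ B → posTrace σ B = posTrace ρ (Φ B)) : IsPredualAt Φ ρ σ := by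
  have hρ1 := (isPosTraceClass_iff.1 hρ).2
  have hσ1 : posTrace σ 1 ≠ ⊤ := by
    rw [h 1 zero_le_one]
    exact posTrace_ne_top hρ1 (map_nonneg Φ zero_le_one)
  have hσT : IsPosTraceClass σ := isPosTraceClass_iff.2 ⟨hσ, hσ1⟩
  refine ⟨hσT, fun A => ?_⟩
  rw [opTrace_mul_eq_expect hσT, opTrace_mul_eq_expect' hρ]
  have hA : A ∈ Submodule.span ℂ {a : H →L[ℂ] H | 0 ≤ a} :=
    CStarAlgebra.span_nonneg (A := H →L[ℂ] H) ▸ Submodule.mem_top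
  induction hA using Submodule.span_induction with
  | mem B hB => rw [expect_eq_posTrace σ hB, expect_eq_posTrace ρ (map_nonneg Φ hB), h B hB]
  | zero => simp [expect]
  | add B D _ _ h1 h2 => rw [map_add, expect_add hρ1, expect_add hσ1, h1, h2]
  | smul c B _ h1 => rw [map_smul, expect_smul, expect_smul, h1]

theorem IsNormalMap.exists_isPredualAt (hΦ : IsNormalMap Φ) (hρ : IsPosTraceClass ρ) :
    ∃ σ, IsPredualAt Φ ρ σ := by
  obtain ⟨σ, hσ0, hσ⟩ := exists_quad_eq_posTrace_map_ketBra Φ (isPosTraceClass_iff.1 hρ).2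
  exact ⟨σ, isPredualAt_of_posTrace_eq hρ hσ0 fun B => hΦ.posTrace_eq_of_quad_eq hσ0 hσ⟩

theorem IsNormalMap.predual_spec (hΦ : IsNormalMap Φ) (hρ : IsPosTraceClass ρ) :
    IsPredualAt Φ ρ (predual Φ ρ) :=
  Classical.epsilon_spec (hΦ.exists_isPredualAt hρ)

theorem IsNormalMap.expect_predual (hΦ : IsNormalMap Φ) (hρ : IsPosTraceClass ρ)
    (A : H →L[ℂ] H) : expect (predual Φ ρ) A = expect ρ (Φ A) := by
  obtain ⟨hσ, h⟩ := hΦ.predual_spec hρ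
  rw [← opTrace_mul_eq_expect hσ, ← opTrace_mul_eq_expect' hρ, h]

theorem IsNormalMap.posTrace_predual (hΦ : IsNormalMap Φ) (hρ : IsPosTraceClass ρ)
    {B : H →L[ℂ] H} (hB : 0 ≤ B) : posTrace (predual Φ ρ) B = posTrace ρ (Φ B) := by
  have h := hΦ.expect_predual hρ B
  have hΦB := map_nonneg Φ hB
  rwa [expect_eq_posTrace _ hB, expect_eq_posTrace ρ hΦB, Complex.ofReal_inj,
    ENNReal.toReal_eq_toReal_iff'
      (posTrace_ne_top (isPosTraceClass_iff.1 (hΦ.predual_spec hρ).1).2 hB)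
      (posTrace_ne_top (isPosTraceClass_iff.1 hρ).2 hΦB)] at h

end Predual

/-! ### Energy of positive trace class operators -/

section ResolventCompl

variable {H : Type*} [NormedAddCommGroup H] [InnerProductSpace ℂ H]

theorem sqNorm_of_mem {T : H →ₗ.[ℂ] H} {φ : H} (h : φ ∈ T.domain) :
    sqNorm T φ = ‖T ⟨φ, h⟩‖ₑ ^ 2 := dif_pos h

theorem sqNorm_of_notMem {T : H →ₗ.[ℂ] H} {φ : H} (h : φ ∉ T.domain) : sqNorm T φ = ⊤ := dif_neg h

theorem mem_of_sqNorm_ne_top {T : H →ₗ.[ℂ] H} {φ : H} (h : sqNorm T φ ≠ ⊤) : φ ∈ T.domain :=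
  not_imp_comm.1 sqNorm_of_notMem h

/-- `0` is an approximate eigenvalue of `S`: there are unit vectors `φ` with `‖S φ‖` arbitrarily
small. -/
def HasApproxKernel (S : H →ₗ.[ℂ] H) : Prop :=
  ∀ δ > 0, ∃ φ : H, ‖φ‖ = 1 ∧ sqNorm S φ ≤ ENNReal.ofReal δ

theorem RelBoundedWith.norm_apply_le {S : H →ₗ.[ℂ] H} {A : S.domain →ₗ[ℂ] H} {a b : ℝ}
    (hA : RelBoundedWith S A a b) (ha : 0 ≤ a) (hb : 0 ≤ b) (φ : S.domain) :
    ‖A φ‖ ≤ a * ‖(φ : H)‖ + b * ‖S φ‖ := by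
  have hcross : 0 ≤ a * ‖(φ : H)‖ * (b * ‖S φ‖) := by positivity
  exact le_of_pow_le_pow_left₀ two_ne_zero (by positivity) (by linarith [hA φ])

/-- `Q = 1 - (1 + S)⁻¹` for a positive self-adjoint operator `S`. This bounded operator replaces `S`
throughout, and `(1 - Q) y` runs through the domain of `S`. -/
structure IsResolventCompl (S : H →ₗ.[ℂ] H) (Q : H →L[ℂ] H) : Prop where
  nonneg : 0 ≤ Q
  le_one : Q ≤ 1
  injective : Function.Injective (1 - Q : H →L[ℂ] H)
  mem : ∀ y, (1 - Q : H →L[ℂ] H) y ∈ S.domain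
  apply_eq : ∀ y, S ⟨(1 - Q : H →L[ℂ] H) y, mem y⟩ = Q y
  left_inv : ∀ x : S.domain, (1 - Q : H →L[ℂ] H) (x + S x) = x

namespace IsResolventCompl

variable {S : H →ₗ.[ℂ] H} {Q : H →L[ℂ] H}

/-- The bounded operator `A (1 + S)⁻¹` for an `S`-bounded operator `A`. -/
noncomputable def lift (hQ : IsResolventCompl S Q) (A : relBounded S) : H →L[ℂ] H :=
  LinearMap.mkContinuousOfExistsBound
    (A.1 ∘ₗ LinearMap.codRestrict S.domain (1 - Q : H →L[ℂ] H).toLinearMap hQ.mem) (by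
      obtain ⟨a, b, ha, hb, hA⟩ := A.2
      refine ⟨a * ‖(1 - Q : H →L[ℂ] H)‖ + b * ‖Q‖, fun y => ?_⟩
      calc ‖A.1 ⟨(1 - Q : H →L[ℂ] H) y, hQ.mem y⟩‖
          ≤ a * ‖(1 - Q : H →L[ℂ] H) y‖ + b * ‖Q y‖ := by
            rw [← hQ.apply_eq]
            exact hA.norm_apply_le ha hb _
        _ ≤ a * (‖(1 - Q : H →L[ℂ] H)‖ * ‖y‖) + b * (‖Q‖ * ‖y‖) := by
            gcongr <;> exact ContinuousLinearMap.le_opNorm _ _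
        _ = (a * ‖(1 - Q : H →L[ℂ] H)‖ + b * ‖Q‖) * ‖y‖ := by ring)

variable (hQ : IsResolventCompl S Q)

theorem apply_eq_lift (A : relBounded S) {φ : S.domain} {y : H}
    (h : (φ : H) = (1 - Q : H →L[ℂ] H) y) : A.1 φ = hQ.lift A y :=
  congrArg A.1 (Subtype.ext h)

theorem lift_ofBounded (A : H →L[ℂ] H) : hQ.lift (ofBounded S A) = A * (1 - Q) := rfl

theorem lift_add (A B : relBounded S) : hQ.lift (A + B) = hQ.lift A + hQ.lift B := rfl

theorem lift_smul (c : ℂ) (A : relBounded S) : hQ.lift (c • A) = c • hQ.lift A := rfl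

/-- Bounded operators `A (1 - Qⁿ)` approximating the `S`-bounded operator `A`. -/
noncomputable def approx (A : relBounded S) (n : ℕ) : H →L[ℂ] H :=
  hQ.lift A * neumann Q n

theorem approx_mul (A : relBounded S) (n : ℕ) :
    hQ.approx A n * (1 - Q) = hQ.lift A * (1 - Q ^ n) := by
  rw [approx, mul_assoc, neumann_mul_one_sub]

theorem approx_add (A B : relBounded S) (n : ℕ) :
    hQ.approx (A + B) n = hQ.approx A n + hQ.approx B n := by
  rw [approx, hQ.lift_add, add_mul, approx, approx]

theorem approx_smul (c : ℂ) (A : relBounded S) (n : ℕ) :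
    hQ.approx (c • A) n = c • hQ.approx A n := by
  rw [approx, hQ.lift_smul, smul_mul_assoc, approx]

theorem approx_ofBounded (A : H →L[ℂ] H) (n : ℕ) :
    hQ.approx (ofBounded S A) n = A - A * Q ^ n := by
  rw [approx, hQ.lift_ofBounded, mul_assoc, one_sub_mul_neumann, mul_sub, mul_one]

end IsResolventCompl

end ResolventCompl

section Energy

variable {H : Type*} [NormedAddCommGroup H] [InnerProductSpace ℂ H] [CompleteSpace H]

theorem IsPosSelfAdjoint.exists_isResolventCompl {S : H →ₗ.[ℂ] H} (hS : IsPosSelfAdjoint S) :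
    ∃ Q, IsResolventCompl S Q := by
  obtain ⟨R, h0, h1, hSR, hRS⟩ := hS.exists_resolvent
  have hR : (1 - (1 - R) : H →L[ℂ] H) = R := sub_sub_cancel 1 R
  refine ⟨1 - R, sub_nonneg.2 h1, sub_le_self 1 h0, ?_, ?_, ?_, ?_⟩
  · rw [hR, injective_iff_map_eq_zero]
    intro x hx
    obtain ⟨hmem, hSx⟩ := hSR x
    have hzero : (⟨R x, hmem⟩ : S.domain) = 0 := Subtype.ext hx
    rw [hzero, LinearPMap.map_zero, hx, sub_zero] at hSx
    exact hSx.symm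
  · rw [hR]
    exact fun y => (hSR y).1
  · simp only [hR]
    exact fun y => (hSR y).2
  · rwa [hR]

namespace IsResolventCompl

variable {S : H →ₗ.[ℂ] H} {Q ρ σ : H →L[ℂ] H} (hQ : IsResolventCompl S Q)

include hQ

theorem pow_nonneg (n : ℕ) : 0 ≤ Q ^ n := CStarAlgebra.pow_nonneg hQ.nonneg n

theorem sqNorm_eq (φ : H) : sqNorm S φ = ∑' p : ℕ × ℕ, quad (Q ^ (p.1 + p.2 + 2)) φ := by
  by_cases h : ∃ y, (1 - Q : H →L[ℂ] H) y = φ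
  · obtain ⟨y, rfl⟩ := h
    rw [tsum_quad_one_sub_apply hQ.nonneg hQ.le_one hQ.injective, sqNorm_of_mem (hQ.mem y),
      hQ.apply_eq]
  · rw [sqNorm_of_notMem fun hφ => h ⟨_, hQ.left_inv ⟨φ, hφ⟩⟩, eq_comm]
    exact not_imp_comm.1
      (mem_range_one_sub_of_tsum_quad_ne_top hQ.nonneg hQ.le_one hQ.injective) h

theorem trConj_eq (ρ : H →L[ℂ] H) :
    trConj S ρ = ∑' p : ℕ × ℕ, posTrace ρ (Q ^ (p.1 + p.2 + 2)) := by
  simp only [trConj, posTrace, hQ.sqNorm_eq]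
  rw [ENNReal.tsum_comm]

theorem trConj_ketBra (φ : H) : trConj S (ketBra φ) = sqNorm S φ := by
  rw [hQ.trConj_eq, hQ.sqNorm_eq]
  exact tsum_congr fun p => posTrace_ketBra φ (hQ.pow_nonneg _)

theorem trConj_add (hρ : 0 ≤ ρ) (hσ : 0 ≤ σ) : trConj S (ρ + σ) = trConj S ρ + trConj S σ := by
  rw [hQ.trConj_eq, hQ.trConj_eq, hQ.trConj_eq, ← ENNReal.tsum_add]
  exact tsum_congr fun p => posTrace_add_left hρ hσ (hQ.pow_nonneg _)

theorem trConj_smul {c : ℝ} (hc : 0 ≤ c) (hρ : 0 ≤ ρ) :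
    trConj S ((c : ℂ) • ρ) = ENNReal.ofReal c * trConj S ρ := by
  rw [hQ.trConj_eq, hQ.trConj_eq, ← ENNReal.tsum_mul_left]
  exact tsum_congr fun p => posTrace_smul_left hc hρ (hQ.pow_nonneg _)

end IsResolventCompl

end Energy

section FiniteEnergy

variable {H : Type*} [NormedAddCommGroup H] [InnerProductSpace ℂ H] [CompleteSpace H]
  {S : H →ₗ.[ℂ] H} {Q ρ σ : H →L[ℂ] H}

theorem enorm_apply_sq_le_hsNormSq (T : H →L[ℂ] H) (x : H) :
    ‖T x‖ₑ ^ 2 ≤ hsNormSq T * ‖x‖ₑ ^ 2 := by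
  rw [← tsum_enorm_inner_sq (stdBasis H), ← hsNormSq_star, hsNormSq, ← ENNReal.tsum_mul_right]
  refine ENNReal.tsum_le_tsum fun i => ?_
  rw [← ContinuousLinearMap.adjoint_inner_left, ← mul_pow]
  refine pow_le_pow_left' ?_ 2
  rw [← ofReal_norm, ← ofReal_norm, ← ofReal_norm, ← ENNReal.ofReal_mul (norm_nonneg _)]
  exact ENNReal.ofReal_le_ofReal (norm_inner_le_norm _ _)

theorem quad_sqrt_apply_le (ρ : H →L[ℂ] H) {B : H →L[ℂ] H} (hB : 0 ≤ B) (x : H) :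
    quad B (CFC.sqrt ρ x) ≤ posTrace ρ B * ‖x‖ₑ ^ 2 := by
  rw [posTrace_eq_hsNormSq ρ hB, ← enorm_sqrt_apply_sq hB]
  exact enorm_apply_sq_le_hsNormSq (CFC.sqrt B * CFC.sqrt ρ) x

theorem trConj_le_of_relBoundedWith (hE : trConj S ρ ≠ ⊤) {A : S.domain →ₗ[ℂ] H} {a b : ℝ}
    (hA : RelBoundedWith S A a b) :
    trConj ⟨S.domain, A⟩ ρ ≤
      ENNReal.ofReal (a ^ 2) * posTrace ρ 1 + ENNReal.ofReal (b ^ 2) * trConj S ρ := by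
  rw [posTrace_one, trConj, trConj, hsNormSq, ← ENNReal.tsum_mul_left, ← ENNReal.tsum_mul_left,
    ← ENNReal.tsum_add]
  refine ENNReal.tsum_le_tsum fun i => ?_
  have hmem : CFC.sqrt ρ (stdBasis H i) ∈ S.domain :=
    mem_of_sqNorm_ne_top (ENNReal.ne_top_of_tsum_ne_top hE i)
  rw [sqNorm_of_mem hmem, sqNorm_of_mem (T := ⟨S.domain, A⟩) hmem, enorm_sq_eq_ofReal,
    enorm_sq_eq_ofReal, enorm_sq_eq_ofReal, ← ENNReal.ofReal_mul (sq_nonneg _),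
    ← ENNReal.ofReal_mul (sq_nonneg _), ← ENNReal.ofReal_add (by positivity) (by positivity)]
  exact ENNReal.ofReal_le_ofReal (hA ⟨_, hmem⟩)

theorem trConj_ketBra_of_mem {T : H →ₗ.[ℂ] H} {φ : H} (hφ : ‖φ‖ = 1) (h : φ ∈ T.domain) :
    trConj T (ketBra φ) = ‖T ⟨φ, h⟩‖ₑ ^ 2 := by
  have hterm (i) : sqNorm T (CFC.sqrt (ketBra φ) (stdBasis H i)) =
      ‖⟪stdBasis H i, φ⟫_ℂ‖ₑ ^ 2 * ‖T ⟨φ, h⟩‖ₑ ^ 2 := by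
    rw [sqrt_ketBra hφ, InnerProductSpace.rankOne_apply,
      sqNorm_of_mem (T.domain.smul_mem _ h), enorm_inner_symm, ← mul_pow, ← enorm_smul,
      ← LinearPMap.map_smul]
    rfl
  simp only [trConj, hterm]
  rw [ENNReal.tsum_mul_right, tsum_enorm_inner_sq, enorm_sq_eq_ofReal φ, hφ]
  simp

theorem exists_norm_sqrt_sum_mul_le {ι : Type*} {Y : ι → H →L[ℂ] H} (hY : ∀ i, 0 ≤ Y i)
    {R : H →L[ℂ] H} (h : ∀ y, ∑' i, quad (Y i) (R y) ≠ ⊤) :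
    ∃ C : ℝ, ∀ F : Finset ι, ‖CFC.sqrt (∑ i ∈ F, Y i) * R‖ ≤ C := by
  refine banach_steinhaus fun y => ⟨√(∑' i, quad (Y i) (R y)).toReal, fun F => ?_⟩
  refine Real.le_sqrt_of_sq_le ?_
  rw [← ENNReal.ofReal_le_iff_le_toReal (h y), ← enorm_sq_eq_ofReal, mul_apply_eq_comp,
    enorm_sqrt_apply_sq (Finset.sum_nonneg fun i _ => hY i), quad_sum F hY]
  exact ENNReal.sum_le_tsum F

theorem posTrace_sum {ι : Type*} (ρ : H →L[ℂ] H) {Y : ι → H →L[ℂ] H} (hY : ∀ i, 0 ≤ Y i)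
    (F : Finset ι) : posTrace ρ (∑ i ∈ F, Y i) = ∑ i ∈ F, posTrace ρ (Y i) := by
  simp only [posTrace, quad_sum F hY]
  exact Summable.tsum_finsetSum fun i _ => ENNReal.summable

namespace IsResolventCompl

variable (hQ : IsResolventCompl S Q)

include hQ

theorem sqNorm_sqrt_le (ρ : H →L[ℂ] H) (x : H) :
    sqNorm S (CFC.sqrt ρ x) ≤ trConj S ρ * ‖x‖ₑ ^ 2 := by
  rw [hQ.sqNorm_eq, hQ.trConj_eq, ← ENNReal.tsum_mul_right]
  exact ENNReal.tsum_le_tsum fun p => quad_sqrt_apply_le ρ (hQ.pow_nonneg (p.1 + p.2 + 2)) x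

theorem exists_apply_sqrt_eq (hE : trConj S ρ ≠ ⊤) :
    ∃ T : H →L[ℂ] H, ∀ x, ∃ h : CFC.sqrt ρ x ∈ S.domain, S ⟨CFC.sqrt ρ x, h⟩ = T x := by
  have hfin (x : H) : trConj S ρ * ‖x‖ₑ ^ 2 ≠ ⊤ :=
    ENNReal.mul_ne_top hE (ENNReal.pow_ne_top enorm_ne_top)
  have hmem (x : H) : CFC.sqrt ρ x ∈ S.domain :=
    mem_of_sqNorm_ne_top (ne_top_of_le_ne_top (hfin x) (hQ.sqNorm_sqrt_le ρ x))
  refine ⟨LinearMap.mkContinuous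
    (S.toFun ∘ₗ LinearMap.codRestrict S.domain (CFC.sqrt ρ).toLinearMap hmem)
    √(trConj S ρ).toReal fun x => ?_, fun x => ⟨hmem x, rfl⟩⟩
  have h := hQ.sqNorm_sqrt_le ρ x
  rw [sqNorm_of_mem (hmem x)] at h
  have hreal := ENNReal.toReal_mono (hfin x) h
  rw [ENNReal.toReal_mul, ENNReal.toReal_pow, ENNReal.toReal_pow, toReal_enorm,
    toReal_enorm] at hreal
  refine le_of_pow_le_pow_left₀ two_ne_zero (by positivity) ?_
  rwa [mul_pow, Real.sq_sqrt ENNReal.toReal_nonneg]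

theorem exists_sqrt_eq_mul (hE : trConj S ρ ≠ ⊤) :
    ∃ W : H →L[ℂ] H, CFC.sqrt ρ = (1 - Q) * W := by
  obtain ⟨T, hT⟩ := hQ.exists_apply_sqrt_eq hE
  refine ⟨CFC.sqrt ρ + T, ContinuousLinearMap.ext fun x => ?_⟩
  obtain ⟨hmem, hSx⟩ := hT x
  rw [mul_apply_eq_comp, add_apply, ← hSx]
  exact (hQ.left_inv ⟨_, hmem⟩).symm

theorem trConj_eq_hsNormSq {W : H →L[ℂ] H} (hW : CFC.sqrt ρ = (1 - Q) * W) :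
    trConj S ρ = hsNormSq (Q * W) := by
  simp only [trConj, hW, hsNormSq, mul_apply_eq_comp]
  exact tsum_congr fun i => by rw [sqNorm_of_mem (hQ.mem _), hQ.apply_eq]

theorem trConj_eq_hsNormSq_lift_mul {W : H →L[ℂ] H} (hW : CFC.sqrt ρ = (1 - Q) * W)
    (A : relBounded S) : trConj ⟨S.domain, A.1⟩ ρ = hsNormSq (hQ.lift A * W) := by
  simp only [trConj, hW, hsNormSq, mul_apply_eq_comp]
  exact tsum_congr fun i => sqNorm_of_mem (T := ⟨S.domain, A.1⟩) (hQ.mem _)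

theorem hsNormSq_le {W : H →L[ℂ] H} (hW : CFC.sqrt ρ = (1 - Q) * W) :
    hsNormSq W ≤ 2 * (posTrace ρ 1 + trConj S ρ) := by
  rw [hQ.trConj_eq_hsNormSq hW, posTrace_one, hW, hsNormSq, hsNormSq, hsNormSq,
    ← ENNReal.tsum_add, ← ENNReal.tsum_mul_left]
  refine ENNReal.tsum_le_tsum fun i => ?_
  have hsplit (x : H) : W x = ((1 - Q) * W) x + (Q * W) x := by
    rw [← add_apply, ← add_mul, sub_add_cancel, one_mul]
  rw [hsplit]
  exact enorm_add_sq_le _ _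

-- With `√ρ = (1 - Q) W` and `√σ = (1 - Q) W'`, the inequality `c ρ ≤ σ` says that
-- `c ‖W* x‖² ≤ ‖W'* x‖²` on the dense range of `1 - Q`.
theorem mul_trConj_le (hρ : 0 ≤ ρ) (hσ : 0 ≤ σ) (hEρ : trConj S ρ ≠ ⊤) (hEσ : trConj S σ ≠ ⊤)
    {c : ℝ} (hc : 0 ≤ c) (h : (c : ℂ) • ρ ≤ σ) (A : relBounded S) :
    ENNReal.ofReal c * trConj ⟨S.domain, A.1⟩ ρ ≤ trConj ⟨S.domain, A.1⟩ σ := by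
  obtain ⟨W, hW⟩ := hQ.exists_sqrt_eq_mul hEρ
  obtain ⟨W', hW'⟩ := hQ.exists_sqrt_eq_mul hEσ
  have hR : (0 : H →L[ℂ] H) ≤ 1 - Q := sub_nonneg.2 hQ.le_one
  have hquad {τ V : H →L[ℂ] H} (hτ : 0 ≤ τ) (hV : CFC.sqrt τ = (1 - Q) * V) (x : H) :
      ‖star V ((1 - Q : H →L[ℂ] H) x)‖ₑ ^ 2 = quad τ x := by
    rw [← enorm_sqrt_apply_sq hτ, ← star_sqrt, hV, star_mul, hR.isSelfAdjoint.star_eq,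
      mul_apply_eq_comp]
  have hle (y : H) : c * ‖star W y‖ ^ 2 ≤ ‖star W' y‖ ^ 2 := by
    refine (denseRange_of_nonneg_of_injective hR hQ.injective).induction_on
      (p := fun y => c * ‖star W y‖ ^ 2 ≤ ‖star W' y‖ ^ 2) y
      (isClosed_le (by fun_prop) (by fun_prop)) fun x => ?_
    rw [← ENNReal.ofReal_le_ofReal_iff (sq_nonneg _), ENNReal.ofReal_mul hc,
      ← enorm_sq_eq_ofReal, ← enorm_sq_eq_ofReal, hquad hρ hW, hquad hσ hW', ← quad_smul hc]
    exact quad_mono h x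
  rw [hQ.trConj_eq_hsNormSq_lift_mul hW, hQ.trConj_eq_hsNormSq_lift_mul hW', ← hsNormSq_star,
    star_mul, ← hsNormSq_star (hQ.lift A * W'), star_mul, hsNormSq, hsNormSq,
    ← ENNReal.tsum_mul_left]
  refine ENNReal.tsum_le_tsum fun i => ?_
  rw [enorm_sq_eq_ofReal, enorm_sq_eq_ofReal, ← ENNReal.ofReal_mul hc]
  exact ENNReal.ofReal_le_ofReal (hle _)

-- The missing trace is supplied by a pure state of low energy.
theorem exists_isState_smul_le
    (hlow : HasApproxKernel S) (hσ : 0 ≤ σ) (htr : posTrace σ 1 ≤ 1)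
    {c E F : ℝ} (hc : 0 ≤ c) (hc1 : c ≤ 1) (hE : 0 ≤ E) (hσE : trConj S σ ≤ ENNReal.ofReal E)
    (hF : c * E < F) : ∃ ρ, IsState ρ ∧ (c : ℂ) • σ ≤ ρ ∧ trConj S ρ ≤ ENNReal.ofReal F := by
  obtain ⟨φ, hφ, hφE⟩ := hlow (F - c * E) (sub_pos.2 hF)
  obtain ⟨t, ht0, ht1, hσt⟩ : ∃ t : ℝ, 0 ≤ t ∧ t ≤ 1 ∧ posTrace σ 1 = ENNReal.ofReal t :=
    ⟨_, ENNReal.toReal_nonneg, ENNReal.toReal_le_of_le_ofReal zero_le_one (by simpa using htr),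
      (ENNReal.ofReal_toReal (ne_top_of_le_ne_top ENNReal.one_ne_top htr)).symm⟩
  have hs0 : 0 ≤ 1 - c * t := sub_nonneg.2 (mul_le_one₀ hc1 ht0 ht1)
  have hs1 : 1 - c * t ≤ 1 := sub_le_self 1 (mul_nonneg hc ht0)
  have hcσ := smul_nonneg_of_real hc hσ
  have hsφ := smul_nonneg_of_real hs0 (ketBra_nonneg φ)
  have hφ1 : posTrace (ketBra φ) 1 = 1 := (isState_iff.1 (isState_ketBra hφ)).2
  refine ⟨(c : ℂ) • σ + ((1 - c * t : ℝ) : ℂ) • ketBra φ, ?_, le_add_of_nonneg_right hsφ, ?_⟩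
  · refine isState_iff.2 ⟨add_nonneg hcσ hsφ, ?_⟩
    rw [posTrace_add_left hcσ hsφ zero_le_one, posTrace_smul_left hc hσ zero_le_one,
      posTrace_smul_left hs0 (ketBra_nonneg φ) zero_le_one, hφ1, mul_one, hσt,
      ← ENNReal.ofReal_mul hc, ← ENNReal.ofReal_add (mul_nonneg hc ht0) hs0,
      add_sub_cancel, ENNReal.ofReal_one]
  · calc trConj S ((c : ℂ) • σ + ((1 - c * t : ℝ) : ℂ) • ketBra φ)
        = ENNReal.ofReal c * trConj S σ + ENNReal.ofReal (1 - c * t) * sqNorm S φ := by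
          rw [hQ.trConj_add hcσ hsφ, hQ.trConj_smul hc hσ, hQ.trConj_smul hs0 (ketBra_nonneg φ),
            hQ.trConj_ketBra]
      _ ≤ ENNReal.ofReal c * ENNReal.ofReal E + 1 * ENNReal.ofReal (F - c * E) := by
          gcongr
          exact ENNReal.ofReal_le_one.2 hs1
      _ = ENNReal.ofReal F := by
          rw [one_mul, ← ENNReal.ofReal_mul hc,
            ← ENNReal.ofReal_add (mul_nonneg hc hE) (sub_pos.2 hF).le, add_sub_cancel]

variable {Φ : (H →L[ℂ] H) →CP (H →L[ℂ] H)}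

theorem map_pow_nonneg (Φ : (H →L[ℂ] H) →CP (H →L[ℂ] H)) (n : ℕ) : 0 ≤ Φ (Q ^ n) :=
  map_nonneg Φ (hQ.pow_nonneg n)

theorem trConj_predual (hΦ : IsNormalMap Φ) (hρ : IsPosTraceClass ρ) :
    trConj S (predual Φ ρ) = ∑' p : ℕ × ℕ, posTrace ρ (Φ (Q ^ (p.1 + p.2 + 2))) := by
  rw [hQ.trConj_eq]
  exact tsum_congr fun p => hΦ.posTrace_predual hρ (hQ.pow_nonneg _)

theorem tsum_quad_map_pow_ne_top (hΦ : IsNormalMap Φ) {φ : H} (hφ : ‖φ‖ = 1)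
    (h : trConj S (predual Φ (ketBra φ)) ≠ ⊤) :
    ∑' p : ℕ × ℕ, quad (Φ (Q ^ (p.1 + p.2 + 2))) φ ≠ ⊤ := by
  rw [hQ.trConj_predual hΦ (isState_ketBra hφ).1] at h
  simpa only [posTrace_ketBra φ (hQ.map_pow_nonneg Φ _)] using h

-- Uniform boundedness turns finiteness of the energies of all `Φ_* |φ⟩⟨φ|` into a bound.
theorem exists_trConj_predual_le (hΦ : IsNormalMap Φ)
    (h : ∀ φ ∈ S.domain, ‖φ‖ = 1 → trConj S (predual Φ (ketBra φ)) ≠ ⊤) :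
    ∃ C : ℝ≥0∞, C ≠ ⊤ ∧ ∀ ρ, IsPosTraceClass ρ → trConj S ρ ≠ ⊤ →
      trConj S (predual Φ ρ) ≤ C * (posTrace ρ 1 + trConj S ρ) := by
  have hX (p : ℕ × ℕ) : 0 ≤ Φ (Q ^ (p.1 + p.2 + 2)) := hQ.map_pow_nonneg Φ _
  have hq (y : H) :
      ∑' p : ℕ × ℕ, quad (Φ (Q ^ (p.1 + p.2 + 2))) ((1 - Q : H →L[ℂ] H) y) ≠ ⊤ := by
    set φ := (1 - Q : H →L[ℂ] H) y
    rcases eq_or_ne φ 0 with h0 | h0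
    · simp [h0, quad]
    have hunit : ‖((‖φ‖ : ℂ)⁻¹ • φ)‖ = 1 := norm_smul_inv_norm h0
    have hscale : φ = (‖φ‖ : ℂ) • ((‖φ‖ : ℂ)⁻¹ • φ) :=
      (smul_inv_smul₀ (Complex.ofReal_ne_zero.2 (norm_ne_zero_iff.2 h0)) φ).symm
    rw [hscale]
    simp only [quad_smul_right _ (‖φ‖ : ℂ)]
    rw [ENNReal.tsum_mul_left]
    exact ENNReal.mul_ne_top (ENNReal.pow_ne_top enorm_ne_top)
      (hQ.tsum_quad_map_pow_ne_top hΦ hunit (h _ (S.domain.smul_mem _ (hQ.mem y)) hunit))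
  obtain ⟨C, hC⟩ := exists_norm_sqrt_sum_mul_le hX hq
  refine ⟨ENNReal.ofReal C ^ 2 * 2, ENNReal.mul_ne_top (ENNReal.pow_ne_top ENNReal.ofReal_ne_top)
    ENNReal.ofNat_ne_top, fun ρ hρ hE => ?_⟩
  obtain ⟨W, hW⟩ := hQ.exists_sqrt_eq_mul hE
  rw [hQ.trConj_predual hΦ hρ, ENNReal.tsum_eq_iSup_sum]
  refine iSup_le fun F => ?_
  rw [← posTrace_sum ρ hX, posTrace_eq_hsNormSq ρ (Finset.sum_nonneg fun p _ => hX p), hW,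
    ← mul_assoc, mul_assoc (ENNReal.ofReal C ^ 2)]
  refine (hsNormSq_mul_le _ _).trans (mul_le_mul' (pow_le_pow_left' ?_ 2) (hQ.hsNormSq_le hW))
  rw [← ofReal_norm]
  exact ENNReal.ofReal_le_ofReal (hC F)

end IsResolventCompl

end FiniteEnergy

/-! ### Extension to relatively bounded operators -/

section Extension

theorem tendsto_zero_of_enorm_sq_le {E : Type*} [SeminormedAddCommGroup E] {u : ℕ → E}
    {f : ℕ → ℝ≥0∞} (hf : Tendsto f atTop (𝓝 0)) (h : ∀ n, ‖u n‖ₑ ^ 2 ≤ f n) :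
    Tendsto u atTop (𝓝 0) := by
  have hsq : Tendsto (fun n => ‖u n‖ₑ ^ 2) atTop (𝓝 0) :=
    tendsto_of_tendsto_of_tendsto_of_le_of_le tendsto_const_nhds hf (fun n => zero_le) h
  have hsqrt := ((Real.continuous_sqrt.tendsto _).comp
    ((ENNReal.tendsto_toReal ENNReal.zero_ne_top).comp hsq))
  rw [ENNReal.toReal_zero, Real.sqrt_zero] at hsqrt
  refine tendsto_zero_iff_norm_tendsto_zero.2 (hsqrt.congr fun n => ?_)
  simp [Real.sqrt_sq]

theorem cauchySeq_of_enorm_sub_sq_le {E : Type*} [SeminormedAddCommGroup E] {u : ℕ → E}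
    {f : ℕ → ℝ≥0∞} (hf : Tendsto f atTop (𝓝 0)) (h : ∀ m n, ‖u m - u n‖ₑ ^ 2 ≤ f m + f n) :
    CauchySeq u := by
  rw [Metric.cauchySeq_iff]
  intro ε hε
  have hε2 : 0 < ENNReal.ofReal (ε ^ 2 / 2) := ENNReal.ofReal_pos.2 (by positivity)
  obtain ⟨N, hN⟩ := eventually_atTop.1 (hf.eventually_lt_const hε2)
  refine ⟨N, fun m hm n hn => ?_⟩
  have hlt := (h m n).trans_lt (ENNReal.add_lt_add (hN m hm) (hN n hn))
  rw [← ENNReal.ofReal_add (by positivity) (by positivity), add_halves, enorm_sq_eq_ofReal] at hlt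
  rw [dist_eq_norm]
  exact lt_of_pow_lt_pow_left₀ 2 hε.le ((ENNReal.ofReal_lt_ofReal_iff (by positivity)).1 hlt)

theorem quad_le_enorm_mul {H : Type*} [NormedAddCommGroup H] [InnerProductSpace ℂ H]
    (B : H →L[ℂ] H) (x : H) : quad B x ≤ ‖B‖ₑ * ‖x‖ₑ ^ 2 := by
  rw [enorm_sq_eq_ofReal, ← ofReal_norm, ← ENNReal.ofReal_mul (norm_nonneg _)]
  refine ENNReal.ofReal_le_ofReal ?_
  calc (⟪x, B x⟫_ℂ).re ≤ ‖x‖ * ‖B x‖ := (Complex.re_le_norm _).trans (norm_inner_le_norm _ _)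
    _ ≤ ‖x‖ * (‖B‖ * ‖x‖) := by gcongr; exact B.le_opNorm x
    _ = ‖B‖ * ‖x‖ ^ 2 := by ring

theorem RelBoundedWith.of_unit {H : Type*} [NormedAddCommGroup H] [InnerProductSpace ℂ H]
    {S : H →ₗ.[ℂ] H} {A : S.domain →ₗ[ℂ] H} {a b : ℝ}
    (h : ∀ φ : S.domain, ‖(φ : H)‖ = 1 → ‖A φ‖ ^ 2 ≤ a ^ 2 + b ^ 2 * ‖S φ‖ ^ 2) :
    RelBoundedWith S A a b := by
  intro φ
  rcases eq_or_ne φ 0 with rfl | h0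
  · simp
  have hφ : (φ : H) ≠ 0 := fun hφ => h0 (Subtype.ext hφ)
  have hn : ‖(φ : H)‖ ≠ 0 := norm_ne_zero_iff.2 hφ
  have hu := h ((‖(φ : H)‖ : ℂ)⁻¹ • φ) (norm_smul_inv_norm hφ)
  rw [map_smul, LinearPMap.map_smul, norm_smul, norm_smul, norm_inv, Complex.norm_real,
    norm_norm, mul_pow, mul_pow, inv_pow] at hu
  calc ‖A φ‖ ^ 2 = ‖(φ : H)‖ ^ 2 * ((‖(φ : H)‖ ^ 2)⁻¹ * ‖A φ‖ ^ 2) := by field_simp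
    _ ≤ ‖(φ : H)‖ ^ 2 * (a ^ 2 + b ^ 2 * ((‖(φ : H)‖ ^ 2)⁻¹ * ‖S φ‖ ^ 2)) := by gcongr
    _ = a ^ 2 * ‖(φ : H)‖ ^ 2 + b ^ 2 * ‖S φ‖ ^ 2 := by field_simp

variable {H : Type*} [NormedAddCommGroup H] [InnerProductSpace ℂ H] [CompleteSpace H]

theorem hsNormSq_eq_ofReal {T : H →L[ℂ] H} (h : hsNormSq T ≠ ⊤) :
    hsNormSq T = ENNReal.ofReal (∑' i, ‖T (stdBasis H i)‖ ^ 2) := by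
  rw [ENNReal.ofReal_tsum_of_nonneg (fun i => sq_nonneg _) (summable_norm_sq_of_tsum_ne_top h)]
  exact tsum_congr fun i => enorm_sq_eq_ofReal _

theorem hsNormSq_sub_le (X Y : H →L[ℂ] H) :
    hsNormSq (X - Y) ≤ 2 * (hsNormSq X + hsNormSq Y) := by
  rw [hsNormSq, hsNormSq, hsNormSq, ← ENNReal.tsum_add, ← ENNReal.tsum_mul_left]
  refine ENNReal.tsum_le_tsum fun i => ?_
  rw [sub_apply, sub_eq_add_neg, ← enorm_neg (Y (stdBasis H i))]
  exact enorm_add_sq_le _ _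

theorem tendsto_hsNormSq_mul {T : ℕ → H →L[ℂ] H} {T' W : H →L[ℂ] H} (hW : hsNormSq W ≠ ⊤) {K : ℝ}
    (hK : ∀ n x, ‖T n x‖ ≤ K * ‖x‖) (hT : ∀ x, Tendsto (fun n => T n x) atTop (𝓝 (T' x))) :
    Tendsto (fun n => hsNormSq (T n * W)) atTop (𝓝 (hsNormSq (T' * W))) := by
  simp only [hsNormSq_eq_ofReal (hsNormSq_mul_ne_top _ hW)]
  refine ENNReal.tendsto_ofReal ?_
  refine tendsto_tsum_of_dominated_convergence
    (bound := fun i => K ^ 2 * ‖W (stdBasis H i)‖ ^ 2)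
    ((summable_norm_sq_of_tsum_ne_top hW).mul_left _)
    (fun i => ((hT (W (stdBasis H i))).norm).pow 2) (Eventually.of_forall fun n i => ?_)
  rw [norm_pow, norm_norm, ← mul_pow]
  exact pow_le_pow_left₀ (norm_nonneg _) (hK n _) 2

theorem isPosTraceClass_ketBra (φ : H) : IsPosTraceClass (ketBra φ) := by
  rw [isPosTraceClass_iff, posTrace_ketBra φ zero_le_one]
  exact ⟨ketBra_nonneg φ, quad_ne_top 1 φ⟩

variable {S : H →ₗ.[ℂ] H} {Q ρ : H →L[ℂ] H} {Φ : (H →L[ℂ] H) →CP (H →L[ℂ] H)}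

theorem hsNormSq_map_mul_sqrt_le (hΦ : IsNormalMap Φ) (hρ : IsPosTraceClass ρ)
    (B : H →L[ℂ] H) :
    hsNormSq (Φ B * CFC.sqrt ρ) ≤ ‖Φ 1‖ₑ * hsNormSq (B * CFC.sqrt (predual Φ ρ)) := by
  rw [← posTrace_star_mul_self (predual Φ ρ), hΦ.posTrace_predual hρ (star_mul_self_nonneg B),
    posTrace, hsNormSq, ← ENNReal.tsum_mul_left]
  exact ENNReal.tsum_le_tsum fun i => enorm_map_apply_sq_le Φ B _

theorem enorm_map_apply_sq_le_hsNormSq (hΦ : IsNormalMap Φ) (B : H →L[ℂ] H) (φ : H) :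
    ‖Φ B φ‖ₑ ^ 2 ≤ ‖Φ 1‖ₑ * hsNormSq (B * CFC.sqrt (predual Φ (ketBra φ))) := by
  rw [← posTrace_star_mul_self,
    hΦ.posTrace_predual (isPosTraceClass_ketBra φ) (star_mul_self_nonneg B),
    posTrace_ketBra φ (map_nonneg Φ (star_mul_self_nonneg B))]
  exact enorm_map_apply_sq_le Φ B φ

/-- `Φ_*` maps operators of finite energy `Tr S² ρ` to operators of finite energy. -/
def PreservesFiniteEnergy (Φ : (H →L[ℂ] H) →CP (H →L[ℂ] H)) (S : H →ₗ.[ℂ] H) : Prop :=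
  ∀ ρ, IsPosTraceClass ρ → trConj S ρ ≠ ⊤ → trConj S (predual Φ ρ) ≠ ⊤

namespace IsResolventCompl

variable (hQ : IsResolventCompl S Q)

include hQ

theorem norm_mul_pow_apply_le (A : H →L[ℂ] H) (n : ℕ) (x : H) : ‖(A * Q ^ n) x‖ ≤ ‖A‖ * ‖x‖ :=
  A.le_opNorm_of_le (norm_pow_apply_le hQ.nonneg hQ.le_one n x)

theorem tendsto_mul_pow_apply (A : H →L[ℂ] H) (x : H) :
    Tendsto (fun n => (A * Q ^ n) x) atTop (𝓝 0) := by
  have h := (A.continuous.tendsto 0).comp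
    (tendsto_pow_apply_zero hQ.nonneg hQ.le_one hQ.injective x)
  rwa [map_zero] at h

theorem tendsto_mul_hsNormSq_mul_pow {c : ℝ≥0∞} (hc : c ≠ ⊤) (A : H →L[ℂ] H) {W : H →L[ℂ] H}
    (hW : hsNormSq W ≠ ⊤) : Tendsto (fun n => c * hsNormSq (A * Q ^ n * W)) atTop (𝓝 0) := by
  have h := ENNReal.Tendsto.const_mul (a := c) (tendsto_hsNormSq_mul (T' := 0) hW
    (hQ.norm_mul_pow_apply_le A) (hQ.tendsto_mul_pow_apply A)) (Or.inr hc)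
  have h0 : c * hsNormSq (0 * W) = 0 := by simp [hsNormSq]
  rwa [h0] at h

theorem tendsto_hsNormSq_mul_one_sub_pow (A : H →L[ℂ] H) {W : H →L[ℂ] H} (hW : hsNormSq W ≠ ⊤) :
    Tendsto (fun n => hsNormSq (A * (1 - Q ^ n) * W)) atTop (𝓝 (hsNormSq (A * W))) := by
  refine tendsto_hsNormSq_mul hW (K := 2 * ‖A‖) (fun n x => ?_) fun x => ?_
  · rw [mul_sub, mul_one, sub_apply]
    linarith [norm_sub_le (A x) ((A * Q ^ n) x), A.le_opNorm x, hQ.norm_mul_pow_apply_le A n x]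
  · simp only [mul_sub, mul_one, sub_apply]
    simpa only [sub_zero] using tendsto_const_nhds.sub (hQ.tendsto_mul_pow_apply A x)

theorem trConj_ketBra_ne_top (φ : S.domain) : trConj S (ketBra (φ : H)) ≠ ⊤ := by
  rw [hQ.trConj_ketBra, sqNorm_of_mem φ.2]
  exact ENNReal.pow_ne_top enorm_ne_top

theorem exists_sqrt_predual_eq_mul (hΦ : IsNormalMap Φ) (hpres : PreservesFiniteEnergy Φ S)
    (hρ : IsPosTraceClass ρ) (hE : trConj S ρ ≠ ⊤) :
    ∃ W : H →L[ℂ] H, hsNormSq W ≠ ⊤ ∧ CFC.sqrt (predual Φ ρ) = (1 - Q) * W := by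
  obtain ⟨W, hW⟩ := hQ.exists_sqrt_eq_mul (hpres ρ hρ hE)
  refine ⟨W, ne_top_of_le_ne_top ?_ (hQ.hsNormSq_le hW), hW⟩
  exact ENNReal.mul_ne_top ENNReal.ofNat_ne_top
    (ENNReal.add_ne_top.2 ⟨(isPosTraceClass_iff.1 (hΦ.predual_spec hρ).1).2, hpres ρ hρ hE⟩)

theorem cauchySeq_map_approx_apply (hΦ : IsNormalMap Φ) (hpres : PreservesFiniteEnergy Φ S)
    (A : relBounded S) (φ : S.domain) : CauchySeq fun n => Φ (hQ.approx A n) (φ : H) := by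
  obtain ⟨W, hW, hσ⟩ := hQ.exists_sqrt_predual_eq_mul hΦ hpres (isPosTraceClass_ketBra (φ : H))
    (hQ.trConj_ketBra_ne_top φ)
  refine cauchySeq_of_enorm_sub_sq_le (hQ.tendsto_mul_hsNormSq_mul_pow
    (ENNReal.mul_ne_top enorm_ne_top ENNReal.ofNat_ne_top : ‖Φ 1‖ₑ * 2 ≠ ⊤) (hQ.lift A) hW)
    fun m n => ?_
  have hdiff : (hQ.approx A m - hQ.approx A n) * CFC.sqrt (predual Φ (ketBra (φ : H))) =
      hQ.lift A * Q ^ n * W - hQ.lift A * Q ^ m * W := by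
    rw [hσ, ← mul_assoc, sub_mul, hQ.approx_mul, hQ.approx_mul]
    noncomm_ring
  rw [← sub_apply, ← map_sub, ← mul_add, mul_assoc]
  refine (enorm_map_apply_sq_le_hsNormSq hΦ _ _).trans (mul_le_mul_right ?_ _)
  rw [hdiff, add_comm]
  exact hsNormSq_sub_le _ _

/-- The extension of `Φ` as a map to linear operators on the domain of `S`: the strong limit of
`Φ (A (1 - Qⁿ))`. -/
noncomputable def extendOnDomain (hΦ : IsNormalMap Φ)
    (hpres : PreservesFiniteEnergy Φ S) : relBounded S →ₗ[ℂ] S.domain →ₗ[ℂ] H :=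
  have hlim (A φ) := (hQ.cauchySeq_map_approx_apply hΦ hpres A φ).tendsto_limUnder
  LinearMap.mk₂ ℂ (fun A φ => limUnder atTop fun n => Φ (hQ.approx A n) (φ : H))
    (fun A B φ => Tendsto.limUnder_eq (((hlim A φ).add (hlim B φ)).congr fun n => by
      rw [hQ.approx_add, map_add, add_apply]))
    (fun c A φ => Tendsto.limUnder_eq (((hlim A φ).const_smul c).congr fun n => by
      rw [hQ.approx_smul, map_smul, smul_apply]))
    (fun A φ ψ => Tendsto.limUnder_eq (((hlim A φ).add (hlim A ψ)).congr fun n => by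
      rw [Submodule.coe_add, map_add]))
    (fun c A φ => Tendsto.limUnder_eq (((hlim A φ).const_smul c).congr fun n => by
      rw [Submodule.coe_smul, map_smul]))

theorem tendsto_extendOnDomain (hΦ : IsNormalMap Φ) (hpres : PreservesFiniteEnergy Φ S)
    (A : relBounded S) (φ : S.domain) :
    Tendsto (fun n => Φ (hQ.approx A n) (φ : H)) atTop (𝓝 (hQ.extendOnDomain hΦ hpres A φ)) :=
  (hQ.cauchySeq_map_approx_apply hΦ hpres A φ).tendsto_limUnder

theorem extendOnDomain_ofBounded (hΦ : IsNormalMap Φ) (hpres : PreservesFiniteEnergy Φ S)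
    (A : H →L[ℂ] H) (φ : S.domain) :
    hQ.extendOnDomain hΦ hpres (ofBounded S A) φ = Φ A (φ : H) := by
  refine tendsto_nhds_unique (hQ.tendsto_extendOnDomain hΦ hpres _ φ) ?_
  have hσ : hsNormSq (CFC.sqrt (predual Φ (ketBra (φ : H)))) ≠ ⊤ := by
    rw [← posTrace_one]
    exact (isPosTraceClass_iff.1 (hΦ.predual_spec (isPosTraceClass_ketBra (φ : H))).1).2
  have herr : Tendsto (fun n => Φ (A * Q ^ n) (φ : H)) atTop (𝓝 0) :=
    tendsto_zero_of_enorm_sq_le (hQ.tendsto_mul_hsNormSq_mul_pow enorm_ne_top A hσ)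
      fun n => enorm_map_apply_sq_le_hsNormSq hΦ _ _
  simpa only [hQ.approx_ofBounded, map_sub, sub_apply, sub_zero] using
    tendsto_const_nhds.sub herr

theorem trConj_extendOnDomain_le (hΦ : IsNormalMap Φ) (hpres : PreservesFiniteEnergy Φ S)
    (A : relBounded S) (hρ : IsPosTraceClass ρ) (hE : trConj S ρ ≠ ⊤) :
    trConj ⟨S.domain, hQ.extendOnDomain hΦ hpres A⟩ ρ ≤
      ‖Φ 1‖ₑ * trConj ⟨S.domain, A.1⟩ (predual Φ ρ) := by
  obtain ⟨W, hW, hσ⟩ := hQ.exists_sqrt_predual_eq_mul hΦ hpres hρ hE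
  rw [hQ.trConj_eq_hsNormSq_lift_mul hσ, trConj, ENNReal.tsum_eq_iSup_sum]
  refine iSup_le fun F => ?_
  have hmem (i) : CFC.sqrt ρ (stdBasis H i) ∈ S.domain :=
    mem_of_sqNorm_ne_top (ENNReal.ne_top_of_tsum_ne_top hE i)
  have hleft : Tendsto
      (fun n => ∑ i ∈ F, ‖Φ (hQ.approx A n) (CFC.sqrt ρ (stdBasis H i))‖ₑ ^ 2) atTop
      (𝓝 (∑ i ∈ F, sqNorm ⟨S.domain, hQ.extendOnDomain hΦ hpres A⟩
        (CFC.sqrt ρ (stdBasis H i)))) := by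
    refine tendsto_finsetSum F fun i _ => ?_
    rw [sqNorm_of_mem (T := ⟨S.domain, hQ.extendOnDomain hΦ hpres A⟩) (hmem i)]
    exact ENNReal.Tendsto.pow (hQ.tendsto_extendOnDomain hΦ hpres A ⟨_, hmem i⟩).enorm
  have hright := ENNReal.Tendsto.const_mul (a := ‖Φ 1‖ₑ)
    (hQ.tendsto_hsNormSq_mul_one_sub_pow (hQ.lift A) hW) (Or.inr enorm_ne_top)
  refine le_of_tendsto_of_tendsto' hleft hright fun n => (ENNReal.sum_le_tsum F).trans ?_
  rw [← hQ.approx_mul, mul_assoc, ← hσ]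
  exact hsNormSq_map_mul_sqrt_le hΦ hρ (hQ.approx A n)

theorem relBoundedWith_extendOnDomain (hΦ : IsNormalMap Φ) (hpres : PreservesFiniteEnergy Φ S)
    {A : relBounded S} {a b : ℝ} (hA : RelBoundedWith S A.1 a b) {c d : ℝ} (hc : 0 ≤ c)
    (hd : 0 ≤ d) (h : ∀ φ : S.domain, ‖(φ : H)‖ = 1 →
      trConj S (predual Φ (ketBra (φ : H))) ≤ ENNReal.ofReal (c + d * ‖S φ‖ ^ 2)) :
    RelBoundedWith S (hQ.extendOnDomain hΦ hpres A) √(‖Φ 1‖ * (a ^ 2 * ‖Φ 1‖ + b ^ 2 * c))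
      (√(d * ‖Φ 1‖) * b) := by
  refine RelBoundedWith.of_unit fun φ hφ => ?_
  have hρ := isPosTraceClass_ketBra (φ : H)
  have hE := hQ.trConj_ketBra_ne_top φ
  have htr : posTrace (predual Φ (ketBra (φ : H))) 1 ≤ ENNReal.ofReal ‖Φ 1‖ := by
    rw [hΦ.posTrace_predual hρ zero_le_one, posTrace_ketBra _ (map_nonneg Φ zero_le_one)]
    simpa [enorm_sq_eq_ofReal, hφ] using quad_le_enorm_mul (Φ 1) (φ : H)
  rw [mul_pow, Real.sq_sqrt (by positivity), Real.sq_sqrt (by positivity),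
    ← ENNReal.ofReal_le_ofReal_iff (by positivity), ← enorm_sq_eq_ofReal]
  calc ‖hQ.extendOnDomain hΦ hpres A φ‖ₑ ^ 2
      = trConj ⟨S.domain, hQ.extendOnDomain hΦ hpres A⟩ (ketBra (φ : H)) :=
        (trConj_ketBra_of_mem (T := ⟨S.domain, hQ.extendOnDomain hΦ hpres A⟩) hφ φ.2).symm
    _ ≤ ‖Φ 1‖ₑ * trConj ⟨S.domain, A.1⟩ (predual Φ (ketBra (φ : H))) :=
        hQ.trConj_extendOnDomain_le hΦ hpres A hρ hE
    _ ≤ ENNReal.ofReal ‖Φ 1‖ * (ENNReal.ofReal (a ^ 2) * ENNReal.ofReal ‖Φ 1‖ +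
          ENNReal.ofReal (b ^ 2) * ENNReal.ofReal (c + d * ‖S φ‖ ^ 2)) := by
        rw [ofReal_norm]
        gcongr
        exact (trConj_le_of_relBoundedWith (hpres _ hρ hE) hA).trans
          (add_le_add (mul_le_mul_right (htr.trans_eq (ofReal_norm _)) _)
            (mul_le_mul_right (h φ hφ) _))
    _ = ENNReal.ofReal (‖Φ 1‖ * (a ^ 2 * ‖Φ 1‖ + b ^ 2 * c) +
          d * ‖Φ 1‖ * b ^ 2 * ‖S φ‖ ^ 2) := by
        rw [← ENNReal.ofReal_mul (by positivity), ← ENNReal.ofReal_mul (by positivity),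
          ← ENNReal.ofReal_add (by positivity) (by positivity),
          ← ENNReal.ofReal_mul (by positivity)]
        congr 1
        ring

theorem extendOnDomain_mem (hΦ : IsNormalMap Φ) (hpres : PreservesFiniteEnergy Φ S)
    (A : relBounded S) : hQ.extendOnDomain hΦ hpres A ∈ relBounded S := by
  obtain ⟨C, hC, hbound⟩ := hQ.exists_trConj_predual_le hΦ fun φ hφ _ =>
    hpres _ (isPosTraceClass_ketBra φ) (hQ.trConj_ketBra_ne_top ⟨φ, hφ⟩)
  obtain ⟨a, b, -, hb, hA⟩ := A.2
  refine ⟨_, _, Real.sqrt_nonneg _, mul_nonneg (Real.sqrt_nonneg _) hb,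
    hQ.relBoundedWith_extendOnDomain hΦ hpres hA (c := C.toReal) (d := C.toReal)
      ENNReal.toReal_nonneg ENNReal.toReal_nonneg fun φ hφ => ?_⟩
  refine (hbound _ (isPosTraceClass_ketBra _) (hQ.trConj_ketBra_ne_top φ)).trans_eq ?_
  rw [(isState_iff.1 (isState_ketBra hφ)).2, hQ.trConj_ketBra, sqNorm_of_mem φ.2,
    enorm_sq_eq_ofReal, ← mul_one_add, ENNReal.ofReal_mul ENNReal.toReal_nonneg,
    ENNReal.ofReal_toReal hC, ENNReal.ofReal_add zero_le_one (sq_nonneg _), ENNReal.ofReal_one]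

/-- The extension of `Φ` to the space of `S`-bounded operators. -/
noncomputable def extend (hΦ : IsNormalMap Φ)
    (hpres : PreservesFiniteEnergy Φ S) : relBounded S →ₗ[ℂ] relBounded S :=
  (hQ.extendOnDomain hΦ hpres).codRestrict (relBounded S) (hQ.extendOnDomain_mem hΦ hpres)

theorem extend_ofBounded (hΦ : IsNormalMap Φ) (hpres : PreservesFiniteEnergy Φ S)
    (A : H →L[ℂ] H) : hQ.extend hΦ hpres (ofBounded S A) = ofBounded S (Φ A) :=
  Subtype.ext (LinearMap.ext fun φ => hQ.extendOnDomain_ofBounded hΦ hpres A φ)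

end IsResolventCompl

end Extension

/-! ### Energy and norm estimates -/

section Estimates

theorem le_ofReal_div_mul_of_forall_lt {x y : ℝ≥0∞} {E F : ℝ} (hE : 0 < E) (hF : 0 < F)
    (h : ∀ c, 0 ≤ c → c * F < E → ENNReal.ofReal c * x ≤ y) : x ≤ ENNReal.ofReal (F / E) * y := by
  have key : ENNReal.ofReal (E / F) * x ≤ y := by
    refine ENNReal.mul_le_of_forall_lt fun a ha b hb => ?_
    have ha' : a ≠ ⊤ := (ha.trans ENNReal.ofReal_lt_top).ne
    have hlt : a.toReal < E / F := (ENNReal.lt_ofReal_iff_toReal_lt ha').1 ha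
    calc a * b ≤ ENNReal.ofReal a.toReal * x := by rw [ENNReal.ofReal_toReal ha']; gcongr
      _ ≤ y := h _ ENNReal.toReal_nonneg ((lt_div_iff₀ hF).1 hlt)
  calc x = ENNReal.ofReal (F / E) * (ENNReal.ofReal (E / F) * x) := by
        rw [← mul_assoc, ← ENNReal.ofReal_mul (by positivity), div_mul_div_cancel₀ hE.ne',
          div_self hF.ne', ENNReal.ofReal_one, one_mul]
    _ ≤ _ := by gcongr

variable {H : Type*} [NormedAddCommGroup H] [InnerProductSpace ℂ H]

theorem relBound_nonneg {S : H →ₗ.[ℂ] H} (A : relBounded S) : 0 ≤ relBound S A :=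
  Real.sInf_nonneg fun _ hb => hb.1

theorem relBound_le {S : H →ₗ.[ℂ] H} {A : relBounded S} {a b : ℝ} (ha : 0 ≤ a) (hb : 0 ≤ b)
    (hA : RelBoundedWith S A.1 a b) : relBound S A ≤ b :=
  csInf_le ⟨0, fun _ h => h.1⟩ ⟨hb, a, ha, hA⟩

theorem le_mul_relBound {S : H →ₗ.[ℂ] H} {A : relBounded S} {r c : ℝ} (hc : 0 ≤ c)
    (h : ∀ a b, 0 ≤ a → 0 ≤ b → RelBoundedWith S A.1 a b → r ≤ c * b) :
    r ≤ c * relBound S A := by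
  obtain ⟨a₀, b₀, ha₀, hb₀, hA₀⟩ := A.2
  rw [relBound, ← smul_eq_mul, ← Real.sInf_smul_of_nonneg hc]
  refine le_csInf ⟨c • b₀, b₀, ⟨hb₀, a₀, ha₀, hA₀⟩, rfl⟩ ?_
  rintro _ ⟨b, ⟨hb, a, ha, hA⟩, rfl⟩
  exact h a b ha hb hA

theorem exists_norm_eq_one_of_dense [Nontrivial H] {D : Submodule ℂ H} (hD : Dense (D : Set H)) :
    ∃ φ : D, ‖φ‖ = 1 := by
  have : Nontrivial D := by
    refine D.nontrivial_iff_ne_bot.2 fun h => ?_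
    obtain ⟨x, hx⟩ := exists_ne (0 : H)
    refine hx (closure_minimal (s := (D : Set H)) ?_ isClosed_singleton (hD x))
    simp only [h, Submodule.bot_coe, subset_refl]
  exact exists_norm_eq D zero_le_one

variable [CompleteSpace H] {G : H →ₗ.[ℂ] H} {hG : IsPosSelfAdjoint G} {Q σ ρ : H →L[ℂ] H}
  {Φ : (H →L[ℂ] H) →CP (H →L[ℂ] H)}

theorem sqNorm_sqrtOp_le (φ : G.domain) :
    sqNorm (sqrtOp G hG) (φ : H) ≤ ENNReal.ofReal (‖(φ : H)‖ * ‖G φ‖) := by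
  have hs := sqrtOp_spec G hG
  obtain ⟨hφ, hSφ⟩ := (hs.mem_domain φ).1 φ.2
  have hsymm : ⟪sqrtOp G hG ⟨φ, hφ⟩, sqrtOp G hG ⟨φ, hφ⟩⟫_ℂ = ⟪(φ : H), G φ⟫_ℂ := by
    rw [hs.apply_eq φ hφ hSφ]
    exact hs.posSelfAdjoint.inner_symm ⟨φ, hφ⟩ ⟨_, hSφ⟩
  rw [sqNorm_of_mem hφ, enorm_sq_eq_ofReal, ← re_inner_self_eq, hsymm]
  exact ENNReal.ofReal_le_ofReal ((Complex.re_le_norm _).trans (norm_inner_le_norm _ _))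

theorem hasApproxKernel_sqrtOp [Nontrivial H]
    (hG0 : sInf {r : ℝ | ∃ φ : G.domain, ‖(φ : H)‖ = 1 ∧ r = ‖G φ‖} = 0) :
    HasApproxKernel (sqrtOp G hG) := by
  intro δ hδ
  obtain ⟨ψ, hψ⟩ := exists_norm_eq_one_of_dense hG.isSelfAdjoint.dense_domain
  have hne : {r : ℝ | ∃ φ : G.domain, ‖(φ : H)‖ = 1 ∧ r = ‖G φ‖}.Nonempty := ⟨_, ψ, hψ, rfl⟩
  obtain ⟨_, ⟨φ, hφ, rfl⟩, hr⟩ := exists_lt_of_csInf_lt hne (hG0.trans_lt hδ)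
  refine ⟨φ, hφ, (sqNorm_sqrtOp_le φ).trans (ENNReal.ofReal_le_ofReal ?_)⟩
  rw [hφ, one_mul]
  exact hr.le

theorem energy_predual_le_maxEnergy (hρ : IsState ρ) {E : ℝ}
    (hE : energy G hG ρ ≤ ENNReal.ofReal E) :
    energy G hG (predual Φ ρ) ≤ maxEnergy Φ G hG E :=
  le_iSup_of_le ρ (le_iSup_of_le hρ (le_iSup_of_le hE le_rfl))

theorem IsLimited.exists_energy_predual_le (hlim : IsLimited Φ G hG) (hΦ : IsNormalMap Φ) :
    ∃ C : ℝ≥0∞, C ≠ ⊤ ∧ ∀ ρ, IsPosTraceClass ρ → energy G hG ρ ≠ ⊤ →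
      energy G hG (predual Φ ρ) ≤ C * (posTrace ρ 1 + energy G hG ρ) := by
  obtain ⟨Q, hQ⟩ := (sqrtOp_spec G hG).posSelfAdjoint.exists_isResolventCompl
  exact hQ.exists_trConj_predual_le hΦ fun φ hφ hn =>
    (hlim _ (isState_ketBra hn) (hQ.trConj_ketBra_ne_top ⟨φ, hφ⟩).lt_top).ne

theorem IsLimited.preservesFiniteEnergy (hlim : IsLimited Φ G hG) (hΦ : IsNormalMap Φ) :
    PreservesFiniteEnergy Φ (sqrtOp G hG) := by
  obtain ⟨C, hC, h⟩ := hlim.exists_energy_predual_le hΦ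
  exact fun ρ hρ hE => ne_top_of_le_ne_top
    (ENNReal.mul_ne_top hC (ENNReal.add_ne_top.2 ⟨(isPosTraceClass_iff.1 hρ).2, hE⟩)) (h ρ hρ hE)

theorem IsLimited.maxEnergy_lt_top (hlim : IsLimited Φ G hG) (hΦ : IsNormalMap Φ) (E : ℝ) :
    maxEnergy Φ G hG E < ⊤ := by
  obtain ⟨C, hC, h⟩ := hlim.exists_energy_predual_le hΦ
  refine lt_of_le_of_lt (b := C * (1 + ENNReal.ofReal E)) ?_
    (ENNReal.mul_lt_top hC.lt_top (by simp))
  refine iSup_le fun ρ => iSup_le fun hρ => iSup_le fun hE => ?_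
  refine (h ρ hρ.1 (ne_top_of_le_ne_top ENNReal.ofReal_ne_top hE)).trans ?_
  rw [(isState_iff.1 hρ).2]
  gcongr

theorem IsResolventCompl.mul_trConj_predual_le {S : H →ₗ.[ℂ] H} (hQ : IsResolventCompl S Q)
    (hΦ : IsNormalMap Φ) (hσ : IsPosTraceClass σ) (hρ : IsPosTraceClass ρ) {c : ℝ} (hc : 0 ≤ c)
    (h : (c : ℂ) • σ ≤ ρ) :
    ENNReal.ofReal c * trConj S (predual Φ σ) ≤ trConj S (predual Φ ρ) := by
  rw [hQ.trConj_predual hΦ hσ, hQ.trConj_predual hΦ hρ, ← ENNReal.tsum_mul_left]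
  refine ENNReal.tsum_le_tsum fun p => ?_
  have hX := hQ.map_pow_nonneg Φ (p.1 + p.2 + 2)
  rw [← posTrace_smul_left hc hσ.1 hX]
  exact posTrace_mono_left (smul_nonneg_of_real hc hσ.1) h hX

theorem maxEnergy_le_ofReal_div_mul (hΦ : IsNormalMap Φ)
    (hlow : HasApproxKernel (sqrtOp G hG)) {E F : ℝ} (hE : 0 < E) (hEF : E ≤ F) :
    maxEnergy Φ G hG F ≤ ENNReal.ofReal (F / E) * maxEnergy Φ G hG E := by
  obtain ⟨Q, hQ⟩ := (sqrtOp_spec G hG).posSelfAdjoint.exists_isResolventCompl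
  have hF : 0 < F := hE.trans_le hEF
  refine iSup_le fun σ => iSup_le fun hσ => iSup_le fun hσF =>
    le_ofReal_div_mul_of_forall_lt hE hF fun c hc hcE => ?_
  have hc1 : c ≤ 1 := le_of_mul_le_mul_right (by rw [one_mul]; exact (hcE.trans_le hEF).le) hF
  obtain ⟨hσ0, hσ1⟩ := isState_iff.1 hσ
  obtain ⟨ρ, hρ, hle, hρE⟩ := hQ.exists_isState_smul_le hlow hσ0 hσ1.le hc hc1 hF.le hσF hcE
  exact (hQ.mul_trConj_predual_le hΦ hσ.1 hρ.1 hc hle).trans (energy_predual_le_maxEnergy hρ hρE)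

theorem antitoneOn_maxEnergy_div (hΦ : IsNormalMap Φ) (hlow : HasApproxKernel (sqrtOp G hG))
    (hfin : ∀ E > 0, maxEnergy Φ G hG E < ⊤) :
    AntitoneOn (fun E => (maxEnergy Φ G hG E).toReal / E) (Set.Ioi 0) := by
  intro E (hE : 0 < E) F (hF : 0 < F) hEF
  have h := ENNReal.toReal_mono (ENNReal.mul_ne_top ENNReal.ofReal_ne_top (hfin E hE).ne)
    (maxEnergy_le_ofReal_div_mul hΦ hlow hE hEF)
  rw [ENNReal.toReal_mul, ENNReal.toReal_ofReal (by positivity)] at h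
  exact (div_le_iff₀ hF).2 (h.trans_eq (by ring))

theorem exists_tendsto_maxEnergy_div (hΦ : IsNormalMap Φ) (hlow : HasApproxKernel (sqrtOp G hG))
    (hfin : ∀ E > 0, maxEnergy Φ G hG E < ⊤) :
    ∃ k, Tendsto (fun E => (maxEnergy Φ G hG E).toReal / E) atTop (𝓝 k) := by
  have hpos (E : ℝ) : 0 < max E 1 := lt_max_of_lt_right one_pos
  have hanti : Antitone fun E : ℝ => (maxEnergy Φ G hG (max E 1)).toReal / max E 1 :=
    fun E F h => antitoneOn_maxEnergy_div hΦ hlow hfin (hpos E) (hpos F) (max_le_max_right 1 h)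
  refine ⟨_, (tendsto_atTop_ciInf hanti ⟨0, ?_⟩).congr' ?_⟩
  · rintro _ ⟨E, rfl⟩
    exact div_nonneg ENNReal.toReal_nonneg (hpos E).le
  · filter_upwards [eventually_ge_atTop 1] with E hE
    rw [max_eq_left hE]

theorem energy_predual_ketBra_le (hΦ : IsNormalMap Φ) (hlow : HasApproxKernel (sqrtOp G hG))
    {E : ℝ} (hE : 0 < E) (hfin : maxEnergy Φ G hG E < ⊤) (φ : (sqrtOp G hG).domain)
    (hφ : ‖(φ : H)‖ = 1) :
    energy G hG (predual Φ (ketBra (φ : H))) ≤ ENNReal.ofReal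
      ((maxEnergy Φ G hG E).toReal + (maxEnergy Φ G hG E).toReal / E * ‖sqrtOp G hG φ‖ ^ 2) := by
  obtain ⟨Q, hQ⟩ := (sqrtOp_spec G hG).posSelfAdjoint.exists_isResolventCompl
  set F := ‖sqrtOp G hG φ‖ ^ 2 + E with hF
  have hφF : energy G hG (ketBra (φ : H)) ≤ ENNReal.ofReal F := by
    rw [energy, hQ.trConj_ketBra, sqNorm_of_mem φ.2, enorm_sq_eq_ofReal]
    exact ENNReal.ofReal_le_ofReal (le_add_of_nonneg_right hE.le)
  calc energy G hG (predual Φ (ketBra (φ : H)))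
      ≤ maxEnergy Φ G hG F := energy_predual_le_maxEnergy (isState_ketBra hφ) hφF
    _ ≤ ENNReal.ofReal (F / E) * maxEnergy Φ G hG E :=
        maxEnergy_le_ofReal_div_mul hΦ hlow hE (le_add_of_nonneg_left (sq_nonneg _))
    _ = ENNReal.ofReal (F / E * (maxEnergy Φ G hG E).toReal) := by
        rw [ENNReal.ofReal_mul (by positivity), ENNReal.ofReal_toReal hfin.ne]
    _ = _ := by
        congr 1
        rw [hF]
        field_simp
        ring

theorem IsResolventCompl.relBoundedWith_extend (hQ : IsResolventCompl (sqrtOp G hG) Q)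
    (hΦ : IsNormalMap Φ) (hpres : PreservesFiniteEnergy Φ (sqrtOp G hG))
    (hlow : HasApproxKernel (sqrtOp G hG)) {E : ℝ} (hE : 0 < E) (hfin : maxEnergy Φ G hG E < ⊤)
    {A : BG G hG} {a b : ℝ} (hA : RelBoundedWith (sqrtOp G hG) A.1 a b) :
    RelBoundedWith (sqrtOp G hG) (hQ.extend hΦ hpres A).1
      √(‖Φ 1‖ * (a ^ 2 * ‖Φ 1‖ + b ^ 2 * (maxEnergy Φ G hG E).toReal))
      (√((maxEnergy Φ G hG E).toReal / E * ‖Φ 1‖) * b) :=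
  hQ.relBoundedWith_extendOnDomain hΦ hpres hA ENNReal.toReal_nonneg (by positivity)
    (energy_predual_ketBra_le hΦ hlow hE hfin)

theorem IsResolventCompl.relBound_extend_le (hQ : IsResolventCompl (sqrtOp G hG) Q)
    (hΦ : IsNormalMap Φ) (hpres : PreservesFiniteEnergy Φ (sqrtOp G hG))
    (hlow : HasApproxKernel (sqrtOp G hG)) (hfin : ∀ E > 0, maxEnergy Φ G hG E < ⊤) {k : ℝ}
    (hk : Tendsto (fun E => (maxEnergy Φ G hG E).toReal / E) atTop (𝓝 k)) (A : BG G hG) :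
    relBound (sqrtOp G hG) (hQ.extend hΦ hpres A) ≤
      √(k * ‖Φ 1‖) * relBound (sqrtOp G hG) A := by
  refine le_mul_relBound (Real.sqrt_nonneg _) fun a b _ hb hA => ?_
  refine ge_of_tendsto (((hk.mul_const ‖Φ 1‖).sqrt).mul_const b) ?_
  filter_upwards [eventually_gt_atTop 0] with E hE
  exact relBound_le (Real.sqrt_nonneg _) (by positivity)
    (hQ.relBoundedWith_extend hΦ hpres hlow hE (hfin E hE) hA)

theorem eNorm_nonneg (E : ℝ) (A : BG G hG) : 0 ≤ eNorm G hG E A := by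
  refine Real.sSup_nonneg ?_
  rintro _ ⟨ρ, -, -, rfl⟩
  positivity

theorem eNorm_le {E C : ℝ} (hC : 0 ≤ C) {A : BG G hG}
    (h : ∀ ρ : H →L[ℂ] H, IsState ρ → energy G hG ρ ≤ ENNReal.ofReal E →
      trConj ⟨(sqrtOp G hG).domain, A.1⟩ ρ ≤ ENNReal.ofReal (C ^ 2)) :
    eNorm G hG E A ≤ C := by
  refine Real.sSup_le ?_ hC
  rintro _ ⟨ρ, hρ, hE, rfl⟩
  rw [Real.sqrt_le_left hC]
  exact ENNReal.toReal_le_of_le_ofReal (by positivity) (h ρ hρ hE)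

theorem exists_trConj_le (A : BG G hG) (E : ℝ) :
    ∃ C : ℝ≥0∞, C ≠ ⊤ ∧ ∀ ρ : H →L[ℂ] H, IsState ρ → energy G hG ρ ≤ ENNReal.ofReal E →
      trConj ⟨(sqrtOp G hG).domain, A.1⟩ ρ ≤ C := by
  obtain ⟨a, b, -, -, hA⟩ := A.2
  refine ⟨ENNReal.ofReal (a ^ 2) * 1 + ENNReal.ofReal (b ^ 2) * ENNReal.ofReal E, by finiteness,
    fun ρ hρ hE => ?_⟩
  refine (trConj_le_of_relBoundedWith (ne_top_of_le_ne_top ENNReal.ofReal_ne_top hE) hA).trans ?_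
  rw [(isState_iff.1 hρ).2]
  exact add_le_add_right (mul_le_mul_right hE _) _

theorem trConj_le_eNorm_sq {E : ℝ} (A : BG G hG) (hρ : IsState ρ)
    (hE : energy G hG ρ ≤ ENNReal.ofReal E) :
    trConj ⟨(sqrtOp G hG).domain, A.1⟩ ρ ≤ ENNReal.ofReal (eNorm G hG E A ^ 2) := by
  obtain ⟨C, hC, hle⟩ := exists_trConj_le A E
  have hsqrt : √(trConj ⟨(sqrtOp G hG).domain, A.1⟩ ρ).toReal ≤ eNorm G hG E A := by
    refine le_csSup ⟨√C.toReal, ?_⟩ ⟨ρ, hρ, hE, rfl⟩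
    rintro _ ⟨ρ', hρ', hE', rfl⟩
    exact Real.sqrt_le_sqrt (ENNReal.toReal_mono hC (hle ρ' hρ' hE'))
  rw [ENNReal.le_ofReal_iff_toReal_le (ne_top_of_le_ne_top hC (hle ρ hρ hE)) (by positivity)]
  rwa [Real.sqrt_le_left (eNorm_nonneg E A)] at hsqrt

theorem mul_trConj_le_eNorm_sq (A : BG G hG) (hσ : 0 ≤ σ) (hσE : energy G hG σ ≠ ⊤)
    (hρ : IsState ρ) {E : ℝ} (hρE : energy G hG ρ ≤ ENNReal.ofReal E) {c : ℝ} (hc : 0 ≤ c)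
    (h : (c : ℂ) • σ ≤ ρ) :
    ENNReal.ofReal c * trConj ⟨(sqrtOp G hG).domain, A.1⟩ σ ≤
      ENNReal.ofReal (eNorm G hG E A ^ 2) := by
  obtain ⟨Q, hQ⟩ := (sqrtOp_spec G hG).posSelfAdjoint.exists_isResolventCompl
  exact (hQ.mul_trConj_le hσ hρ.1.1 hσE (ne_top_of_le_ne_top ENNReal.ofReal_ne_top hρE) hc h
    A).trans (trConj_le_eNorm_sq A hρ hρE)

theorem trConj_le_div_mul_eNorm_sq (hlow : HasApproxKernel (sqrtOp G hG)) (A : BG G hG)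
    (hσ : 0 ≤ σ) (htr : posTrace σ 1 ≤ 1) {E F : ℝ} (hE : 0 < E) (hEF : E ≤ F)
    (hσF : energy G hG σ ≤ ENNReal.ofReal F) :
    trConj ⟨(sqrtOp G hG).domain, A.1⟩ σ ≤
      ENNReal.ofReal (F / E) * ENNReal.ofReal (eNorm G hG E A ^ 2) := by
  obtain ⟨Q, hQ⟩ := (sqrtOp_spec G hG).posSelfAdjoint.exists_isResolventCompl
  have hF : 0 < F := hE.trans_le hEF
  refine le_ofReal_div_mul_of_forall_lt hE hF fun c hc hcE => ?_
  have hc1 : c ≤ 1 := le_of_mul_le_mul_right (by rw [one_mul]; exact (hcE.trans_le hEF).le) hF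
  obtain ⟨ρ, hρ, hle, hρE⟩ := hQ.exists_isState_smul_le hlow hσ htr hc hc1 hF.le hσF hcE
  exact mul_trConj_le_eNorm_sq A hσ (ne_top_of_le_ne_top ENNReal.ofReal_ne_top hσF) hρ hρE hc hle

theorem isState_inv_smul (hσ : IsPosTraceClass σ) (h0 : posTrace σ 1 ≠ 0) :
    IsState ((((posTrace σ 1).toReal⁻¹ : ℝ) : ℂ) • σ) := by
  have htop := (isPosTraceClass_iff.1 hσ).2
  have hpos : 0 < (posTrace σ 1).toReal := ENNReal.toReal_pos h0 htop
  have hinv : 0 ≤ (posTrace σ 1).toReal⁻¹ := inv_nonneg.2 hpos.le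
  refine isState_iff.2 ⟨smul_nonneg_of_real hinv hσ.1, ?_⟩
  rw [posTrace_smul_left hinv hσ.1 zero_le_one, ENNReal.ofReal_inv_of_pos hpos,
    ENNReal.ofReal_toReal htop, ENNReal.inv_mul_cancel h0 htop]

theorem trConj_le_eNorm_sq_of_energy_eq_zero (A : BG G hG) (hσ : 0 ≤ σ) (htr : posTrace σ 1 ≤ 1)
    (hσE : energy G hG σ = 0) (E : ℝ) :
    trConj ⟨(sqrtOp G hG).domain, A.1⟩ σ ≤ ENNReal.ofReal (eNorm G hG E A ^ 2) := by
  obtain ⟨Q, hQ⟩ := (sqrtOp_spec G hG).posSelfAdjoint.exists_isResolventCompl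
  have hσE' : energy G hG σ ≠ ⊤ := hσE.trans_ne ENNReal.zero_ne_top
  have htop : posTrace σ 1 ≠ ⊤ := ne_top_of_le_ne_top ENNReal.one_ne_top htr
  by_cases ht : posTrace σ 1 = 0
  · obtain ⟨a, b, -, -, hA⟩ := A.2
    refine (trConj_le_of_relBoundedWith hσE' hA).trans ?_
    rw [ht, ← energy, hσE, mul_zero, mul_zero, add_zero]
    exact zero_le
  have hpos : 0 < (posTrace σ 1).toReal := ENNReal.toReal_pos ht htop
  have hinv : 0 ≤ (posTrace σ 1).toReal⁻¹ := inv_nonneg.2 hpos.le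
  have hle : ((1 : ℝ) : ℂ) • σ ≤ (((posTrace σ 1).toReal⁻¹ : ℝ) : ℂ) • σ := by
    rw [← sub_nonneg, ← sub_smul, ← Complex.ofReal_sub]
    exact smul_nonneg_of_real (sub_nonneg.2 ((one_le_inv₀ hpos).2
      (ENNReal.toReal_le_of_le_ofReal zero_le_one (by rwa [ENNReal.ofReal_one])))) hσ
  have hE : energy G hG ((((posTrace σ 1).toReal⁻¹ : ℝ) : ℂ) • σ) ≤ ENNReal.ofReal E := by
    rw [energy, hQ.trConj_smul hinv hσ, ← energy, hσE, mul_zero]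
    exact zero_le
  simpa only [ENNReal.ofReal_one, one_mul] using mul_trConj_le_eNorm_sq A hσ hσE'
    (isState_inv_smul (isPosTraceClass_iff.2 ⟨hσ, htop⟩) ht) hE zero_le_one hle

theorem trConj_le_eNorm_sq_of_posTrace_le_one (hlow : HasApproxKernel (sqrtOp G hG))
    (A : BG G hG) (hσ : 0 ≤ σ) (htr : posTrace σ 1 ≤ 1) {E : ℝ}
    (hσE : energy G hG σ ≤ ENNReal.ofReal E) :
    trConj ⟨(sqrtOp G hG).domain, A.1⟩ σ ≤ ENNReal.ofReal (eNorm G hG E A ^ 2) := by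
  rcases le_or_gt E 0 with hE | hE
  · rw [ENNReal.ofReal_of_nonpos hE] at hσE
    exact trConj_le_eNorm_sq_of_energy_eq_zero A hσ htr (le_antisymm hσE zero_le) E
  · simpa only [div_self hE.ne', ENNReal.ofReal_one, one_mul] using
      trConj_le_div_mul_eNorm_sq hlow A hσ htr hE le_rfl hσE

theorem eNorm_le_sqrt_max_mul (hlow : HasApproxKernel (sqrtOp G hG)) (A : BG G hG) {E : ℝ}
    (hE : 0 < E) (F : ℝ) : eNorm G hG F A ≤ √(max 1 (F / E)) * eNorm G hG E A := by
  refine eNorm_le (mul_nonneg (Real.sqrt_nonneg _) (eNorm_nonneg E A)) fun ρ hρ hρF => ?_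
  rw [mul_pow, Real.sq_sqrt (le_max_of_le_left zero_le_one)]
  rcases le_total F E with h | h
  · exact (trConj_le_eNorm_sq A hρ (hρF.trans (ENNReal.ofReal_le_ofReal h))).trans
      (ENNReal.ofReal_le_ofReal (le_mul_of_one_le_left (sq_nonneg _) (le_max_left _ _)))
  · obtain ⟨hρ0, hρ1⟩ := isState_iff.1 hρ
    refine (trConj_le_div_mul_eNorm_sq hlow A hρ0 hρ1.le hE h hρF).trans ?_
    rw [← ENNReal.ofReal_mul (div_nonneg (hE.le.trans h) hE.le)]
    exact ENNReal.ofReal_le_ofReal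
      (mul_le_mul_of_nonneg_right (le_max_right _ _) (sq_nonneg _))

theorem IsResolventCompl.eNorm_extend_le (hQ : IsResolventCompl (sqrtOp G hG) Q)
    (hΦ : IsNormalMap Φ) (hsub : Φ 1 ≤ 1) (hpres : PreservesFiniteEnergy Φ (sqrtOp G hG))
    (hlow : HasApproxKernel (sqrtOp G hG)) {E : ℝ} (hfin : maxEnergy Φ G hG E < ⊤)
    (A : BG G hG) :
    eNorm G hG E (hQ.extend hΦ hpres A) ≤
      √‖Φ 1‖ * eNorm G hG (maxEnergy Φ G hG E).toReal A := by
  refine eNorm_le (mul_nonneg (Real.sqrt_nonneg _) (eNorm_nonneg _ _)) fun ρ hρ hρE => ?_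
  refine (hQ.trConj_extendOnDomain_le hΦ hpres A hρ.1
    (ne_top_of_le_ne_top ENNReal.ofReal_ne_top hρE)).trans ?_
  rw [mul_pow, Real.sq_sqrt (norm_nonneg _), ENNReal.ofReal_mul (norm_nonneg _), ofReal_norm]
  have htr : posTrace (predual Φ ρ) 1 ≤ 1 := by
    rw [hΦ.posTrace_predual hρ.1 zero_le_one]
    exact (posTrace_mono_right ρ hsub).trans_eq (isState_iff.1 hρ).2
  refine mul_le_mul_right (trConj_le_eNorm_sq_of_posTrace_le_one hlow A
    (hΦ.predual_spec hρ.1).1.1 htr ?_) _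
  rw [ENNReal.ofReal_toReal hfin.ne]
  exact energy_predual_le_maxEnergy hρ hρE

theorem sqrt_mul_eNorm_le (hlow : HasApproxKernel (sqrtOp G hG)) (A : BG G hG) {E : ℝ}
    (hE : 0 < E) (F r : ℝ) :
    √r * eNorm G hG F A ≤ √(max 1 (F / E) * r) * eNorm G hG E A := by
  rw [Real.sqrt_mul (le_max_of_le_left zero_le_one), mul_comm √(max _ _), mul_assoc]
  exact mul_le_mul_of_nonneg_left (eNorm_le_sqrt_max_mul hlow A hE F) (Real.sqrt_nonneg _)

theorem isENormContinuous_of_le {E M : ℝ}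
    (h : ∀ A, eNorm G hG E (ofBounded _ (Φ A)) ≤ M * eNorm G hG E (ofBounded _ A)) :
    IsENormContinuous Φ G hG E := by
  intro A₀ ε hε
  refine ⟨ε / (|M| + 1), by positivity, fun A hA => ?_⟩
  rw [lt_div_iff₀ (by positivity)] at hA
  have hn := eNorm_nonneg E (ofBounded (sqrtOp G hG) (A - A₀))
  calc eNorm G hG E (ofBounded _ (Φ A - Φ A₀))
      ≤ M * eNorm G hG E (ofBounded _ (A - A₀)) := by rw [← map_sub]; exact h _
    _ ≤ eNorm G hG E (ofBounded _ (A - A₀)) * (|M| + 1) := by nlinarith [le_abs_self M]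
    _ < ε := hA

theorem IsLimited.isENormContinuous (hlim : IsLimited Φ G hG) (hΦ : IsNormalMap Φ)
    (hsub : Φ 1 ≤ 1) (hlow : HasApproxKernel (sqrtOp G hG)) {E : ℝ} (hE : 0 < E) :
    IsENormContinuous Φ G hG E := by
  obtain ⟨Q, hQ⟩ := (sqrtOp_spec G hG).posSelfAdjoint.exists_isResolventCompl
  have hpres := hlim.preservesFiniteEnergy hΦ
  refine isENormContinuous_of_le
    (M := √(max 1 ((maxEnergy Φ G hG E).toReal / E) * ‖Φ 1‖)) fun A => ?_
  rw [← hQ.extend_ofBounded hΦ hpres]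
  exact (hQ.eNorm_extend_le hΦ hsub hpres hlow (hlim.maxEnergy_lt_top hΦ E) _).trans
    (sqrt_mul_eNorm_le hlow _ hE _ _)

end Estimates

/-! ### Stinespring representations -/

section Amplification

variable {H : Type*} [NormedAddCommGroup H] [InnerProductSpace ℂ H]
  {K : Type*} [NormedAddCommGroup K] [InnerProductSpace ℂ K]

theorem denseRange_toComplL :
    DenseRange (UniformSpace.Completion.toComplL : H ⊗[ℂ] K →L[ℂ] HTensor H K) :=
  UniformSpace.Completion.denseRange_coe

/-- The bounded operator `φ ↦ φ ⊗ ψ`; it carries the linearity and continuity of `pureTensor φ ψ`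
in `φ`. -/
noncomputable def tensorRight (H : Type*) [NormedAddCommGroup H] [InnerProductSpace ℂ H] (ψ : K) :
    H →L[ℂ] HTensor H K :=
  UniformSpace.Completion.toComplL ∘L (TensorProduct.mkL ℂ H K).flip ψ

theorem tensorRight_apply (φ : H) (ψ : K) : tensorRight H ψ φ = pureTensor φ ψ := rfl

variable (H K) in
/-- The set of the vectors `φ ⊗ ψ`, whose linear span is the algebraic tensor product inside the
Hilbert space one. -/
def pureTensors : Set (HTensor H K) := Set.range fun p : H × K => pureTensor p.1 p.2

theorem pureTensor_mem_pureTensors (φ : H) (ψ : K) : pureTensor φ ψ ∈ pureTensors H K :=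
  ⟨(φ, ψ), rfl⟩

theorem inner_pureTensor (φ φ' : H) (ψ ψ' : K) :
    ⟪pureTensor φ ψ, pureTensor φ' ψ'⟫_ℂ = ⟪φ, φ'⟫_ℂ * ⟪ψ, ψ'⟫_ℂ := by
  rw [pureTensor, pureTensor, UniformSpace.Completion.inner_coe, TensorProduct.inner_tmul]

theorem ampl_pureTensor (A : H →L[ℂ] H) (φ : H) (ψ : K) :
    ampl K A (pureTensor φ ψ) = pureTensor (A φ) ψ :=
  ContinuousLinearMap.extend_eq (UniformSpace.Completion.toComplL.comp (A.rTensor K))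
    denseRange_toComplL (UniformSpace.Completion.isUniformInducing_coe _) (φ ⊗ₜ[ℂ] ψ)

theorem htensor_ext {F : Type*} [NormedAddCommGroup F] [NormedSpace ℂ F]
    {T T' : HTensor H K →L[ℂ] F}
    (h : ∀ φ ψ, T (pureTensor φ ψ) = T' (pureTensor φ ψ)) : T = T' :=
  let ι : H ⊗[ℂ] K →L[ℂ] HTensor H K := UniformSpace.Completion.toComplL
  have hι : T.toLinearMap ∘ₗ ι.toLinearMap = T'.toLinearMap ∘ₗ ι.toLinearMap :=
    TensorProduct.ext' h
  DFunLike.coe_injective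
    (UniformSpace.Completion.ext T.continuous T'.continuous (DFunLike.congr_fun hι))

theorem eq_zero_of_inner_pureTensor {x : HTensor H K} (h : ∀ φ ψ, ⟪x, pureTensor φ ψ⟫_ℂ = 0) :
    x = 0 := by
  have hx : innerSL ℂ x = 0 := htensor_ext fun φ ψ => by
    rw [innerSL_apply_apply, h, zero_apply]
  rw [← inner_self_eq_zero (𝕜 := ℂ), ← innerSL_apply_apply, hx, zero_apply]

theorem dense_span_pureTensors :
    Dense (Submodule.span ℂ (pureTensors H K) : Set (HTensor H K)) := by
  rw [Submodule.dense_iff_topologicalClosure_eq_top, Submodule.topologicalClosure_eq_top_iff,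
    Submodule.eq_bot_iff]
  intro x hx
  rw [Submodule.mem_orthogonal'] at hx
  exact eq_zero_of_inner_pureTensor fun φ ψ =>
    hx _ (Submodule.subset_span (pureTensor_mem_pureTensors φ ψ))

theorem ampl_mul (A B : H →L[ℂ] H) : ampl K (A * B) = ampl K A * ampl K B :=
  htensor_ext fun φ ψ => by simp only [mul_apply_eq_comp, ampl_pureTensor]

theorem ampl_one : ampl K (1 : H →L[ℂ] H) = 1 :=
  htensor_ext fun φ ψ => by rw [ampl_pureTensor, one_apply_eq_self, one_apply_eq_self]

theorem ampl_sub (A B : H →L[ℂ] H) : ampl K (A - B) = ampl K A - ampl K B :=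
  htensor_ext fun φ ψ => by
    simp only [sub_apply, ampl_pureTensor]
    exact map_sub (tensorRight H ψ) (A φ) (B φ)

theorem ampl_one_sub (Q : H →L[ℂ] H) : ampl K (1 - Q) = 1 - ampl K Q := by
  rw [ampl_sub, ampl_one]

theorem ampl_one_sub_add_ampl (Q : H →L[ℂ] H) (u : HTensor H K) :
    ampl K (1 - Q) u + ampl K Q u = u := by
  rw [ampl_one_sub, sub_apply, one_apply_eq_self, sub_add_cancel]

theorem ampl_pow (A : H →L[ℂ] H) (n : ℕ) : ampl K (A ^ n) = ampl K A ^ n := by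
  induction n with
  | zero => rw [pow_zero, pow_zero, ampl_one]
  | succ n ih => rw [pow_succ, pow_succ, ampl_mul, ih]

variable [CompleteSpace H]

theorem star_ampl (A : H →L[ℂ] H) : star (ampl K A) = ampl K (star A) := by
  refine htensor_ext fun φ ψ => ?_
  rw [← sub_eq_zero]
  refine eq_zero_of_inner_pureTensor fun φ' ψ' => ?_
  rw [inner_sub_left, ContinuousLinearMap.star_eq_adjoint, ContinuousLinearMap.adjoint_inner_left,
    ampl_pureTensor, ampl_pureTensor, inner_pureTensor, inner_pureTensor,
    ContinuousLinearMap.star_eq_adjoint, ContinuousLinearMap.adjoint_inner_left, sub_self]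

theorem ampl_nonneg {A : H →L[ℂ] H} (hA : 0 ≤ A) : 0 ≤ ampl K A := by
  rw [← star_sqrt_mul_sqrt hA, ampl_mul, ← star_ampl]
  exact star_mul_self_nonneg (ampl K (CFC.sqrt A))

theorem ampl_le_one {A : H →L[ℂ] H} (hA : A ≤ 1) : ampl K A ≤ 1 := by
  rw [← sub_nonneg, ← ampl_one_sub]
  exact ampl_nonneg (sub_nonneg.2 hA)

theorem ampl_injective {R : H →L[ℂ] H} (hR : 0 ≤ R) (hinj : Function.Injective R) :
    Function.Injective (ampl K R) := by
  rw [injective_iff_map_eq_zero]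
  refine fun x hx => eq_zero_of_inner_pureTensor fun φ ψ => ?_
  have hclosed : IsClosed {φ : H | ⟪x, tensorRight H ψ φ⟫_ℂ = 0} :=
    isClosed_eq (by fun_prop) continuous_const
  refine (denseRange_of_nonneg_of_injective hR hinj).induction_on
    (p := fun φ => ⟪x, tensorRight H ψ φ⟫_ℂ = 0) φ hclosed fun y => ?_
  rw [tensorRight_apply, ← ampl_pureTensor, ← inner_apply_comm_of_nonneg (ampl_nonneg hR), hx,
    inner_zero_left]

end Amplification

section RelativeAmplification

theorem toLinearPMap_graph_eq_of_le_range {R E F E' : Type*} [Ring R] [AddCommGroup E] [Module R E]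
    [AddCommGroup F] [Module R F] [AddCommGroup E'] [Module R E'] {f : E →ₗ[R] F} {g : E →ₗ[R] E'}
    (hf : Function.Injective f) {p : Submodule R (F × E')} (hp : p ≤ LinearMap.range (f.prod g)) :
    p.toLinearPMap.graph = p := by
  refine Submodule.toLinearPMap_graph_eq _ fun x hx hx0 => ?_
  obtain ⟨u, rfl⟩ := hp hx
  have hu : u = 0 := (map_eq_zero_iff f hf).1 hx0
  rw [hu, map_zero, Prod.snd_zero]

variable {H : Type*} [NormedAddCommGroup H] [InnerProductSpace ℂ H] {S : H →ₗ.[ℂ] H}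
  {Q : H →L[ℂ] H}

theorem toFun_mem_relBounded (S : H →ₗ.[ℂ] H) : S.toFun ∈ relBounded S :=
  ⟨0, 1, le_rfl, zero_le_one, fun φ => by
    rw [one_pow, one_mul, zero_pow two_ne_zero, zero_mul, zero_add, LinearPMap.toFun_eq_coe]⟩

theorem comp_mem_relBounded (C : H →L[ℂ] H) (A : relBounded S) :
    C.toLinearMap ∘ₗ A.1 ∈ relBounded S := by
  obtain ⟨a, b, ha, hb, hA⟩ := A.2
  refine ⟨‖C‖ * a, ‖C‖ * b, by positivity, by positivity, fun φ => ?_⟩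
  calc ‖C (A.1 φ)‖ ^ 2 ≤ (‖C‖ * ‖A.1 φ‖) ^ 2 := by gcongr; exact C.le_opNorm _
    _ = ‖C‖ ^ 2 * ‖A.1 φ‖ ^ 2 := mul_pow _ _ _
    _ ≤ ‖C‖ ^ 2 * (a ^ 2 * ‖(φ : H)‖ ^ 2 + b ^ 2 * ‖S φ‖ ^ 2) := by gcongr; exact hA φ
    _ = (‖C‖ * a) ^ 2 * ‖(φ : H)‖ ^ 2 + (‖C‖ * b) ^ 2 * ‖S φ‖ ^ 2 := by ring

namespace IsResolventCompl

section Lift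

variable (hQ : IsResolventCompl S Q)

include hQ

theorem lift_toFun : hQ.lift ⟨S.toFun, toFun_mem_relBounded S⟩ = Q :=
  ContinuousLinearMap.ext hQ.apply_eq

theorem lift_comp (C : H →L[ℂ] H) (A : relBounded S) :
    hQ.lift ⟨_, comp_mem_relBounded C A⟩ = C * hQ.lift A := rfl

theorem lift_add_apply (A : relBounded S) (x : S.domain) : hQ.lift A (x + S x) = A.1 x :=
  (hQ.apply_eq_lift A (hQ.left_inv x).symm).symm

theorem lift_injective : Function.Injective hQ.lift := fun A B h =>
  Subtype.ext (LinearMap.ext fun x => by rw [← hQ.lift_add_apply, h, hQ.lift_add_apply])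

-- The preimage of `C` is `C (1 + S)`.
theorem lift_surjective : Function.Surjective hQ.lift := fun C =>
  ⟨ofBounded S C + ⟨_, comp_mem_relBounded C ⟨S.toFun, toFun_mem_relBounded S⟩⟩, by
    rw [lift_add, lift_ofBounded, lift_comp, lift_toFun, ← mul_add, sub_add_cancel, mul_one]⟩

end Lift

variable [CompleteSpace H] {K : Type*} [NormedAddCommGroup K] [InnerProductSpace ℂ K]
  (hQ : IsResolventCompl S Q)

include hQ

theorem ampl_one_sub_injective : Function.Injective (ampl K (1 - Q)) :=
  ampl_injective (sub_nonneg.2 hQ.le_one) hQ.injective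

theorem graph_algAmpl (A : relBounded S) :
    (algAmpl K ⟨S.domain, A.1⟩).graph = (Submodule.span ℂ (pureTensors H K)).map
      ((ampl K (1 - Q)).toLinearMap.prod (ampl K (hQ.lift A)).toLinearMap) := by
  set F := (ampl K (1 - Q)).toLinearMap.prod (ampl K (hQ.lift A)).toLinearMap
  have hF (y : H) (ψ : K) : F (pureTensor y ψ) =
      (pureTensor ((1 - Q : H →L[ℂ] H) y) ψ, pureTensor (hQ.lift A y) ψ) :=
    Prod.ext (ampl_pureTensor _ _ _) (ampl_pureTensor _ _ _)
  have hset : {p : HTensor H K × HTensor H K | ∃ (φ : S.domain) (ψ : K),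
      p = (pureTensor (φ : H) ψ, pureTensor (A.1 φ) ψ)} = F '' pureTensors H K := by
    ext p
    constructor
    · rintro ⟨φ, ψ, rfl⟩
      refine ⟨_, pureTensor_mem_pureTensors (φ + S φ) ψ, ?_⟩
      rw [hF, hQ.left_inv, hQ.lift_add_apply]
    · rintro ⟨_, ⟨⟨y, ψ⟩, rfl⟩, rfl⟩
      exact ⟨⟨_, hQ.mem y⟩, ψ, hF y ψ⟩
  rw [Submodule.map_span, ← hset]
  refine toLinearPMap_graph_eq_of_le_range hQ.ampl_one_sub_injective
    (g := (ampl K (hQ.lift A)).toLinearMap) ?_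
  rw [Submodule.span_le]
  exact hset.trans_subset (Set.image_subset_range _ _)

theorem graph_algAmpl_topologicalClosure : (algAmpl K S).graph.topologicalClosure =
    LinearMap.range ((ampl K (1 - Q)).toLinearMap.prod (ampl K Q).toLinearMap) := by
  set F := (ampl K (1 - Q)).prod (ampl K Q)
  have hF : Topology.IsClosedEmbedding F :=
    Function.LeftInverse.isClosedEmbedding
      (f := fun p : HTensor H K × HTensor H K => p.1 + p.2)
      (ampl_one_sub_add_ampl Q) (by fun_prop) F.continuous
  have hgraph : (algAmpl K S).graph = (Submodule.span ℂ (pureTensors H K)).map F.toLinearMap := by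
    have h := hQ.graph_algAmpl (K := K) ⟨S.toFun, toFun_mem_relBounded S⟩
    rwa [hQ.lift_toFun] at h
  apply SetLike.coe_injective
  rw [hgraph, Submodule.topologicalClosure_coe, Submodule.map_coe]
  refine (hF.isClosedMap.closure_image_eq_of_continuous F.continuous _).trans ?_
  rw [dense_span_pureTensors.closure_eq, Set.image_univ]
  rfl

theorem graph_closedAmpl : (closedAmpl K S).graph =
    LinearMap.range ((ampl K (1 - Q)).toLinearMap.prod (ampl K Q).toLinearMap) := by
  have hclosable : (algAmpl K S).IsClosable :=
    ⟨_, hQ.graph_algAmpl_topologicalClosure.trans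
      (toLinearPMap_graph_eq_of_le_range hQ.ampl_one_sub_injective le_rfl).symm⟩
  rw [closedAmpl, ← hclosable.graph_closure_eq_closure_graph, hQ.graph_algAmpl_topologicalClosure]

theorem closedAmpl_ampl : IsResolventCompl (closedAmpl K S) (ampl K Q) := by
  have hgraph (y) : ∃ x : (closedAmpl K S).domain,
      (x : HTensor H K) = (1 - ampl K Q : HTensor H K →L[ℂ] HTensor H K) y ∧
        closedAmpl K S x = ampl K Q y := by
    have hy : (ampl K (1 - Q) y, ampl K Q y) ∈ (closedAmpl K S).graph := by
      rw [hQ.graph_closedAmpl]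
      exact ⟨y, rfl⟩
    rw [ampl_one_sub] at hy
    exact (LinearPMap.mem_graph_iff _).1 hy
  refine ⟨ampl_nonneg hQ.nonneg, ampl_le_one hQ.le_one, ?_, fun y => ?_, fun y => ?_, fun x => ?_⟩
  · rw [← ampl_one_sub]
    exact hQ.ampl_one_sub_injective
  · obtain ⟨x, hx, -⟩ := hgraph y
    exact hx ▸ x.2
  · obtain ⟨x, hx, hSx⟩ := hgraph y
    exact (congrArg _ (Subtype.ext hx.symm)).trans hSx
  · have h := (closedAmpl K S).mem_graph x
    rw [hQ.graph_closedAmpl] at h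
    obtain ⟨u, hu⟩ := h
    have hux : ampl K (1 - Q) u = x := congrArg Prod.fst hu
    have huS : ampl K Q u = closedAmpl K S x := congrArg Prod.snd hu
    rw [← ampl_one_sub, ← huS, ← hux]
    exact congrArg _ (ampl_one_sub_add_ampl Q u)

theorem algAmpl_le_iff (A : relBounded S) (B : relBounded (closedAmpl K S)) :
    algAmpl K ⟨S.domain, A.1⟩ ≤ ⟨(closedAmpl K S).domain, B.1⟩ ↔
      hQ.closedAmpl_ampl.lift B = ampl K (hQ.lift A) := by
  have hB (u) : (ampl K (1 - Q) u, hQ.closedAmpl_ampl.lift B u) ∈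
      LinearPMap.graph ⟨(closedAmpl K S).domain, B.1⟩ := by
    rw [ampl_one_sub]
    exact LinearPMap.mem_graph ⟨(closedAmpl K S).domain, B.1⟩ ⟨_, hQ.closedAmpl_ampl.mem u⟩
  rw [← LinearPMap.le_graph_iff, hQ.graph_algAmpl]
  constructor
  · refine fun h => htensor_ext fun y ψ => ?_
    have hyψ := h ⟨_, Submodule.subset_span (pureTensor_mem_pureTensors y ψ), rfl⟩
    exact LinearPMap.mem_graph_snd_inj _ (hB (pureTensor y ψ)) hyψ rfl
  · rintro h _ ⟨u, -, rfl⟩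
    have hu := hB u
    rwa [h] at hu

theorem existsUnique_isRelAmpl (A : relBounded S) : ∃! B, IsRelAmpl K S A.1 B := by
  obtain ⟨B, hB⟩ := hQ.closedAmpl_ampl.lift_surjective (ampl K (hQ.lift A))
  refine ⟨B.1, ⟨B.2, (hQ.algAmpl_le_iff A B).2 hB⟩, ?_⟩
  rintro C ⟨hC, hAC⟩
  have hC' := (hQ.algAmpl_le_iff A ⟨C, hC⟩).1 hAC
  exact congrArg Subtype.val (hQ.closedAmpl_ampl.lift_injective (hC'.trans hB.symm))

theorem apply_eq_ampl_lift {A : relBounded S} {B : (closedAmpl K S).domain →ₗ[ℂ] HTensor H K}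
    (hB : IsRelAmpl K S A.1 B) (x : (closedAmpl K S).domain) :
    B x = ampl K (hQ.lift A) (x + closedAmpl K S x) := by
  rw [← (hQ.algAmpl_le_iff A ⟨B, hB.1⟩).1 hB.2, lift_add_apply]

theorem tendsto_ampl_approx {A : relBounded S} {B : (closedAmpl K S).domain →ₗ[ℂ] HTensor H K}
    (hB : IsRelAmpl K S A.1 B) (x : (closedAmpl K S).domain) :
    Tendsto (fun n => ampl K (hQ.approx A n) x) atTop (𝓝 (B x)) := by
  set u : HTensor H K := x + closedAmpl K S x with hu
  have hx : ampl K (1 - Q) u = x := by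
    rw [ampl_one_sub]
    exact hQ.closedAmpl_ampl.left_inv x
  have happrox (n) : ampl K (hQ.approx A n) x = ampl K (hQ.lift A) (u - (ampl K Q ^ n) u) := by
    rw [← hx, ← mul_apply_eq_comp, ← ampl_mul, hQ.approx_mul, ampl_mul, mul_apply_eq_comp,
      ampl_one_sub, ampl_pow, sub_apply, one_apply_eq_self]
  have hQn := tendsto_pow_apply_zero hQ.closedAmpl_ampl.nonneg hQ.closedAmpl_ampl.le_one
    hQ.closedAmpl_ampl.injective u
  simp only [happrox]
  rw [hQ.apply_eq_ampl_lift hB, ← hu]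
  have h := ((ampl K (hQ.lift A)).continuous.tendsto _).comp
    ((tendsto_const_nhds (x := u)).sub hQn)
  rwa [sub_zero] at h

end IsResolventCompl

section Stinespring

variable [CompleteSpace H] {K : Type*} [NormedAddCommGroup K] [InnerProductSpace ℂ K]
  {Φ : (H →L[ℂ] H) →CP (H →L[ℂ] H)} {V : H →L[ℂ] HTensor H K}

theorem IsStinespring.quad_apply (hV : IsStinespring Φ V) (A : H →L[ℂ] H) (φ : H) :
    quad (Φ A) φ = quad (ampl K A) (V φ) := by
  rw [quad, quad, hV A, ← ContinuousLinearMap.adjoint_inner_right, ContinuousLinearMap.comp_apply,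
    ContinuousLinearMap.comp_apply]

theorem IsStinespring.sqNorm_closedAmpl (hV : IsStinespring Φ V) (hΦ : IsNormalMap Φ)
    (hQ : IsResolventCompl S Q) (φ : H) :
    sqNorm (closedAmpl K S) (V φ) = trConj S (predual Φ (ketBra φ)) := by
  rw [hQ.trConj_predual hΦ (isPosTraceClass_ketBra φ), hQ.closedAmpl_ampl.sqNorm_eq]
  refine tsum_congr fun p => ?_
  rw [posTrace_ketBra φ (hQ.map_pow_nonneg Φ _), hV.quad_apply, ampl_pow]

theorem IsStinespring.mem_closedAmpl_domain (hV : IsStinespring Φ V) (hΦ : IsNormalMap Φ)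
    (hQ : IsResolventCompl S Q) (hpres : PreservesFiniteEnergy Φ S) (φ : S.domain) :
    V φ ∈ (closedAmpl K S).domain := by
  refine mem_of_sqNorm_ne_top ?_
  rw [hV.sqNorm_closedAmpl hΦ hQ]
  exact hpres _ (isPosTraceClass_ketBra _) (hQ.trConj_ketBra_ne_top φ)

theorem IsStinespring.extend_apply (hV : IsStinespring Φ V) (hΦ : IsNormalMap Φ)
    (hQ : IsResolventCompl S Q) (hpres : PreservesFiniteEnergy Φ S) {A : relBounded S}
    {B : (closedAmpl K S).domain →ₗ[ℂ] HTensor H K} (hB : IsRelAmpl K S A.1 B) (φ : S.domain) :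
    (hQ.extend hΦ hpres A).1 φ =
      V.adjoint (B ⟨V φ, hV.mem_closedAmpl_domain hΦ hQ hpres φ⟩) := by
  refine tendsto_nhds_unique (hQ.tendsto_extendOnDomain hΦ hpres A φ) ?_
  refine ((V.adjoint.continuous.tendsto _).comp (hQ.tendsto_ampl_approx hB _)).congr fun n => ?_
  rw [hV, Function.comp_apply, ContinuousLinearMap.comp_apply, ContinuousLinearMap.comp_apply]

theorem IsStinespring.isGivenBy_extend (hV : IsStinespring Φ V) (hΦ : IsNormalMap Φ)
    (hQ : IsResolventCompl S Q) (hpres : PreservesFiniteEnergy Φ S) :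
    IsGivenBy S V (hQ.extend hΦ hpres) := fun A =>
  ⟨hQ.existsUnique_isRelAmpl A, fun _ hB φ => ⟨_, hV.extend_apply hΦ hQ hpres hB φ⟩⟩

theorem IsGivenBy.unique {Ψ Ψ' : relBounded S →ₗ[ℂ] relBounded S} (h : IsGivenBy S V Ψ)
    (h' : IsGivenBy S V Ψ') : Ψ' = Ψ := by
  refine LinearMap.ext fun A => Subtype.ext (LinearMap.ext fun φ => ?_)
  obtain ⟨B, hB, -⟩ := (h A).1
  obtain ⟨_, hφ⟩ := (h A).2 B hB φ
  obtain ⟨_, hφ'⟩ := (h' A).2 B hB φ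
  rw [hφ, hφ']

end Stinespring

end RelativeAmplification

/-! ### From continuity to limited energy -/

section FiniteRank

variable {H : Type*} [NormedAddCommGroup H] [InnerProductSpace ℂ H] [CompleteSpace H]
  {Φ : (H →L[ℂ] H) →CP (H →L[ℂ] H)} {σ : H →L[ℂ] H}

theorem opTrace_rankOne (x y : H) : opTrace (InnerProductSpace.rankOne ℂ x y) = ⟪y, x⟫_ℂ := by
  rw [opTrace, ← (stdBasis H).tsum_inner_mul_inner y x]
  refine tsum_congr fun i => ?_
  rw [InnerProductSpace.rankOne_apply, inner_smul_right]

theorem IsNormalMap.inner_predual_ketBra_apply (hΦ : IsNormalMap Φ) (φ ψ w : H) :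
    ⟪w, predual Φ (ketBra φ) ψ⟫_ℂ = ⟪φ, Φ (InnerProductSpace.rankOne ℂ ψ w) φ⟫_ℂ := by
  have hleft : predual Φ (ketBra φ) * InnerProductSpace.rankOne ℂ ψ w =
      InnerProductSpace.rankOne ℂ (predual Φ (ketBra φ) ψ) w := by
    ext x
    simp [InnerProductSpace.rankOne_apply, mul_apply_eq_comp]
  have hright : Φ (InnerProductSpace.rankOne ℂ ψ w) * ketBra φ =
      InnerProductSpace.rankOne ℂ (Φ (InnerProductSpace.rankOne ℂ ψ w) φ) φ := by
    ext x
    simp [InnerProductSpace.rankOne_apply, mul_apply_eq_comp]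
  have h := (hΦ.predual_spec (isPosTraceClass_ketBra φ)).2 (InnerProductSpace.rankOne ℂ ψ w)
  rwa [hleft, hright, opTrace_rankOne, opTrace_rankOne] at h

theorem sqrt_apply_mem_range (hσ : 0 ≤ σ) [FiniteDimensional ℂ (LinearMap.range σ.toLinearMap)]
    (x : H) : CFC.sqrt σ x ∈ LinearMap.range σ.toLinearMap := by
  rw [← Submodule.orthogonal_orthogonal (LinearMap.range σ.toLinearMap), Submodule.mem_orthogonal]
  intro y hy
  rw [Submodule.mem_orthogonal'] at hy
  have hσy : ⟪y, σ y⟫_ℂ = 0 := hy _ ⟨y, rfl⟩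
  have hsqrt : CFC.sqrt σ y = 0 := by
    rw [← inner_self_eq_zero (𝕜 := ℂ), inner_apply_comm_of_nonneg (CFC.sqrt_nonneg σ),
      sqrt_sqrt_apply hσ, hσy]
  rw [← inner_apply_comm_of_nonneg (CFC.sqrt_nonneg σ), hsqrt, inner_zero_left]

theorem trConj_ne_top_of_finiteDimensional_range {S : H →ₗ.[ℂ] H} (hσ : IsPosTraceClass σ)
    [FiniteDimensional ℂ (LinearMap.range σ.toLinearMap)] (h : ∀ x, σ x ∈ S.domain) :
    trConj S σ ≠ ⊤ := by
  obtain ⟨hσ0, hσ1⟩ := isPosTraceClass_iff.1 hσ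
  have hle : LinearMap.range σ.toLinearMap ≤ S.domain := by
    rintro _ ⟨x, rfl⟩
    exact h x
  let T := (S.toFun ∘ₗ Submodule.inclusion hle).toContinuousLinearMap
  refine ne_top_of_le_ne_top (ENNReal.mul_ne_top (a := ‖T‖ₑ ^ 2)
    (ENNReal.pow_ne_top enorm_ne_top) hσ1) ?_
  rw [trConj, posTrace_one, hsNormSq, ← ENNReal.tsum_mul_left]
  refine ENNReal.tsum_le_tsum fun i => ?_
  have hi := sqrt_apply_mem_range hσ0 (stdBasis H i)
  rw [sqNorm_of_mem (hle hi), ← mul_pow]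
  exact pow_le_pow_left' (T.le_opENorm ⟨_, hi⟩) 2

theorem mul_sqrt_eq_zero_of_posTrace_eq_zero {P : H →L[ℂ] H} (hP : IsStarProjection P)
    (h : posTrace σ P = 0) : P * CFC.sqrt σ = 0 := by
  have hnorm : hsNormSq (P * CFC.sqrt σ) = 0 := by
    rw [← posTrace_star_mul_self, hP.isSelfAdjoint.star_eq, hP.isIdempotentElem.eq, h]
  ext x
  have hx := enorm_apply_sq_le_hsNormSq (P * CFC.sqrt σ) x
  rwa [hnorm, zero_mul, nonpos_iff_eq_zero, pow_eq_zero_iff two_ne_zero, enorm_eq_zero] at hx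

theorem IsNormalMap.finiteDimensional_range_predual (hΦ : IsNormalMap Φ) {P : H →L[ℂ] H}
    (hP : IsStarProjection P) [FiniteDimensional ℂ (LinearMap.range P.toLinearMap)]
    (h : Φ 1 = Φ P) {ρ : H →L[ℂ] H} (hρ : IsPosTraceClass ρ) :
    FiniteDimensional ℂ (LinearMap.range (predual Φ ρ).toLinearMap) := by
  have htr : posTrace (predual Φ ρ) (1 - P) = 0 := by
    rw [hΦ.posTrace_predual hρ hP.one_sub.nonneg, map_sub, h, sub_self]
    simp [posTrace, quad]
  have hsqrt := mul_sqrt_eq_zero_of_posTrace_eq_zero hP.one_sub htr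
  have hPσ : P * predual Φ ρ = predual Φ ρ := by
    rw [← sub_eq_zero, ← neg_eq_zero, neg_sub, ← one_sub_mul,
      ← CFC.sqrt_mul_sqrt_self _ (hΦ.predual_spec hρ).1.1, ← mul_assoc, hsqrt, zero_mul]
  refine Submodule.finiteDimensional_of_le (S₂ := LinearMap.range P.toLinearMap) ?_
  rintro _ ⟨x, rfl⟩
  exact ⟨predual Φ ρ x, DFunLike.congr_fun hPσ x⟩

variable {K : Type*} [NormedAddCommGroup K] [InnerProductSpace ℂ K]

theorem adjoint_tensorRight_pureTensor (k : K) (x : H) (ψ : K) :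
    (tensorRight H k).adjoint (pureTensor x ψ) = ⟪k, ψ⟫_ℂ • x := by
  refine ext_inner_left ℂ fun y => ?_
  rw [ContinuousLinearMap.adjoint_inner_right, tensorRight_apply, inner_pureTensor,
    inner_smul_right, mul_comm]

theorem ampl_eq_sum {ι : Type*} [Fintype ι] (b : OrthonormalBasis ι ℂ K) (A : H →L[ℂ] H) :
    ampl K A = ∑ j, tensorRight H (b j) ∘L A ∘L (tensorRight H (b j)).adjoint := by
  refine htensor_ext fun x ψ => ?_
  let tensorLeft : K →L[ℂ] HTensor H K :=
    UniformSpace.Completion.toComplL ∘L TensorProduct.mkL ℂ H K (A x)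
  have hterm (j) : tensorRight H (b j) (A ((tensorRight H (b j)).adjoint (pureTensor x ψ))) =
      tensorLeft (⟪b j, ψ⟫_ℂ • b j) := by
    rw [adjoint_tensorRight_pureTensor, map_smul, map_smul, map_smul]
    rfl
  simp only [ampl_pureTensor, sum_apply, ContinuousLinearMap.comp_apply, hterm]
  rw [← map_sum, b.sum_repr' ψ]
  rfl

-- The operators `(tensorRight H (b j)).adjoint ∘L V` are the Kraus operators of `Φ`.
theorem IsStinespring.predual_ketBra {V : H →L[ℂ] HTensor H K} (hV : IsStinespring Φ V)
    (hΦ : IsNormalMap Φ) {ι : Type*} [Fintype ι] (b : OrthonormalBasis ι ℂ K) (φ : H) :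
    predual Φ (ketBra φ) = ∑ j, ketBra ((tensorRight H (b j)).adjoint (V φ)) := by
  ext ψ
  refine ext_inner_left ℂ fun w => ?_
  rw [hΦ.inner_predual_ketBra_apply, hV, ContinuousLinearMap.comp_apply,
    ContinuousLinearMap.adjoint_inner_right, ContinuousLinearMap.comp_apply, ampl_eq_sum b,
    sum_apply, sum_apply, inner_sum, inner_sum]
  refine Finset.sum_congr rfl fun j _ => ?_
  rw [ContinuousLinearMap.comp_apply, ContinuousLinearMap.comp_apply,
    ← ContinuousLinearMap.adjoint_inner_left, InnerProductSpace.rankOne_apply,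
    InnerProductSpace.rankOne_apply, inner_smul_right, inner_smul_right, mul_comm]

theorem IsStinespring.finiteDimensional_range_predual_ketBra [FiniteDimensional ℂ K]
    {V : H →L[ℂ] HTensor H K} (hV : IsStinespring Φ V) (hΦ : IsNormalMap Φ) (φ : H) :
    FiniteDimensional ℂ (LinearMap.range (predual Φ (ketBra φ)).toLinearMap) := by
  let b := stdOrthonormalBasis ℂ K
  let v := fun j => (tensorRight H (b j)).adjoint (V φ)
  have : FiniteDimensional ℂ (Submodule.span ℂ (Set.range v)) :=
    FiniteDimensional.span_of_finite ℂ (Set.finite_range v)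
  refine Submodule.finiteDimensional_of_le (S₂ := Submodule.span ℂ (Set.range v)) ?_
  rintro _ ⟨x, rfl⟩
  rw [hV.predual_ketBra hΦ b, ContinuousLinearMap.coe_coe, sum_apply]
  exact Submodule.sum_mem _ fun j _ =>
    Submodule.smul_mem _ _ (Submodule.subset_span ⟨j, rfl⟩)

theorem finiteDimensional_range_predual_ketBra (hΦ : IsNormalMap Φ)
    (hfin : HasFiniteChoiRank Φ ∨
      ∃ P : H →L[ℂ] H, IsStarProjection P ∧ FiniteDimensional ℂ (LinearMap.range P.toLinearMap) ∧
        Φ 1 = Φ P) (φ : H) :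
    FiniteDimensional ℂ (LinearMap.range (predual Φ (ketBra φ)).toLinearMap) := by
  rcases hfin with ⟨K, _, _, V, _, hV, -⟩ | ⟨P, hP, _, hΦP⟩
  · exact hV.finiteDimensional_range_predual_ketBra hΦ φ
  · exact hΦ.finiteDimensional_range_predual hP hΦP (isPosTraceClass_ketBra φ)

end FiniteRank

section Converse

variable {H : Type*} [NormedAddCommGroup H] [InnerProductSpace ℂ H] [CompleteSpace H]
  {S G : H →ₗ.[ℂ] H} {hG : IsPosSelfAdjoint G} {ρ : H →L[ℂ] H}
  {Φ : (H →L[ℂ] H) →CP (H →L[ℂ] H)} {E : ℝ}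

theorem IsPosSelfAdjoint.enorm_sqrt_apply_sq_le (hS : IsPosSelfAdjoint S) (hE : trConj S ρ ≠ ⊤)
    (χ : S.domain) : ‖CFC.sqrt ρ (S χ)‖ₑ ^ 2 ≤ trConj S ρ * ‖(χ : H)‖ₑ ^ 2 := by
  obtain ⟨Q, hQ⟩ := hS.exists_isResolventCompl
  set x := CFC.sqrt ρ (S χ) with hx
  have hsq := hQ.sqNorm_sqrt_le ρ x
  have hmem : CFC.sqrt ρ x ∈ S.domain := mem_of_sqNorm_ne_top
    (ne_top_of_le_ne_top (ENNReal.mul_ne_top hE (ENNReal.pow_ne_top enorm_ne_top)) hsq)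
  rw [sqNorm_of_mem hmem] at hsq
  have hinner : ⟪x, x⟫_ℂ = ⟪(χ : H), S ⟨_, hmem⟩⟫_ℂ := by
    nth_rewrite 1 [hx]
    rw [inner_apply_comm_of_nonneg (CFC.sqrt_nonneg ρ)]
    exact hS.inner_symm χ ⟨_, hmem⟩
  have hle : ‖x‖ₑ ^ 2 ≤ ‖(χ : H)‖ₑ * ‖S ⟨_, hmem⟩‖ₑ := by
    rw [enorm_sq_eq_ofReal, ← re_inner_self_eq, hinner, ← ofReal_norm, ← ofReal_norm,
      ← ENNReal.ofReal_mul (norm_nonneg _)]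
    exact ENNReal.ofReal_le_ofReal ((Complex.re_le_norm _).trans (norm_inner_le_norm _ _))
  rcases eq_or_ne x 0 with h0 | h0
  · rw [h0, enorm_zero, zero_pow two_ne_zero]
    exact zero_le
  · refine (ENNReal.mul_le_mul_iff_left (pow_ne_zero 2 (enorm_ne_zero.2 h0))
      (ENNReal.pow_ne_top enorm_ne_top)).1 ?_
    calc ‖x‖ₑ ^ 2 * ‖x‖ₑ ^ 2 ≤ (‖(χ : H)‖ₑ * ‖S ⟨_, hmem⟩‖ₑ) ^ 2 := by
          rw [← sq]
          gcongr
      _ ≤ ‖(χ : H)‖ₑ ^ 2 * (trConj S ρ * ‖x‖ₑ ^ 2) := by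
          rw [mul_pow]
          gcongr
      _ = trConj S ρ * ‖(χ : H)‖ₑ ^ 2 * ‖x‖ₑ ^ 2 := by ring

theorem IsPosSelfAdjoint.mem_domain_of_norm_inner_le (hS : IsPosSelfAdjoint S) {y : H} {r C : ℝ}
    (hr : 0 < r) (h : ∀ χ : S.domain, ‖χ‖ < r → ‖⟪y, S χ⟫_ℂ‖ ≤ C) : y ∈ S.domain := by
  let f : S.domain →ₗ[ℂ] ℂ := innerₛₗ ℂ y ∘ₗ S.toFun
  obtain ⟨M, hM⟩ := LinearMap.bound_of_ball_bound hr C f fun χ hχ =>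
    h χ (mem_ball_zero_iff.1 hχ)
  rw [← LinearPMap.isSelfAdjoint_def.1 hS.isSelfAdjoint, LinearPMap.mem_adjoint_domain_iff]
  exact AddMonoidHomClass.continuous_of_bound f M hM

theorem trConj_ofBounded_rankOne (hE : trConj S ρ ≠ ⊤) (ψ η : H) :
    trConj ⟨S.domain, (ofBounded S (InnerProductSpace.rankOne ℂ ψ η)).1⟩ ρ =
      ‖CFC.sqrt ρ η‖ₑ ^ 2 * ‖ψ‖ₑ ^ 2 := by
  rw [← tsum_enorm_inner_sq (stdBasis H), ← ENNReal.tsum_mul_right, trConj]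
  refine tsum_congr fun i => ?_
  have hmem : CFC.sqrt ρ (stdBasis H i) ∈ S.domain :=
    mem_of_sqNorm_ne_top (ENNReal.ne_top_of_tsum_ne_top hE i)
  rw [sqNorm_of_mem (T := ⟨S.domain, (ofBounded S (InnerProductSpace.rankOne ℂ ψ η)).1⟩) hmem,
    ← inner_apply_comm_of_nonneg (CFC.sqrt_nonneg ρ), enorm_inner_symm, ← mul_pow, ← enorm_smul]
  rfl

theorem eNorm_rankOne_sqrtOp_le (hE : 0 ≤ E) (ψ : H) (χ : (sqrtOp G hG).domain) :
    eNorm G hG E (ofBounded _ (InnerProductSpace.rankOne ℂ ψ (sqrtOp G hG χ))) ≤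
      √E * ‖(χ : H)‖ * ‖ψ‖ := by
  refine eNorm_le (by positivity) fun ρ _ hρE => ?_
  have hρE' : trConj (sqrtOp G hG) ρ ≠ ⊤ := ne_top_of_le_ne_top ENNReal.ofReal_ne_top hρE
  rw [trConj_ofBounded_rankOne hρE']
  calc ‖CFC.sqrt ρ (sqrtOp G hG χ)‖ₑ ^ 2 * ‖ψ‖ₑ ^ 2
      ≤ ENNReal.ofReal E * ‖(χ : H)‖ₑ ^ 2 * ‖ψ‖ₑ ^ 2 := by
        gcongr
        exact ((sqrtOp_spec G hG).posSelfAdjoint.enorm_sqrt_apply_sq_le hρE' χ).trans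
          (mul_le_mul_left hρE _)
    _ = ENNReal.ofReal ((√E * ‖(χ : H)‖ * ‖ψ‖) ^ 2) := by
        rw [mul_pow, mul_pow, Real.sq_sqrt hE, ENNReal.ofReal_mul (by positivity),
          ENNReal.ofReal_mul hE, enorm_sq_eq_ofReal, enorm_sq_eq_ofReal]

theorem norm_apply_le_eNorm (hlow : HasApproxKernel (sqrtOp G hG)) (hE : 0 < E) (A : BG G hG)
    {φ : (sqrtOp G hG).domain} (hφ : ‖(φ : H)‖ = 1) :
    ‖A.1 φ‖ ≤ √(max 1 (‖sqrtOp G hG φ‖ ^ 2 / E)) * eNorm G hG E A := by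
  have henergy : energy G hG (ketBra (φ : H)) ≤ ENNReal.ofReal (‖sqrtOp G hG φ‖ ^ 2) := by
    rw [energy, trConj_ketBra_of_mem hφ φ.2, enorm_sq_eq_ofReal]
  have h := trConj_le_eNorm_sq A (isState_ketBra hφ) henergy
  rw [trConj_ketBra_of_mem (T := ⟨(sqrtOp G hG).domain, A.1⟩) hφ φ.2, enorm_sq_eq_ofReal,
    ENNReal.ofReal_le_ofReal_iff (by positivity)] at h
  exact (le_of_sq_le_sq h (eNorm_nonneg _ _)).trans (eNorm_le_sqrt_max_mul hlow A hE _)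

theorem IsENormContinuous.exists_norm_map_apply_le (hcont : IsENormContinuous Φ G hG E)
    (hlow : HasApproxKernel (sqrtOp G hG)) (hE : 0 < E) {φ : (sqrtOp G hG).domain}
    (hφ : ‖(φ : H)‖ = 1) :
    ∃ δ > 0, ∃ C, ∀ A, eNorm G hG E (ofBounded _ A) < δ → ‖Φ A (φ : H)‖ ≤ C := by
  obtain ⟨δ, hδ, h⟩ := hcont 0 1 one_pos
  refine ⟨δ, hδ, √(max 1 (‖sqrtOp G hG φ‖ ^ 2 / E)), fun A hA => ?_⟩
  have hΦA := h A (by rwa [sub_zero])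
  rw [map_zero, sub_zero] at hΦA
  exact (norm_apply_le_eNorm hlow hE (ofBounded _ (Φ A)) hφ).trans
    (mul_le_of_le_one_right (Real.sqrt_nonneg _) hΦA.le)

-- By self-adjointness it is enough that `χ ↦ ⟪Φ_*(|φ⟩⟨φ|) ψ, √G χ⟫` is bounded. This form is
-- `⟪Φ(|ψ⟩⟨√G χ|) φ, φ⟫`, and the `E`-norm of `|ψ⟩⟨√G χ|` is at most a multiple of `‖χ‖`.
theorem IsENormContinuous.predual_ketBra_apply_mem (hcont : IsENormContinuous Φ G hG E)
    (hΦ : IsNormalMap Φ) (hlow : HasApproxKernel (sqrtOp G hG)) (hE : 0 < E)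
    {φ : (sqrtOp G hG).domain} (hφ : ‖(φ : H)‖ = 1) (ψ : H) :
    predual Φ (ketBra (φ : H)) ψ ∈ (sqrtOp G hG).domain := by
  obtain ⟨δ, hδ, C, hC⟩ := hcont.exists_norm_map_apply_le hlow hE hφ
  have hr : 0 < δ / (√E * (‖ψ‖ + 1)) := by positivity
  refine (sqrtOp_spec G hG).posSelfAdjoint.mem_domain_of_norm_inner_le hr (C := C) fun χ hχ => ?_
  rw [lt_div_iff₀ (by positivity)] at hχ
  have hsmall : eNorm G hG E
      (ofBounded _ (InnerProductSpace.rankOne ℂ ψ (sqrtOp G hG χ))) < δ :=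
    calc _ ≤ √E * ‖(χ : H)‖ * ‖ψ‖ := eNorm_rankOne_sqrtOp_le hE.le ψ χ
      _ ≤ √E * ‖(χ : H)‖ * (‖ψ‖ + 1) := by gcongr; linarith
      _ = ‖χ‖ * (√E * (‖ψ‖ + 1)) := by rw [Submodule.norm_coe]; ring
      _ < δ := hχ
  calc ‖⟪predual Φ (ketBra (φ : H)) ψ, sqrtOp G hG χ⟫_ℂ‖
      = ‖⟪(φ : H), Φ (InnerProductSpace.rankOne ℂ ψ (sqrtOp G hG χ)) φ⟫_ℂ‖ := by
        rw [norm_inner_symm, hΦ.inner_predual_ketBra_apply]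
    _ ≤ ‖(φ : H)‖ * ‖Φ (InnerProductSpace.rankOne ℂ ψ (sqrtOp G hG χ)) φ‖ :=
        norm_inner_le_norm _ _
    _ ≤ C := by rw [hφ, one_mul]; exact hC _ hsmall

theorem IsENormContinuous.isLimited (hcont : IsENormContinuous Φ G hG E) (hΦ : IsNormalMap Φ)
    (hlow : HasApproxKernel (sqrtOp G hG)) (hE : 0 < E)
    (hfin : ∀ φ, FiniteDimensional ℂ (LinearMap.range (predual Φ (ketBra φ)).toLinearMap)) :
    IsLimited Φ G hG := by
  obtain ⟨Q, hQ⟩ := (sqrtOp_spec G hG).posSelfAdjoint.exists_isResolventCompl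
  obtain ⟨C, hC, hbound⟩ := hQ.exists_trConj_predual_le hΦ fun φ hφ hφ1 =>
    have := hfin φ
    trConj_ne_top_of_finiteDimensional_range (hΦ.predual_spec (isPosTraceClass_ketBra φ)).1
      (hcont.predual_ketBra_apply_mem hΦ hlow hE (φ := ⟨φ, hφ⟩) hφ1)
  intro ρ hρ hρE
  refine (hbound ρ hρ.1 hρE.ne).trans_lt (ENNReal.mul_lt_top hC.lt_top ?_)
  rw [(isState_iff.1 hρ).2]
  exact ENNReal.add_lt_top.2 ⟨ENNReal.one_lt_top, hρE⟩

end Converse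

end EnergyOp

theorem theorem1_general {H : Type*} [NormedAddCommGroup H] [InnerProductSpace ℂ H]
    [CompleteSpace H] [Nontrivial H]
    (Φ : (H →L[ℂ] H) →CP (H →L[ℂ] H)) (hnormal : IsNormalMap Φ) (hsub : Φ 1 ≤ 1)
    (G : H →ₗ.[ℂ] H) (hG : IsPosSelfAdjoint G)
    (hG0 : sInf {r : ℝ | ∃ φ : G.domain, ‖(φ : H)‖ = 1 ∧ r = ‖G φ‖} = 0) :
    (IsLimited Φ G hG →
      (∀ E > 0, IsENormContinuous Φ G hG E) ∧
      (∀ E > 0, maxEnergy Φ G hG E < ⊤) ∧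
      ∃ (Ψ : BG G hG →ₗ[ℂ] BG G hG) (k : ℝ),
        (∀ A : H →L[ℂ] H, Ψ (ofBounded _ A) = ofBounded _ (Φ A)) ∧
        (∀ (K : Type*) [NormedAddCommGroup K] [InnerProductSpace ℂ K] (V : H →L[ℂ] HTensor H K),
          IsStinespring Φ V → IsGivenBy (sqrtOp G hG) V Ψ ∧
            ∀ Ψ' : BG G hG →ₗ[ℂ] BG G hG, IsGivenBy (sqrtOp G hG) V Ψ' → Ψ' = Ψ) ∧
        (∀ E > 0, ∀ A : BG G hG,
          eNorm G hG E (Ψ A) ≤ √‖Φ 1‖ * eNorm G hG (maxEnergy Φ G hG E).toReal A ∧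
          √‖Φ 1‖ * eNorm G hG (maxEnergy Φ G hG E).toReal A ≤
            √(max 1 ((maxEnergy Φ G hG E).toReal / E) * ‖Φ 1‖) * eNorm G hG E A) ∧
        Filter.Tendsto (fun E : ℝ => (maxEnergy Φ G hG E).toReal / E) Filter.atTop (𝓝 k) ∧
        (∀ A : BG G hG, relBound (sqrtOp G hG) (Ψ A) ≤
          √(k * ‖Φ 1‖) * relBound (sqrtOp G hG) A) ∧
        ∀ A : BG G hG, relBound (sqrtOp G hG) A = 0 → relBound (sqrtOp G hG) (Ψ A) = 0) ∧
    ((HasFiniteChoiRank Φ ∨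
        ∃ P : H →L[ℂ] H, IsStarProjection P ∧ FiniteDimensional ℂ (LinearMap.range P.toLinearMap) ∧
          Φ 1 = Φ P) →
      (∃ E > 0, IsENormContinuous Φ G hG E) → IsLimited Φ G hG) := by
  have hlow := hasApproxKernel_sqrtOp (hG := hG) hG0
  refine ⟨fun hlim => ?_, fun hrank ⟨E, hE, hcont⟩ =>
    hcont.isLimited hnormal hlow hE (finiteDimensional_range_predual_ketBra hnormal hrank)⟩
  obtain ⟨Q, hQ⟩ := (sqrtOp_spec G hG).posSelfAdjoint.exists_isResolventCompl
  have hpres := hlim.preservesFiniteEnergy hnormal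
  have hfin E (_ : E > 0) := hlim.maxEnergy_lt_top hnormal E
  obtain ⟨k, hk⟩ := exists_tendsto_maxEnergy_div hnormal hlow hfin
  have hbound := hQ.relBound_extend_le hnormal hpres hlow hfin hk
  refine ⟨fun E hE => hlim.isENormContinuous hnormal hsub hlow hE, hfin, hQ.extend hnormal hpres, k,
    hQ.extend_ofBounded hnormal hpres, fun K _ _ V hV => ?_, fun E hE A => ⟨?_, ?_⟩, hk, hbound,
    fun A hA => ?_⟩
  · have hgiven := hV.isGivenBy_extend hnormal hQ hpres
    exact ⟨hgiven, fun _ => hgiven.unique⟩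
  · exact hQ.eNorm_extend_le hnormal hsub hpres hlow (hfin E hE) A
  · exact sqrt_mul_eNorm_le hlow A hE _ _
  · exact le_antisymm ((hbound A).trans_eq (by rw [hA, mul_zero])) (relBound_nonneg _)

theorem theorem1 {H : Type*} [NormedAddCommGroup H] [InnerProductSpace ℂ H]
    [CompleteSpace H] [TopologicalSpace.SeparableSpace H] (hdim : ¬ FiniteDimensional ℂ H)
    (Φ : (H →L[ℂ] H) →CP (H →L[ℂ] H)) (hnormal : IsNormalMap Φ) (hsub : Φ 1 ≤ 1)
    (G : H →ₗ.[ℂ] H) (hG : IsPosSelfAdjoint G)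
    (hG0 : sInf {r : ℝ | ∃ φ : G.domain, ‖(φ : H)‖ = 1 ∧ r = ‖G φ‖} = 0) :
    -- Part A
    (IsLimited Φ G hG →
      (∀ E > 0, IsENormContinuous Φ G hG E) ∧
      (∀ E > 0, maxEnergy Φ G hG E < ⊤) ∧
      ∃ (Ψ : BG G hG →ₗ[ℂ] BG G hG) (k : ℝ),
        (∀ A : H →L[ℂ] H, Ψ (ofBounded _ A) = ofBounded _ (Φ A)) ∧
        (∀ (K : Type*) [NormedAddCommGroup K] [InnerProductSpace ℂ K] [CompleteSpace K]
          [TopologicalSpace.SeparableSpace K] (V : H →L[ℂ] HTensor H K), IsStinespring Φ V →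
          IsGivenBy (sqrtOp G hG) V Ψ ∧
            ∀ Ψ' : BG G hG →ₗ[ℂ] BG G hG, IsGivenBy (sqrtOp G hG) V Ψ' → Ψ' = Ψ) ∧
        (∀ E > 0, ∀ A : BG G hG,
          eNorm G hG E (Ψ A) ≤ √‖Φ 1‖ * eNorm G hG (maxEnergy Φ G hG E).toReal A ∧
          √‖Φ 1‖ * eNorm G hG (maxEnergy Φ G hG E).toReal A ≤
            √(max 1 ((maxEnergy Φ G hG E).toReal / E) * ‖Φ 1‖) * eNorm G hG E A) ∧
        Filter.Tendsto (fun E : ℝ => (maxEnergy Φ G hG E).toReal / E) Filter.atTop (𝓝 k) ∧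
        (∀ A : BG G hG, relBound (sqrtOp G hG) (Ψ A) ≤
          √(k * ‖Φ 1‖) * relBound (sqrtOp G hG) A) ∧
        ∀ A : BG G hG, relBound (sqrtOp G hG) A = 0 → relBound (sqrtOp G hG) (Ψ A) = 0) ∧
    -- Part B
    (IsDiscreteOp G →
      (HasFiniteChoiRank Φ ∨
        ∃ P : H →L[ℂ] H, IsStarProjection P ∧ FiniteDimensional ℂ (LinearMap.range P.toLinearMap) ∧
          Φ 1 = Φ P) →
      (∃ E > 0, IsENormContinuous Φ G hG E) → IsLimited Φ G hG) := by
  have : Nontrivial H := not_subsingleton_iff_nontrivial.1 fun _ => hdim inferInstance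
  obtain ⟨hA, hB⟩ := theorem1_general Φ hnormal hsub G hG hG0
  refine ⟨fun hlim => ?_, fun _ => hB⟩
  obtain ⟨hcont, hfin, Ψ, k, hext, hgiven, h⟩ := hA hlim
  exact ⟨hcont, hfin, Ψ, k, hext, fun K _ _ _ _ => hgiven K, h⟩
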